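/- Let $K\ge 1$ and let $S_1,\dots,S_K\subset\mathbb S^3$ be compact oriented smooth embedded surfaces with boundary in the round unit three-sphere, whose boundaries $\gamma_k=\partial S_k$ are pairwise disjoint knots. Assume that for $k\neq l$ the surface $S_k$ is transverse to $\gamma_l$ and $S_k\cap S_l$ has zero area. Let $\alpha_1,\dots,\alpha_K\in(0,1)$ and consider the singular magnetic potential $\boldsymbol A=\sum_{k=1}^K 2\pi\alpha_k[S_k]$. Put $\Omega=\mathbb S^3\setminus\bigcup_k S_k$. Let $\mathcal D_{\boldsymbol A}^{(\min)}$ be the operator in $L^2(\mathbb S^3)^2=L^2(\mathbb S^3;\mathbb C^2)$ which acts on $\Omega$ like the free Dirac operator $\boldsymbol\sigma(-i\nabla)$ of $\mathbb S^3$ ($\nabla$ being the spin connection and $\boldsymbol\sigma$ the Clifford map on the trivial spinor bundle $\mathbb S^3\times\mathbb C^2$), with domain $$\Big\{\psi\in H^1(\Omega)^2:\ \psi|_{(S_k)_+}=e^{-2i\pi\alpha_k}\,\psi|_{(S_k)_-}\in H^{1/2}_{\mathrm{loc}}\Big(S_k\setminus\Big(\bigcup_{l\ne k}S_l\cup\gamma_k\Big)\Big)^2,\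 1\le k\le K\Big\},$$ where $\psi|_{(S_k)_\pm}$ are the traces of $\psi$ on the two sides of $S_k$ (the normal of $S_k$ points to the $+$ side). Then $\mathcal D_{\boldsymbol A}^{(\min)}$ is densely defined, and $$\ker\Big(\mathcal D_{\boldsymbol A}^{(\min)}\big(\mathcal D_{\boldsymbol A}^{(\min)}\big)^*\Big)=\ker\Big(\big(\mathcal D_{\boldsymbol A}^{(\min)}\big)^*\Big),$$ and this space is infinite dimensional. Here $\mathcal D_{\boldsymbol A}^{(\min)}(\mathcal D_{\boldsymbol A}^{(\min)})^*$ has its natural domain, the set of all $\psi\in\operatorname{dom}((\mathcal D_{\boldsymbol A}^{(\min)})^*)$ with $(\mathcal D_{\boldsymbol A}^{(\min)})^*\psi\in\operatorname{dom}(\mathcal D_{\boldsymbol A}^{(\min)})$. -/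

import Mathlib

open MeasureTheory Set Topology Filter
open scoped ContDiff

noncomputable section

namespace MagneticLink

/-! ### The round three-sphere, its measure, a global frame, spinors -/

/-- The Euclidean space `ℝ⁴`. -/
abbrev E4 : Type := EuclideanSpace ℝ (Fin 4)

/-- The unit sphere `𝕊³ ⊂ ℝ⁴`. -/
abbrev S3 : Type := Metric.sphere (0 : E4) 1

/-- The Riemannian volume measure of the round sphere `𝕊³`. -/
abbrev vol3 : Measure S3 := (volume : Measure E4).toSphere

/-- Surface area on `𝕊³`: the two-dimensional Hausdorff measure, normalised so that it agrees
with Lebesgue measure on planes. On smooth surfaces it is the Riemannian area. -/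
abbrev area : Measure S3 := μHE[2]

/-- The global orthonormal frame `X₁(p) = i p`, `X₂(p) = j p`, `X₃(p) = k p` of `T𝕊³`
(multiplication by the imaginary quaternion units, `ℝ⁴ = ℍ`). These are divergence-free (Killing)
fields with `[X₁, X₂] = -2 X₃` and cyclically. -/
def frame (j : Fin 3) (p : E4) : E4 :=
  match j with
  | 0 => !₂[-p 1, p 0, -p 3, p 2]
  | 1 => !₂[-p 2, p 3, p 0, -p 1]
  | 2 => !₂[-p 3, -p 2, p 1, p 0]

/-- The derivative `X_j φ` along the frame, for (the restriction to `𝕊³` of) a smooth function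
on `ℝ⁴`; as `X_j` is tangent to the sphere this depends on `φ|_{𝕊³}` only. -/
def frameDeriv (j : Fin 3) (φ : E4 → ℝ) (p : E4) : ℝ := fderiv ℝ φ p (frame j p)

/-- The spinor fibre `ℂ²`. -/
abbrev Spinor : Type := EuclideanSpace ℂ (Fin 2)

/-- The Hilbert space `L²(𝕊³)²` of sections of the trivial spinor bundle `𝕊³ × ℂ²`. -/
abbrev L2 : Type := Lp Spinor 2 vol3

/-- The Pauli matrices. -/
def pauli (j : Fin 3) : Matrix (Fin 2) (Fin 2) ℂ :=
  match j with
  | 0 => !![0, 1; 1, 0]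
  | 1 => !![0, -Complex.I; Complex.I, 0]
  | 2 => !![1, 0; 0, -1]

/-- Clifford multiplication `𝛔(X_j^♭)` on `L²(𝕊³)²`. In the frame `X₁, X₂, X₃` it is pointwise
multiplication by the Pauli matrix `σ_j`. -/
def clifford (j : Fin 3) : L2 →L[ℂ] L2 :=
  (Matrix.toEuclideanCLM (n := Fin 2) (𝕜 := ℂ) (pauli j)).compLpL 2 vol3

/-! ### Oriented compact surfaces with boundary in the three-sphere, knots -/

/-- `h = 0` is a regular equation on the open set `U` for the set `S`, and the gradient of `h`
along `S` is a positive multiple of `N`. -/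
structure IsLocalEquation (S : Set S3) (N : S3 → E4) (U : Set S3) (h : E4 → ℝ) : Prop where
  smooth : ContDiff ℝ ∞ h
  mem_iff : ∀ p ∈ U, p ∈ S ↔ h p = 0
  gradient : ∀ p ∈ U, p ∈ S → ∃ c : ℝ, 0 < c ∧
    ∀ v : E4, inner ℝ (p : E4) v = 0 → fderiv ℝ h p v = c * inner ℝ (N p) v

/-- `p` is an interior point of the surface `S` with normal `N`: near `p`, `S` is a regular
level set. -/
def IsInteriorPoint (S : Set S3) (N : S3 → E4) (p : S3) : Prop :=
  p ∈ S ∧ ∃ (U : Set S3) (h : E4 → ℝ), IsOpen U ∧ p ∈ U ∧ IsLocalEquation S N U h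

/-- `p` is a boundary point of the surface `S` with normal `N`: near `p`, `S` is the half
`{h = 0, b ≥ 0}` of a regular level set `{h = 0}` (with gradient along `N` on `S`), where
`b p = 0` and `dh`, `db` are linearly independent on `T_p𝕊³`. -/
def IsBoundaryPoint (S : Set S3) (N : S3 → E4) (p : S3) : Prop :=
  p ∈ S ∧ ∃ (U : Set S3) (h b : E4 → ℝ), IsOpen U ∧ p ∈ U ∧
    ContDiff ℝ ∞ h ∧ ContDiff ℝ ∞ b ∧
    (∀ q ∈ U, q ∈ S ↔ h q = 0 ∧ 0 ≤ b q) ∧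
    (∀ q ∈ U, q ∈ S → ∃ c : ℝ, 0 < c ∧
      ∀ v : E4, inner ℝ (q : E4) v = 0 → fderiv ℝ h q v = c * inner ℝ (N q) v) ∧
    b p = 0 ∧
    ∃ v : E4, inner ℝ (p : E4) v = 0 ∧ fderiv ℝ h p v = 0 ∧ fderiv ℝ b p v ≠ 0

/-- A compact smooth embedded surface with boundary in `𝕊³`, oriented by a unit normal field
(only the values of the normal on the surface matter). -/
structure OrientedSurface where
  /-- the underlying set -/
  carrier : Set S3
  /-- the unit normal -/
  normal : S3 → E4
  isCompact : IsCompact carrier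
  norm_normal : ∀ p ∈ carrier, ‖normal p‖ = 1
  normal_tangent : ∀ p ∈ carrier, inner ℝ (p : E4) (normal p) = 0
  local_form : ∀ p ∈ carrier,
    IsInteriorPoint carrier normal p ∨ IsBoundaryPoint carrier normal p

/-- The boundary `∂S` of a surface. -/
def OrientedSurface.boundary (S : OrientedSurface) : Set S3 :=
  {p | IsBoundaryPoint S.carrier S.normal p}

/-- A knot: a smoothly embedded circle in `𝕊³`. -/
def IsKnot (γ : Set S3) : Prop :=
  ∃ c : ℝ → E4, ContDiff ℝ ∞ c ∧ (∀ t, c (t + 1) = c t) ∧ InjOn c (Ico 0 1) ∧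
    (∀ t, deriv c t ≠ 0) ∧ range c = Subtype.val '' γ

/-- `v` is the velocity at `p` of a smooth curve running in `γ`. -/
def IsTangentTo (γ : Set S3) (p : S3) (v : E4) : Prop :=
  ∃ c : ℝ → E4, ContDiff ℝ ∞ c ∧ (∀ t, c t ∈ Subtype.val '' γ) ∧ c 0 = p ∧ deriv c 0 = v

/-- Transversality in `𝕊³` of a surface and a curve `γ`: at every common point some tangent vector
of `γ` is not tangent to the surface. -/
def OrientedSurface.TransverseTo (S : OrientedSurface) (γ : Set S3) : Prop :=
  ∀ p ∈ S.carrier ∩ γ, ∃ v : E4, IsTangentTo γ p v ∧ inner ℝ (S.normal p) v ≠ 0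

/-- A family of Seifert surfaces `S_k` for the components `γ_k = ∂S_k` of a link: the `γ_k` are
pairwise disjoint knots, `S_k` is transverse to `γ_l` for `k ≠ l`, and different surfaces meet in
sets of zero area only (which is automatic if they are in general position). -/
structure IsSeifertFamily {K : ℕ} (S : Fin K → OrientedSurface) : Prop where
  knot : ∀ k, IsKnot (S k).boundary
  disjoint_boundary : ∀ k l, k ≠ l → Disjoint (S k).boundary (S l).boundary
  transverse : ∀ k l, k ≠ l → (S k).TransverseTo (S l).boundary
  area_inter : ∀ k l, k ≠ l → area ((S k).carrier ∩ (S l).carrier) = 0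

/-! ### Sobolev spaces and traces -/

/-- `φ|_{𝕊³}` is a (real) test function on the open set `Ω ⊆ 𝕊³`: it is smooth and its support is
a (compact) subset of `Ω`. -/
def IsTest (Ω : Set S3) (φ : E4 → ℝ) : Prop :=
  ContDiff ℝ ∞ φ ∧ tsupport (fun p : S3 => φ p) ⊆ Ω

/-- `g`, extended by zero off the open set `Ω`, is the weak derivative `X_j ψ` of `ψ` on `Ω`. -/
def HasWeakDeriv (Ω : Set S3) (j : Fin 3) (ψ g : L2) : Prop :=
  (∀ᵐ p ∂vol3, p ∉ Ω → g p = 0) ∧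
  ∀ φ : E4 → ℝ, IsTest Ω φ →
    ∫ p in Ω, φ p • g p ∂vol3 = - ∫ p in Ω, frameDeriv j φ p • ψ p ∂vol3

/-- `τ ∈ H^{1/2}_loc(W)²` for a relatively open part `W` of a smooth surface: on compact subsets `C`
of `W`, both `τ` and the Gagliardo quotient `|τ(p) - τ(q)| / |p - q|^{3/2}` are square
integrable. -/
def MemHHalfLoc (W : Set S3) (τ : S3 → Spinor) : Prop :=
  ∀ C ⊆ W, IsCompact C →
    MemLp τ 2 (area.restrict C) ∧
    MemLp (fun z : S3 × S3 => (dist z.1 z.2 ^ (-(3 / 2 : ℝ))) • (τ z.1 - τ z.2)) 2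
      ((area.restrict C).prod (area.restrict C))

/-- `τ` is the trace, from the side `s = 1` (the side into which the normal points) or from the side
`s = -1` of `S`, of the `H¹` function `ψ` whose derivatives along the frame off the surfaces
are `g`; here `R` is a closed set near which nothing is asked. The trace is characterised by
Green's formula on the one-sided neighbourhoods `{s h > 0}` of pieces of `S`. -/
def HasTrace (S : OrientedSurface) (R : Set S3) (s : ℝ) (ψ : L2) (g : Fin 3 → L2)
    (τ : S3 → Spinor) : Prop :=
  ∀ (U : Set S3) (h : E4 → ℝ), IsOpen U → Disjoint U R →
    IsLocalEquation S.carrier S.normal U h →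
    ∀ φ : E4 → ℝ, IsTest U φ → ∀ j : Fin 3,
      IntegrableOn (fun p : S3 => (φ p * inner ℝ (S.normal p) (frame j p)) • τ p)
        (S.carrier ∩ U) area ∧
      ∫ p in {p : S3 | p ∈ U ∧ 0 < s * h p}, (φ p • g j p + frameDeriv j φ p • ψ p) ∂vol3 =
        (-s) • ∫ p in S.carrier ∩ U, (φ p * inner ℝ (S.normal p) (frame j p)) • τ p ∂area

/-- The complement `Ω = 𝕊³ ∖ ⋃ S_k` of the surfaces. -/
def complSurfaces {K : ℕ} (S : Fin K → OrientedSurface) : Set S3 := (⋃ k, (S k).carrier)ᶜ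

/-- The set `⋃_{l ≠ k} S_l ∪ γ_k` removed from `S_k` in the jump condition. -/
def removedSet {K : ℕ} (S : Fin K → OrientedSurface) (k : Fin K) : Set S3 :=
  (⋃ l ∈ {l | l ≠ k}, (S l).carrier) ∪ (S k).boundary

/-- The phase jump condition `ψ|_{(S_k)₊} = e^{-2iπα_k} ψ|_{(S_k)₋} ∈ H^{1/2}_loc`, on
`S_k ∖ (⋃_{l ≠ k} S_l ∪ γ_k)`. -/
def PhaseJump {K : ℕ} (S : Fin K → OrientedSurface) (α : Fin K → ℝ) (k : Fin K)
    (ψ : L2) (g : Fin 3 → L2) : Prop :=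
  ∃ τp τm : S3 → Spinor,
    HasTrace (S k) (removedSet S k) 1 ψ g τp ∧
    HasTrace (S k) (removedSet S k) (-1) ψ g τm ∧
    MemHHalfLoc ((S k).carrier \ removedSet S k) τp ∧
    MemHHalfLoc ((S k).carrier \ removedSet S k) τm ∧
    ∀ᵐ p ∂(area.restrict ((S k).carrier \ removedSet S k)),
      τp p = Complex.exp (-(2 * Complex.I * Real.pi * α k)) • τm p

/-! ### The Dirac operators -/

/-- The spin connection in the frame: `∇_{X_j} ψ = X_j ψ + (i/2) σ_j ψ`, where `gj = X_j ψ`. This is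
the connection on `𝕊³ × ℂ²` induced by the Levi-Civita connection `∇_{X_i} X_j = -ε_{ijk} X_k`. -/
def spinCov (j : Fin 3) (ψ gj : L2) : L2 := gj + (Complex.I / 2) • clifford j ψ

/-- The free Dirac expression `𝛔(-i∇)ψ = -i ∑_j σ_j ∇_{X_j} ψ`, where `g j = X_j ψ`. -/
def diracExpr (ψ : L2) (g : Fin 3 → L2) : L2 :=
  ∑ j, (-Complex.I) • clifford j (spinCov j ψ (g j))

lemma IsTest.continuous_frameDeriv {Ω : Set S3} {φ : E4 → ℝ} (hφ : IsTest Ω φ) (j : Fin 3) :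
    Continuous (fun p : S3 => frameDeriv j φ p) := by
  have h1 : Continuous (fderiv ℝ φ) := hφ.1.continuous_fderiv (by simp)
  have h2 : Continuous (frame j) := by
    fin_cases j <;> (unfold frame; simp only []; fun_prop)
  exact (h1.clm_apply h2).comp continuous_subtype_val

lemma integrable_smul (φ : S3 → ℝ) (hφ : Continuous φ) (g : L2) :
    Integrable (fun p => φ p • g p) vol3 := by
  obtain ⟨C, hC⟩ := isCompact_univ.exists_bound_of_continuousOn hφ.continuousOn
  exact ((Lp.memLp g).integrable (by norm_num)).bdd_smul C hφ.aestronglyMeasurable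
    (Eventually.of_forall fun p => hC p (mem_univ p))

lemma IsTest.integrable {Ω : Set S3} {φ : E4 → ℝ} (hφ : IsTest Ω φ) (g : L2) :
    Integrable (fun p : S3 => φ p • g p) vol3 :=
  integrable_smul _ (hφ.1.continuous.comp continuous_subtype_val) g

lemma IsTest.integrable_frameDeriv {Ω : Set S3} {φ : E4 → ℝ} (hφ : IsTest Ω φ) (j : Fin 3)
    (g : L2) : Integrable (fun p : S3 => frameDeriv j φ p • g p) vol3 :=
  integrable_smul _ (hφ.continuous_frameDeriv j) g

lemma HasWeakDeriv.zero (Ω : Set S3) (j : Fin 3) : HasWeakDeriv Ω j 0 0 := by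
  refine ⟨?_, fun φ _ => ?_⟩
  · filter_upwards [Lp.coeFn_zero Spinor 2 vol3] with p hp _
    simpa using hp
  · have h (f : S3 → ℝ) : ∫ p in Ω, f p • (0 : L2) p ∂vol3 = 0 := by
      rw [integral_eq_zero_of_ae]
      filter_upwards [ae_restrict_of_ae (Lp.coeFn_zero Spinor 2 vol3)] with p hp
      rw [hp]
      simp only [Pi.zero_apply, smul_zero]
    rw [h, h, neg_zero]

lemma HasWeakDeriv.add {Ω : Set S3} {j : Fin 3} {ψ g ψ' g' : L2} (h : HasWeakDeriv Ω j ψ g)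
    (h' : HasWeakDeriv Ω j ψ' g') : HasWeakDeriv Ω j (ψ + ψ') (g + g') := by
  refine ⟨?_, fun φ hφ => ?_⟩
  · filter_upwards [Lp.coeFn_add g g', h.1, h'.1] with p hp h1 h2 hpΩ
    rw [hp, Pi.add_apply, h1 hpΩ, h2 hpΩ, add_zero]
  · have key (f : S3 → ℝ) (hf : Continuous f) (u v : L2) :
        ∫ p in Ω, f p • (u + v) p ∂vol3 =
          ∫ p in Ω, f p • u p ∂vol3 + ∫ p in Ω, f p • v p ∂vol3 := by
      rw [← integral_add (integrable_smul f hf u).integrableOn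
        (integrable_smul f hf v).integrableOn]
      refine integral_congr_ae ?_
      filter_upwards [ae_restrict_of_ae (Lp.coeFn_add u v)] with p hp
      rw [hp, Pi.add_apply, smul_add]
    rw [key (fun p => φ p) (hφ.1.continuous.comp continuous_subtype_val), key _ (hφ.continuous_frameDeriv j),
      h.2 φ hφ, h'.2 φ hφ, neg_add]

lemma HasWeakDeriv.smul {Ω : Set S3} {j : Fin 3} {ψ g : L2} (a : ℂ) (h : HasWeakDeriv Ω j ψ g) :
    HasWeakDeriv Ω j (a • ψ) (a • g) := by
  refine ⟨?_, fun φ hφ => ?_⟩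
  · filter_upwards [Lp.coeFn_smul a g, h.1] with p hp h1 hpΩ
    rw [hp, Pi.smul_apply, h1 hpΩ, smul_zero]
  · have key (f : S3 → ℝ) (u : L2) :
        ∫ p in Ω, f p • (a • u) p ∂vol3 = a • ∫ p in Ω, f p • u p ∂vol3 := by
      rw [← integral_smul]
      refine integral_congr_ae ?_
      filter_upwards [ae_restrict_of_ae (Lp.coeFn_smul a u)] with p hp
      rw [hp, Pi.smul_apply, smul_comm a]
    rw [key, key, h.2 φ hφ, smul_neg]

lemma HasTrace.zero (S : OrientedSurface) (R : Set S3) (s : ℝ) :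
    HasTrace S R s 0 (fun _ => 0) (fun _ => 0) := by
  intro U h _ _ _ φ _ j
  refine ⟨by simp, ?_⟩
  simp only [smul_zero, integral_zero]
  rw [integral_eq_zero_of_ae]
  filter_upwards [ae_restrict_of_ae (Lp.coeFn_zero Spinor 2 vol3)] with p hp
  rw [hp]
  simp only [Pi.zero_apply, smul_zero, add_zero]

lemma HasTrace.add {S : OrientedSurface} {R : Set S3} {s : ℝ} {ψ ψ' : L2} {g g' : Fin 3 → L2}
    {τ τ' : S3 → Spinor} (h₁ : HasTrace S R s ψ g τ) (h₂ : HasTrace S R s ψ' g' τ') :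
    HasTrace S R s (ψ + ψ') (fun j => g j + g' j) (fun p => τ p + τ' p) := by
  intro U h hU hR hh φ hφ j
  obtain ⟨i₁, e₁⟩ := h₁ U h hU hR hh φ hφ j
  obtain ⟨i₂, e₂⟩ := h₂ U h hU hR hh φ hφ j
  simp only [smul_add]
  refine ⟨i₁.add i₂, ?_⟩
  have key (V : Set S3) : ∫ p in V, (φ p • (g j + g' j) p + frameDeriv j φ p • (ψ + ψ') p) ∂vol3 =
      ∫ p in V, (φ p • g j p + frameDeriv j φ p • ψ p) ∂vol3 +
      ∫ p in V, (φ p • g' j p + frameDeriv j φ p • ψ' p) ∂vol3 := by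
    rw [← integral_add (f := fun p : S3 => φ p • g j p + frameDeriv j φ p • ψ p)
      (g := fun p : S3 => φ p • g' j p + frameDeriv j φ p • ψ' p)
      ((hφ.integrable (g j)).add (hφ.integrable_frameDeriv j ψ)).integrableOn
      ((hφ.integrable (g' j)).add (hφ.integrable_frameDeriv j ψ')).integrableOn]
    refine integral_congr_ae ?_
    filter_upwards [ae_restrict_of_ae (Lp.coeFn_add ψ ψ'),
      ae_restrict_of_ae (Lp.coeFn_add (g j) (g' j))] with p hp hp'
    rw [hp, hp', Pi.add_apply, Pi.add_apply, smul_add, smul_add]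
    abel
  rw [integral_add i₁ i₂, smul_add, ← e₁, ← e₂, key]

lemma HasTrace.smul {S : OrientedSurface} {R : Set S3} {s : ℝ} {ψ : L2} {g : Fin 3 → L2}
    {τ : S3 → Spinor} (a : ℂ) (h₁ : HasTrace S R s ψ g τ) :
    HasTrace S R s (a • ψ) (fun j => a • g j) (fun p => a • τ p) := by
  intro U h hU hR hh φ hφ j
  obtain ⟨i₁, e₁⟩ := h₁ U h hU hR hh φ hφ j
  simp only [smul_comm _ a]
  refine ⟨i₁.smul a, ?_⟩
  rw [integral_smul, smul_comm _ a, ← e₁, ← integral_smul]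
  refine integral_congr_ae ?_
  filter_upwards [ae_restrict_of_ae (Lp.coeFn_smul a ψ),
    ae_restrict_of_ae (Lp.coeFn_smul a (g j))] with p hp hp'
  rw [hp, hp', Pi.smul_apply, Pi.smul_apply, smul_add, smul_comm _ a, smul_comm _ a]

lemma MemHHalfLoc.zero (W : Set S3) : MemHHalfLoc W (fun _ => 0) := by
  intro C _ _
  simp

lemma MemHHalfLoc.add {W : Set S3} {τ τ' : S3 → Spinor} (h : MemHHalfLoc W τ)
    (h' : MemHHalfLoc W τ') : MemHHalfLoc W (fun p => τ p + τ' p) := by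
  intro C hC hC'
  refine ⟨(h C hC hC').1.add (h' C hC hC').1, ?_⟩
  convert (h C hC hC').2.add (h' C hC hC').2 using 1
  ext1 z
  simp only [Pi.add_apply, ← smul_add]
  congr 1
  abel

lemma MemHHalfLoc.smul {W : Set S3} {τ : S3 → Spinor} (a : ℂ) (h : MemHHalfLoc W τ) :
    MemHHalfLoc W (fun p => a • τ p) := by
  intro C hC hC'
  refine ⟨(h C hC hC').1.const_smul a, ?_⟩
  have e : (fun z : S3 × S3 => (dist z.1 z.2 ^ (-(3 / 2 : ℝ))) • (a • τ z.1 - a • τ z.2)) =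
      a • fun z : S3 × S3 => (dist z.1 z.2 ^ (-(3 / 2 : ℝ))) • (τ z.1 - τ z.2) := by
    ext1 z
    rw [Pi.smul_apply, ← smul_sub, smul_comm a]
  rw [e]
  exact (h C hC hC').2.const_smul a

/-- The graph of the minimal operator `𝒟_𝑨^{(min)}`: the pairs `(ψ, 𝛔(-i∇)ψ)` with
`ψ ∈ H¹(Ω)²` satisfying the phase jump condition across every `S_k`. -/
def diracMinGraph {K : ℕ} (S : Fin K → OrientedSurface) (α : Fin K → ℝ) :
    Submodule ℂ (L2 × L2) where
  carrier := {x | ∃ g : Fin 3 → L2, (∀ j, HasWeakDeriv (complSurfaces S) j x.1 (g j)) ∧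
    (∀ k, PhaseJump S α k x.1 g) ∧ x.2 = diracExpr x.1 g}
  zero_mem' := by
    refine ⟨fun _ => 0, fun j => HasWeakDeriv.zero _ j, fun k => ?_, ?_⟩
    · exact ⟨fun _ => 0, fun _ => 0, HasTrace.zero _ _ _, HasTrace.zero _ _ _,
        MemHHalfLoc.zero _, MemHHalfLoc.zero _, by simp⟩
    · simp [diracExpr, spinCov]
  add_mem' := by
    rintro x y ⟨g, hg, hj, hx⟩ ⟨g', hg', hj', hy⟩
    refine ⟨fun j => g j + g' j, fun j => (hg j).add (hg' j), fun k => ?_, ?_⟩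
    · obtain ⟨p, m, a1, a2, a3, a4, a5⟩ := hj k
      obtain ⟨p', m', b1, b2, b3, b4, b5⟩ := hj' k
      refine ⟨_, _, a1.add b1, a2.add b2, a3.add b3, a4.add b4, ?_⟩
      filter_upwards [a5, b5] with q h1 h2
      rw [h1, h2, smul_add]
    · simp only [Prod.fst_add, Prod.snd_add, hx, hy, diracExpr, spinCov,
        ← Finset.sum_add_distrib, map_add, smul_add]
      refine Finset.sum_congr rfl fun j _ => ?_
      abel
  smul_mem' := by
    rintro a x ⟨g, hg, hj, hx⟩
    refine ⟨fun j => a • g j, fun j => (hg j).smul a, fun k => ?_, ?_⟩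
    · obtain ⟨p, m, a1, a2, a3, a4, a5⟩ := hj k
      refine ⟨_, _, a1.smul a, a2.smul a, a3.smul a, a4.smul a, ?_⟩
      filter_upwards [a5] with q h1
      rw [h1, smul_comm]
    · simp only [Prod.smul_fst, Prod.smul_snd, hx, diracExpr, spinCov, Finset.smul_sum, map_add,
        map_smul, smul_add]
      refine Finset.sum_congr rfl fun j _ => ?_
      simp only [smul_comm a]

/-- The minimal operator `𝒟_𝑨^{(min)}` for `𝑨 = ∑_k 2πα_k [S_k]`: it acts like the free Dirac
operator on `Ω = 𝕊³ ∖ ⋃ S_k`, on the domain `H¹_𝑨(𝕊³)²` of all `ψ ∈ H¹(Ω)²` with the phase jump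
`e^{-2iπα_k}` across `S_k`. (Its graph is single-valued, see `diracMin_graph`.) -/
def diracMin {K : ℕ} (S : Fin K → OrientedSurface) (α : Fin K → ℝ) : L2 →ₗ.[ℂ] L2 :=
  (diracMinGraph S α).toLinearPMap

lemma complSurfaces_isOpen {K : ℕ} (S : Fin K → OrientedSurface) : IsOpen (complSurfaces S) :=
  (isClosed_iUnion_of_finite fun k => (S k).isCompact.isClosed).isOpen_compl

/-- A weak derivative of `0` vanishes. -/
lemma HasWeakDeriv.eq_zero {Ω : Set S3} (hΩ : IsOpen Ω) {j : Fin 3} {g : L2}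
    (h : HasWeakDeriv Ω j 0 g) : g = 0 := by
  have hint (φ : E4 → ℝ) (hφ : IsTest Ω φ) : ∫ p, φ p • g p ∂vol3 = 0 := by
    have e := h.2 φ hφ
    have e0 : ∫ p in Ω, frameDeriv j φ p • (0 : L2) p ∂vol3 = 0 := by
      rw [integral_eq_zero_of_ae]
      filter_upwards [ae_restrict_of_ae (Lp.coeFn_zero Spinor 2 vol3)] with p hp
      rw [hp]
      simp only [Pi.zero_apply, smul_zero]
    rw [e0, neg_zero] at e
    rw [← e, eq_comm]
    refine setIntegral_eq_integral_of_forall_compl_eq_zero fun p hp => ?_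
    have : φ p = 0 := by
      by_contra hne
      exact hp (hφ.2 (subset_tsupport (fun p : S3 => φ p) hne))
    simp [this]
  have hgi : Integrable g vol3 := (Lp.memLp g).integrable (by norm_num)
  have hK (K : Set S3) (hKc : IsCompact K) (hKΩ : K ⊆ Ω) : ∫ p in K, g p ∂vol3 = 0 := by
    obtain ⟨O, hO, rfl⟩ := isOpen_induced_iff.1 hΩ
    set K' : Set E4 := Subtype.val '' K with hK'
    have hK'c : IsCompact K' := hKc.image continuous_subtype_val
    have hK'O : K' ⊆ O := image_subset_iff.2 hKΩ
    obtain ⟨δ, δpos, hδ⟩ := hK'c.exists_cthickening_subset_open hO hK'O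
    obtain ⟨u, -, u_pos, u_lim⟩ : ∃ u : ℕ → ℝ, StrictAnti u ∧ (∀ n, u n ∈ Ioo 0 δ) ∧
        Tendsto u atTop (𝓝 0) := exists_seq_strictAnti_tendsto' δpos
    have hex (n : ℕ) : ∃ f : E4 → ℝ, ContDiff ℝ ∞ f ∧ range f ⊆ Icc 0 1 ∧
        Function.support f = Metric.thickening (u n) K' ∧ ∀ x ∈ K', f x = 1 := by
      obtain ⟨f, h1, h2, h3, h4⟩ := exists_contMDiff_support_eq_eq_one_iff
        (n := (⊤ : ℕ∞)) (modelWithCornersSelf ℝ E4)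
        Metric.isOpen_thickening hK'c.isClosed (Metric.self_subset_thickening (u_pos n).1 K')
      exact ⟨f, h1.contDiff, h2, h3, fun x hx => (h4 x).1 hx⟩
    choose f f_diff f_range f_supp f_one using hex
    have f_test (n : ℕ) : IsTest (Subtype.val ⁻¹' O) (f n) := by
      refine ⟨f_diff n, ?_⟩
      refine (closure_minimal ?_ (Metric.isClosed_cthickening.preimage
        continuous_subtype_val)).trans (preimage_mono hδ)
      intro p hp
      have hp' : (p : E4) ∈ Function.support (f n) := hp
      rw [f_supp] at hp'
      exact Metric.thickening_subset_cthickening_of_le (u_pos n).2.le _ hp'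
    have L : Tendsto (fun n => ∫ p : S3, f n p • g p ∂vol3) atTop (𝓝 (∫ p in K, g p ∂vol3)) := by
      rw [← integral_indicator hKc.measurableSet]
      refine tendsto_integral_of_dominated_convergence (fun p => ‖g p‖)
        (fun n => ((f_test n).integrable g).aestronglyMeasurable) hgi.norm (fun n => ?_) ?_
      · refine Eventually.of_forall fun p => ?_
        have := f_range n (mem_range_self (f := f n) (p : E4))
        rw [norm_smul, Real.norm_of_nonneg this.1]
        exact mul_le_of_le_one_left (norm_nonneg _) this.2
      · refine Eventually.of_forall fun p => ?_
        by_cases hp : p ∈ K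
        · have (n : ℕ) : f n p = 1 := f_one n p (mem_image_of_mem _ hp)
          simp [this, indicator_of_mem hp]
        · rw [indicator_of_notMem hp]
          apply tendsto_const_nhds.congr'
          have hpK : (p : E4) ∉ K' := by
            rintro ⟨q, hq, hqp⟩
            exact hp (Subtype.val_injective hqp ▸ hq)
          obtain ⟨ε, εpos, hε⟩ : ∃ ε, 0 < ε ∧ (p : E4) ∉ Metric.thickening ε K' := by
            rw [← hK'c.isClosed.closure_eq, Metric.closure_eq_iInter_thickening K'] at hpK
            simpa using hpK
          filter_upwards [(tendsto_order.1 u_lim).2 ε εpos] with n hn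
          have : f n p = 0 := by
            rw [← Function.notMem_support, f_supp]
            exact fun h' => hε (Metric.thickening_mono hn.le _ h')
          simp [this]
    simp only [hint _ (f_test _), tendsto_const_nhds_iff] at L
    exact L.symm
  have hall : ∀ᵐ p ∂vol3, p ∈ Ω → g p = 0 := by
    obtain ⟨F, hFc, hFΩ, hFU, -⟩ := hΩ.exists_iUnion_isClosed
    have hn (n : ℕ) : ∀ᵐ p ∂vol3, p ∈ F n → g p = 0 := by
      rw [← ae_restrict_iff' (hFc n).measurableSet]
      refine ae_eq_zero_of_forall_setIntegral_isCompact_eq_zero hgi.integrableOn fun s hs => ?_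
      rw [Measure.restrict_restrict hs.measurableSet]
      exact hK _ (hs.inter_right (hFc n)) (inter_subset_right.trans (hFΩ n))
    filter_upwards [ae_all_iff.2 hn] with p hp hpΩ
    rw [← hFU] at hpΩ
    obtain ⟨n, hpn⟩ := mem_iUnion.1 hpΩ
    exact hp n hpn
  refine (Lp.eq_zero_iff_ae_eq_zero).2 ?_
  filter_upwards [h.1, hall] with p h1 h2
  by_cases hp : p ∈ Ω
  · exact h2 hp
  · exact h1 hp

/-- `diracMin` really is the operator with graph `diracMinGraph`. -/
theorem diracMin_graph {K : ℕ} (S : Fin K → OrientedSurface) (α : Fin K → ℝ) :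
    (diracMin S α).graph = diracMinGraph S α := by
  refine Submodule.toLinearPMap_graph_eq _ ?_
  rintro ⟨x, y⟩ ⟨g, hg, -, hy⟩ (rfl : x = 0)
  have h0 (j : Fin 3) : g j = 0 := (hg j).eq_zero (complSurfaces_isOpen S)
  simp only at hy ⊢
  simp [hy, diracExpr, spinCov, h0]

/-! ### Unbounded operators -/

/-- The composition `T ∘ R` of unbounded operators, on its natural domain
`{x ∈ dom R : R x ∈ dom T}`. -/
def compOp (T R : L2 →ₗ.[ℂ] L2) : L2 →ₗ.[ℂ] L2 where
  domain := (T.domain.comap R.toFun).map R.domain.subtype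
  toFun := T.toFun.comp
    ((R.toFun.comp (Submodule.inclusion (Submodule.map_subtype_le _ _))).codRestrict T.domain (by
      rintro ⟨_, x, hx, rfl⟩
      exact hx))

/-- The kernel of an unbounded operator, as a subspace of `L²(𝕊³)²`. -/
def kerOp (T : L2 →ₗ.[ℂ] L2) : Submodule ℂ L2 :=
  (LinearMap.ker T.toFun).map T.domain.subtype

end MagneticLink

end

/-!
# Infinitely many zero modes of the adjoint of the minimal Dirac operator

Write `T = 𝒟_𝑨^{(min)}`. In the global frame `X_j` the free Dirac operator is `P + 3/2` with
`P = -i ∑ σ_j X_j`, and the commutators of the frame give the Lichnerowicz formula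
`(P + 1)² = 1 - ∑ X_j²`. The equality of the kernels is the identity `⟨T T*ψ, ψ⟩ = ‖T*ψ‖²`
(`kerOp_compOp_adjoint`). The infinite dimension comes from three facts.

*The domain of the closure of `T` is contained in `H¹(Ω)²`.* Off the link `⋃ γ_k`, multiplication by
a product of unimodular step functions, one for each surface, removes the phase jumps: a spinor in the
domain becomes an honest `H¹` spinor there. Across a single surface this is Green's formula for the
traces; the intersections of different surfaces have area zero and are removable for each derivative
`X_j` separately, since the integral curves of `X_j` through a set of area zero fill a set of volume
zero (`weakDeriv_gauge`, `WeakDeriv.of_area_eq_zero`). The density `|Pψ|² - |Xψ|² + 2 Re ⟨ψ, Pψ⟩`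
is gauge invariant and a divergence off the link. The link has codimension two, so it is invisible for
divergences of `L²` vector fields (`HasCutoffs.integral_eq_zero`), and truncating `ψ` makes the
vector field square integrable. The outcome `‖(P + 1)ψ‖² = ‖Xψ‖² + ‖ψ‖²` bounds `ψ` and its
derivatives by `2 ‖Tψ‖` (`IsMinPair.norm_le`). A polarised version shows that `T` is symmetric
(`isFormalAdjoint_self`).

*The domain of `T*` contains many spinors which are not in `H¹(Ω)²`.* Near a point of `γ_k` off the
other surfaces there is a complex coordinate `z` with `S_k = {z ≤ 0}` and `∑ (X_j z)² = O(|z|)`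
(`exists_boundaryCoordinate`). The phase of `z^{-α_k}` jumps across `S_k` exactly as required, and
the spinor `v = z^{-α_k} s` with `s = ∑ (X_j z) σ_j ξ` near the point satisfies
`Pv = O(|z|^{-α_k})` because `(∑ (X_j z) σ_j)² = ∑ (X_j z)²`. As `α_k < 1`, both `v` and `Pv` are
square integrable, and Green's formula puts `v` into the domain of `T*`; as `α_k > 0`, the derivatives
of `v` are at least of the order `1/|z|` and not square integrable (`exists_singular`). By
transversality there are infinitely many such points on a knot (`infinite_boundary_diff`), and
spinors supported near different points are independent modulo `H¹(Ω)²`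
(`exists_independent`).

*Linear algebra.* If `T*v` is orthogonal to `ker T*`, it is in the closed range of the closure of `T`,
so `v` differs from an element of `H¹(Ω)²` by an element of `ker T*`. If `ker T*` had dimension `N`, a
space of dimension `2N + 1` of singular spinors would contain one of dimension `N + 1` to which this
applies, and which is independent modulo `H¹(Ω)²`, a contradiction
(`not_finiteDimensional_kerOp_adjoint`).
-/

noncomputable section

namespace MagneticLink

/-! ### The frame, its rotations, and the volume of the sphere -/

/-- The frame field `X_j` as a continuous linear map of `ℝ⁴`. -/
def frameL (j : Fin 3) : E4 →L[ℝ] E4 :=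
  LinearMap.toContinuousLinearMap
    { toFun := frame j
      map_add' := fun p q => by
        ext i; fin_cases j <;> fin_cases i <;> simp [frame] <;> ring
      map_smul' := fun c p => by
        ext i; fin_cases j <;> fin_cases i <;> simp [frame] }

@[simp] lemma frameL_apply (j : Fin 3) (p : E4) : frameL j p = frame j p := rfl

lemma frame_add (j : Fin 3) (p q : E4) : frame j (p + q) = frame j p + frame j q :=
  (frameL j).map_add p q

lemma frame_smul (j : Fin 3) (c : ℝ) (p : E4) : frame j (c • p) = c • frame j p :=
  (frameL j).map_smul c p

lemma frame_frame (j : Fin 3) (p : E4) : frame j (frame j p) = -p := by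
  ext i; fin_cases j <;> fin_cases i <;> simp [frame]

lemma continuous_frame (j : Fin 3) : Continuous (frame j) := (frameL j).continuous

lemma contDiff_frame (j : Fin 3) : ContDiff ℝ ∞ (frame j) := (frameL j).contDiff

lemma inner_frame_self (j : Fin 3) (p : E4) : inner ℝ p (frame j p) = 0 := by
  fin_cases j <;> simp [frame, PiLp.inner_apply, Fin.sum_univ_four] <;> ring

lemma norm_frame (j : Fin 3) (p : E4) : ‖frame j p‖ = ‖p‖ := by
  rw [EuclideanSpace.norm_eq, EuclideanSpace.norm_eq]
  congr 1
  fin_cases j <;> simp [frame, Fin.sum_univ_four] <;> ring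

/-- `frame 0 p, frame 1 p, frame 2 p` span the tangent space: a tangent vector orthogonal to all of
them vanishes. -/
lemma sum_inner_frame (p v : E4) :
    inner ℝ p v ^ 2 + ∑ j, inner ℝ (frame j p) v ^ 2 = ‖p‖ ^ 2 * ‖v‖ ^ 2 := by
  rw [EuclideanSpace.norm_sq_eq, EuclideanSpace.norm_sq_eq]
  simp [frame, PiLp.inner_apply, Fin.sum_univ_four, Fin.sum_univ_three]
  ring

/-- The flow of `X_j`: the rotation by the angle `t`. -/
def rot (j : Fin 3) (t : ℝ) (p : E4) : E4 := Real.cos t • p + Real.sin t • frame j p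

lemma norm_rot (j : Fin 3) (t : ℝ) (p : E4) : ‖rot j t p‖ = ‖p‖ := by
  have h : ‖rot j t p‖ ^ 2 = ‖p‖ ^ 2 := by
    rw [rot, norm_add_sq_real, inner_smul_left, inner_smul_right, inner_frame_self, norm_smul,
      norm_smul, norm_frame, mul_pow, mul_pow]
    simp only [Real.norm_eq_abs, sq_abs]
    linear_combination (‖p‖ ^ 2) * Real.cos_sq_add_sin_sq t
  exact (sq_eq_sq₀ (norm_nonneg _) (norm_nonneg _)).1 h

lemma frame_rot (j : Fin 3) (t : ℝ) (p : E4) :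
    frame j (rot j t p) = Real.cos t • frame j p - Real.sin t • p := by
  rw [rot, frame_add, frame_smul, frame_smul, frame_frame, smul_neg, sub_eq_add_neg]

lemma rot_rot (j : Fin 3) (s t : ℝ) (p : E4) : rot j s (rot j t p) = rot j (s + t) p := by
  conv_lhs => rw [rot, frame_rot]
  rw [rot, rot, Real.cos_add, Real.sin_add]
  module

lemma rot_zero (j : Fin 3) (p : E4) : rot j 0 p = p := by simp [rot]

/-- The rotation `rot j t` as a linear isometry. -/
def rotIso (j : Fin 3) (t : ℝ) : E4 ≃ₗᵢ[ℝ] E4 where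
  toFun := rot j t
  invFun := rot j (-t)
  map_add' p q := by simp only [rot, frame_add]; module
  map_smul' c p := by simp only [rot, frame_smul, RingHom.id_apply]; module
  left_inv p := by simp [rot_rot, rot_zero]
  right_inv p := by simp [rot_rot, rot_zero]
  norm_map' p := norm_rot j t p

lemma hasDerivAt_rot (j : Fin 3) (p : E4) (t : ℝ) :
    HasDerivAt (fun t => rot j t p) (frame j (rot j t p)) t := by
  rw [frame_rot]
  have := ((Real.hasDerivAt_cos t).smul_const p).add ((Real.hasDerivAt_sin t).smul_const (frame j p))
  refine this.congr_deriv ?_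
  simp only [neg_smul]
  abel

/-- The rotation `rot j t` of the sphere. -/
def rotS (j : Fin 3) (t : ℝ) (p : S3) : S3 :=
  ⟨rot j t p, by rw [mem_sphere_zero_iff_norm, norm_rot, norm_eq_of_mem_sphere]⟩

@[simp] lemma coe_rotS (j : Fin 3) (t : ℝ) (p : S3) : (rotS j t p : E4) = rot j t p := rfl

lemma rotS_rotS (j : Fin 3) (s t : ℝ) (p : S3) : rotS j s (rotS j t p) = rotS j (s + t) p :=
  Subtype.ext (rot_rot j s t p)

lemma rotS_zero (j : Fin 3) (p : S3) : rotS j 0 p = p := Subtype.ext (rot_zero j p)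

lemma continuous_rotS (j : Fin 3) : Continuous (fun z : ℝ × S3 => rotS j z.1 z.2) := by
  refine Continuous.subtype_mk ?_ _
  have := continuous_frame j
  unfold rot
  fun_prop

lemma continuous_rotS_right (j : Fin 3) (t : ℝ) : Continuous (rotS j t) :=
  Continuous.subtype_mk ((rotIso j t).continuous.comp continuous_subtype_val) _

lemma continuous_rotS_left (j : Fin 3) (p : S3) : Continuous (fun t => rotS j t p) :=
  Continuous.subtype_mk (continuous_iff_continuousAt.2 fun t =>
    (hasDerivAt_rot j p t).continuousAt) _

open scoped Pointwise in
/-- The flow of `X_j` consists of isometries; hence `X_j` is divergence-free (`integral_dX`). -/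
lemma measurePreserving_rotS (j : Fin 3) (t : ℝ) : MeasurePreserving (rotS j t) vol3 vol3 := by
  refine ⟨(continuous_rotS_right j t).measurable, ?_⟩
  ext s hs
  have hm := (continuous_rotS_right j t).measurable
  rw [Measure.map_apply hm hs, Measure.toSphere_apply' _ (hm hs), Measure.toSphere_apply' _ hs]
  congr 1
  have h1 : (Ioo (0 : ℝ) 1 • (Subtype.val '' (rotS j t ⁻¹' s)) : Set E4) =
      rotIso j t ⁻¹' (Ioo (0 : ℝ) 1 • (Subtype.val '' s)) := by
    ext x
    simp only [Set.mem_smul, mem_image, mem_preimage]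
    constructor
    · rintro ⟨r, hr, _, ⟨p, hp, rfl⟩, rfl⟩
      exact ⟨r, hr, _, ⟨_, hp, rfl⟩, ((rotIso j t).map_smul r (p : E4)).symm⟩
    · rintro ⟨r, hr, _, ⟨p, hp, rfl⟩, hx⟩
      refine ⟨r, hr, _, ⟨rotS j (-t) p, ?_, rfl⟩, ?_⟩
      · simpa [rotS_rotS, rotS_zero] using hp
      · apply (rotIso j t).injective
        rw [← hx, map_smul]
        congr 1
        change rot j t (rot j (-t) p) = p
        simp [rot_rot, rot_zero]
  rw [h1]
  exact (rotIso j t).measurePreserving.measure_preimage_equiv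
    (f := (rotIso j t).toHomeomorph.toMeasurableEquiv) _

/-- The derivative `X_j f` of a function on `ℝ⁴` with values in a real normed space. For
real-valued `f` this is `frameDeriv j f`. -/
def dX {V : Type*} [NormedAddCommGroup V] [NormedSpace ℝ V] (j : Fin 3) (f : E4 → V) (p : E4) : V :=
  fderiv ℝ f p (frame j p)

lemma integrable_sphere {V : Type*} [NormedAddCommGroup V] {f : E4 → V} (hf : Continuous f) :
    Integrable (fun p : S3 => f p) vol3 :=
  (hf.comp continuous_subtype_val).integrable_of_hasCompactSupport
    (HasCompactSupport.of_compactSpace _)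

section
variable {V : Type*} [NormedAddCommGroup V] [NormedSpace ℝ V]

lemma frameDeriv_eq_dX (j : Fin 3) (f : E4 → ℝ) : frameDeriv j f = dX j f := rfl

lemma contDiff_dX {j : Fin 3} {f : E4 → V} (hf : ContDiff ℝ ∞ f) : ContDiff ℝ ∞ (dX j f) :=
  (hf.fderiv_right (m := ∞) (by simp)).clm_apply (contDiff_frame j)

lemma hasDerivAt_comp_rot {j : Fin 3} {f : E4 → V} {p : E4} {t : ℝ}
    (hf : DifferentiableAt ℝ f (rot j t p)) :
    HasDerivAt (fun t => f (rot j t p)) (dX j f (rot j t p)) t :=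
  hf.hasFDerivAt.comp_hasDerivAt t (hasDerivAt_rot j p t)

/-- The frame fields are divergence free. -/
lemma integral_dX [CompleteSpace V] (j : Fin 3) {f : E4 → V} (hf : ContDiff ℝ ∞ f) :
    ∫ p : S3, dX j f p ∂vol3 = 0 := by
  have hd := (contDiff_dX (j := j) hf).continuous
  obtain ⟨C, hC⟩ := isCompact_univ.exists_bound_of_continuousOn
    (hd.comp continuous_subtype_val : Continuous fun p : S3 => dX j f p).continuousOn
  have key := hasDerivAt_integral_of_dominated_loc_of_deriv_le (μ := vol3) (𝕜 := ℝ)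
    (F := fun t (p : S3) => f (rot j t p)) (F' := fun t (p : S3) => dX j f (rot j t p))
    (x₀ := 0) (s := univ) (bound := fun _ => C) univ_mem
    (Eventually.of_forall fun t => (integrable_sphere (f := fun p => f (rot j t p))
      (hf.continuous.comp (rotIso j t).continuous)).aestronglyMeasurable)
    (integrable_sphere (f := fun p => f (rot j 0 p)) (hf.continuous.comp (rotIso j 0).continuous))
    (integrable_sphere (f := fun p => dX j f (rot j 0 p))
      (hd.comp (rotIso j 0).continuous)).aestronglyMeasurable
    (Eventually.of_forall fun p t _ => hC (rotS j t p) (mem_univ _))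
    (integrable_const _)
    (Eventually.of_forall fun p t _ => hasDerivAt_comp_rot
      (hf.differentiable (by simp)).differentiableAt)
  have hconst : (fun t => ∫ p : S3, f (rot j t p) ∂vol3) = fun _ => ∫ p : S3, f p ∂vol3 := by
    funext t
    exact ((measurePreserving_rotS j t).integral_comp'
      (f := ⟨⟨rotS j t, rotS j (-t), fun p => by simp [rotS_rotS, rotS_zero],
        fun p => by simp [rotS_rotS, rotS_zero]⟩, (continuous_rotS_right j t).measurable,
        (continuous_rotS_right j (-t)).measurable⟩) (fun p : S3 => f p))
  have h2 := key.2
  rw [hconst] at h2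
  have := h2.unique (hasDerivAt_const (0 : ℝ) _)
  simpa [rot_zero] using this

lemma dX_smul {j : Fin 3} {f : E4 → ℝ} {g : E4 → V} {p : E4} (hf : DifferentiableAt ℝ f p)
    (hg : DifferentiableAt ℝ g p) :
    dX j (fun q => f q • g q) p = f p • dX j g p + dX j f p • g p := by
  simp only [dX]
  rw [fderiv_fun_smul hf hg]
  simp

/-- `X_j f` depends on the restriction of `f` to the sphere only. -/
lemma dX_congr {j : Fin 3} {f g : E4 → V} {p : S3} (hf : DifferentiableAt ℝ f p)
    (hg : DifferentiableAt ℝ g p) (h : ∀ᶠ q : S3 in 𝓝 p, f q = g q) :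
    dX j f p = dX j g p := by
  have h1 := hasDerivAt_comp_rot (j := j) (f := f) (p := p) (t := 0) (by rwa [rot_zero])
  have h2 := hasDerivAt_comp_rot (j := j) (f := g) (p := p) (t := 0) (by rwa [rot_zero])
  rw [rot_zero] at h1 h2
  refine h1.unique (h2.congr_of_eventuallyEq ?_)
  have hc : Tendsto (fun t => rotS j t p) (𝓝 0) (𝓝 p) := by
    simpa [rotS_zero] using (continuous_rotS_left j p).tendsto 0
  exact hc.eventually h

lemma dX_eq_zero {j : Fin 3} {f : E4 → V} {p : S3} (hf : DifferentiableAt ℝ f p)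
    (h : p ∉ tsupport (fun q : S3 => f q)) : dX j f p = 0 := by
  rw [notMem_tsupport_iff_eventuallyEq] at h
  rw [dX_congr (g := fun _ => 0) hf (by fun_prop) h]
  simp [dX]
end

/-- The radial projection `x ↦ x / |x|` (with a junk value at the origin). -/
def radial (x : E4) : S3 :=
  if h : x = 0 then ⟨EuclideanSpace.single 0 1, by simp⟩ else
    ⟨‖x‖⁻¹ • x, by simp [norm_smul, inv_mul_cancel₀ (norm_ne_zero_iff.2 h)]⟩

lemma coe_radial {x : E4} (h : x ≠ 0) : (radial x : E4) = ‖x‖⁻¹ • x := by simp [radial, h]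

lemma radial_eq {x : E4} (h : x ≠ 0) : radial x = (homeomorphUnitSphereProd E4 ⟨x, h⟩).1 :=
  Subtype.ext (by rw [coe_radial h]; simp [homeomorphUnitSphereProd])

lemma measurable_radial : Measurable radial := by
  refine measurable_of_restrict_of_restrict_compl (MeasurableSet.singleton (0 : E4)) ?_ ?_
  · exact measurable_of_countable _
  · have : ({0} : Set E4)ᶜ.domRestrict radial = fun x => (homeomorphUnitSphereProd E4 x).1 := by
      funext x
      exact radial_eq x.2
    rw [this]
    exact (continuous_fst.comp (homeomorphUnitSphereProd E4).continuous).measurable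

/-- The spherical shell `a < |x| < b`. -/
def shell (a b : ℝ) : Set E4 := {x | a < ‖x‖ ∧ ‖x‖ < b}

/-- The volume of the sphere is the image of Lebesgue measure on a shell, up to a factor. -/
lemma map_radial {a b : ℝ} (ha : 0 < a) (hab : a < b) :
    Measure.map radial ((volume : Measure E4).restrict (shell a b)) =
      ENNReal.ofReal ((b ^ 4 - a ^ 4) / 4) • vol3 := by
  ext s hs
  rw [Measure.map_apply measurable_radial hs, Measure.restrict_apply (measurable_radial hs)]
  have hmp := (volume : Measure E4).measurePreserving_homeomorphUnitSphereProd
  set T : Set (S3 × Ioi (0 : ℝ)) := s ×ˢ (Iio ⟨b, ha.trans hab⟩ \ Iic ⟨a, ha⟩)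
  have hT : MeasurableSet T := hs.prod (measurableSet_Iio.diff measurableSet_Iic)
  have h1 := hmp.measure_preimage hT.nullMeasurableSet
  rw [comap_subtype_coe_apply (measurableSet_singleton _).compl] at h1
  have h2 : (Subtype.val '' ((homeomorphUnitSphereProd E4) ⁻¹' T) : Set E4) =
      radial ⁻¹' s ∩ shell a b := by
    ext x
    constructor
    · rintro ⟨y, ⟨hy1, hy2, hy3⟩, rfl⟩
      refine ⟨by rw [mem_preimage, radial_eq y.2]; exact hy1, ?_, ?_⟩
      · simpa [homeomorphUnitSphereProd, ← Subtype.coe_lt_coe] using hy3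
      · simpa [homeomorphUnitSphereProd, ← Subtype.coe_lt_coe] using hy2
    · rintro ⟨h1, h2, h3⟩
      have hx : x ≠ 0 := norm_pos_iff.1 (ha.trans h2)
      refine ⟨⟨x, hx⟩, ⟨by rw [mem_preimage, radial_eq hx] at h1; exact h1, ?_, ?_⟩, rfl⟩
      · simpa [homeomorphUnitSphereProd, ← Subtype.coe_lt_coe] using h3
      · simpa [homeomorphUnitSphereProd, ← Subtype.coe_lt_coe] using h2
  rw [← h2, h1]
  have h3 : Measure.volumeIoiPow 3 (Iio ⟨b, ha.trans hab⟩ \ Iic ⟨a, ha⟩) =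
      ENNReal.ofReal ((b ^ 4 - a ^ 4) / 4) := by
    have e : (Iic (⟨a, ha⟩ : Ioi (0 : ℝ)) : Set (Ioi (0 : ℝ))) =ᵐ[Measure.volumeIoiPow 3]
        Iio ⟨a, ha⟩ := by
      have : NullMeasurableSet {(⟨a, ha⟩ : Ioi (0 : ℝ))} (Measure.volumeIoiPow 3) :=
        (measurableSet_singleton _).nullMeasurableSet
      have h0 : Measure.volumeIoiPow 3 {(⟨a, ha⟩ : Ioi (0 : ℝ))} = 0 := by
        have hac : Measure.volumeIoiPow 3 ≪ Measure.comap Subtype.val (volume : Measure ℝ) :=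
          withDensity_absolutelyContinuous _ _
        apply hac
        rw [comap_subtype_coe_apply measurableSet_Ioi]
        simp
      rw [← Iio_union_right]
      exact union_ae_eq_left_of_ae_eq_empty (ae_eq_empty.2 h0)
    rw [measure_congr ((ae_eq_refl _).diff e), measure_sdiff, Measure.volumeIoiPow_apply_Iio,
      Measure.volumeIoiPow_apply_Iio, ← ENNReal.ofReal_sub]
    · congr 1; simp; ring
    · positivity
    · exact Iio_subset_Iio (Subtype.coe_le_coe.1 hab.le)
    · exact measurableSet_Iio.nullMeasurableSet
    · rw [Measure.volumeIoiPow_apply_Iio]; exact ENNReal.ofReal_ne_top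
  have hdim : Module.finrank ℝ E4 = 4 := by simp
  simp only [hdim]
  change (vol3.prod (Measure.volumeIoiPow 3)) T = _
  rw [Measure.prod_prod, h3, Measure.smul_apply, smul_eq_mul, mul_comm]

/-- Balls of radius `r` in `𝕊³` have volume `O(r³)`. -/
lemma exists_vol3_ball_le : ∃ C : ℝ, 0 < C ∧ ∀ (p : S3) (r : ℝ), 0 < r →
    vol3 (Metric.ball p r) ≤ ENNReal.ofReal (C * r ^ 3) := by
  set V := (volume : Measure E4).real (Metric.ball 0 1)
  have hV : 0 ≤ V := measureReal_nonneg
  refine ⟨16 * V + 1, by positivity, fun p r hr => ?_⟩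
  have h := congrArg (fun μ => μ (Metric.ball p r)) (map_radial one_pos (by linarith : 1 < 1 + r))
  simp only [Measure.smul_apply, smul_eq_mul] at h
  rw [Measure.map_apply measurable_radial measurableSet_ball,
    Measure.restrict_apply (measurable_radial measurableSet_ball)] at h
  -- compare the shell over the ball, of thickness `r`, with a ball in `ℝ⁴`
  have hsub : radial ⁻¹' Metric.ball p r ∩ shell 1 (1 + r) ⊆ Metric.ball (p : E4) (2 * r) := by
    rintro x ⟨h1, h2, h3⟩
    have hx0 : 0 < ‖x‖ := by linarith
    have hx : x ≠ 0 := norm_pos_iff.1 hx0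
    have h4 : dist x (radial x : E4) < r := by
      rw [coe_radial hx, dist_eq_norm]
      have : x - ‖x‖⁻¹ • x = (1 - ‖x‖⁻¹) • x := by module
      rw [this, norm_smul, Real.norm_eq_abs, abs_of_nonneg, sub_mul, inv_mul_cancel₀ hx0.ne']
      · linarith
      · rw [sub_nonneg]; exact inv_le_one_of_one_le₀ h2.le
    have h5 : dist (radial x : E4) (p : E4) < r := h1
    have := dist_triangle x (radial x : E4) (p : E4)
    rw [Metric.mem_ball]; linarith
  have hle := measure_mono (μ := (volume : Measure E4)) hsub
  rw [h, Measure.addHaar_ball _ _ (by positivity)] at hle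
  have hvol : (volume : Measure E4) (Metric.ball 0 1) = ENNReal.ofReal V :=
    (ofReal_measureReal measure_ball_lt_top.ne).symm
  have hdim : Module.finrank ℝ E4 = 4 := by simp
  rw [hdim, hvol, ← ENNReal.ofReal_mul (by positivity)] at hle
  have hlow : ENNReal.ofReal r ≤ ENNReal.ofReal (((1 + r) ^ 4 - 1 ^ 4) / 4) := by
    apply ENNReal.ofReal_le_ofReal
    nlinarith [pow_pos hr 2, pow_pos hr 3, pow_pos hr 4]
  have hle2 := (mul_le_mul_left hlow (vol3 (Metric.ball p r))).trans hle
  have hr0 : ENNReal.ofReal r ≠ 0 := by simpa using hr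
  rw [← ENNReal.mul_le_mul_iff_right hr0 ENNReal.ofReal_ne_top]
  refine hle2.trans ?_
  rw [← ENNReal.ofReal_mul hr.le]
  apply ENNReal.ofReal_le_ofReal
  have := pow_pos hr 4
  nlinarith

/-! ### Regular level sets and surfaces are null sets -/

lemma countable_regular_zeros {f f' : ℝ → ℝ} (hf : ∀ t, HasDerivAt f (f' t) t) :
    {t | f t = 0 ∧ f' t ≠ 0}.Countable := by
  set A := {t | f t = 0 ∧ f' t ≠ 0}
  have : DiscreteTopology A := by
    rw [discreteTopology_subtype_iff]
    rintro t ⟨h0, h1⟩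
    have := (hf t).eventually_ne (c := 0) h1
    rw [← disjoint_iff, disjoint_principal_right]
    filter_upwards [this] with s hs hA
    exact hs hA.1
  exact countable_coe_iff.1 (TopologicalSpace.separableSpace_iff_countable.1 inferInstance)

/-- Along almost every orbit of `X_j` a regular zero is isolated, so by Fubini's theorem and
rotation invariance regular level sets are null. -/
lemma vol3_regular_zeros (j : Fin 3) {h : E4 → ℝ} (hh : ContDiff ℝ ∞ h) :
    vol3 {p : S3 | h p = 0 ∧ dX j h p ≠ 0} = 0 := by
  set Z : Set S3 := {p : S3 | h p = 0 ∧ dX j h p ≠ 0}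
  have hZ : MeasurableSet Z := by
    refine MeasurableSet.inter ?_ ?_
    · exact (isClosed_eq (hh.continuous.comp continuous_subtype_val) continuous_const).measurableSet
    · exact (isOpen_ne_fun ((contDiff_dX hh).continuous.comp continuous_subtype_val)
        continuous_const).measurableSet
  set T : Set (ℝ × S3) := (fun z => rotS j z.1 z.2) ⁻¹' Z
  have hT : MeasurableSet T := (continuous_rotS j).measurable hZ
  have h1 : ((volume : Measure ℝ).restrict (Ioo 0 1)).prod vol3 T = 0 := by
    rw [Measure.prod_apply_symm hT]
    rw [lintegral_eq_zero_iff (measurable_measure_prodMk_right hT)]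
    refine Eventually.of_forall fun p => ?_
    refine le_antisymm ((Measure.restrict_le_self _).trans ?_) zero_le
    refine le_of_eq ((countable_regular_zeros (f := fun t => h (rot j t p))
      (f' := fun t => dX j h (rot j t p)) fun t => hasDerivAt_comp_rot
        (hh.differentiable (by simp)).differentiableAt).measure_zero _)
  rw [Measure.prod_apply hT] at h1
  have h2 : ∀ t, vol3 (Prod.mk t ⁻¹' T) = vol3 Z := fun t =>
    (measurePreserving_rotS j t).measure_preimage hZ.nullMeasurableSet
  simpa [h2] using h1

lemma exists_frame_ne_zero {p : S3} {v : E4} (h1 : inner ℝ (p : E4) v = 0) (hv : v ≠ 0) :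
    ∃ j, inner ℝ v (frame j p) ≠ 0 := by
  by_contra! h
  have := sum_inner_frame p v
  simp only [h1, real_inner_comm, h] at this
  simp at this
  exact hv (norm_eq_zero.1 (pow_eq_zero_iff two_ne_zero |>.1 this.symm))

/-- The frame derivatives of a local equation do not all vanish on the surface. -/
lemma exists_dX_ne_zero {p : S3} {h : E4 → ℝ} {N : E4} {c : ℝ} (hc : 0 < c) (hN : ‖N‖ = 1)
    (hpN : inner ℝ (p : E4) N = 0)
    (hd : ∀ v : E4, inner ℝ (p : E4) v = 0 → fderiv ℝ h p v = c * inner ℝ N v) :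
    ∃ j, dX j h p ≠ 0 := by
  obtain ⟨j, hj⟩ := exists_frame_ne_zero hpN (norm_ne_zero_iff.1 (by rw [hN]; exact one_ne_zero))
  refine ⟨j, ?_⟩
  rw [dX, hd _ (inner_frame_self j p)]
  exact mul_ne_zero hc.ne' hj

lemma vol3_zeros_of_gradient {A : Set S3} {h : E4 → ℝ} (hh : ContDiff ℝ ∞ h)
    (hA : ∀ p ∈ A, h p = 0 ∧ ∃ j, dX j h p ≠ 0) : vol3 A = 0 := by
  refine measure_mono_null (t := ⋃ j, {p : S3 | h p = 0 ∧ dX j h p ≠ 0}) ?_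
    (measure_iUnion_null fun j => vol3_regular_zeros j hh)
  intro p hp
  obtain ⟨h0, j, hj⟩ := hA p hp
  exact mem_iUnion.2 ⟨j, h0, hj⟩

lemma IsLocalEquation.exists_dX_ne_zero {S : OrientedSurface} {U : Set S3} {h : E4 → ℝ}
    (H : IsLocalEquation S.carrier S.normal U h) {p : S3} (hU : p ∈ U) (hp : p ∈ S.carrier) :
    ∃ j, dX j h p ≠ 0 := by
  obtain ⟨c, hc, hd⟩ := H.gradient p hU hp
  exact MagneticLink.exists_dX_ne_zero hc (S.norm_normal p hp) (S.normal_tangent p hp) hd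

lemma IsLocalEquation.vol3_zeros {S : OrientedSurface} {U : Set S3} {h : E4 → ℝ}
    (H : IsLocalEquation S.carrier S.normal U h) : vol3 {p | p ∈ U ∧ h p = 0} = 0 := by
  refine vol3_zeros_of_gradient H.smooth fun p hp => ⟨hp.2, ?_⟩
  exact H.exists_dX_ne_zero hp.1 ((H.mem_iff p hp.1).2 hp.2)

/-- Surfaces have no volume. -/
lemma OrientedSurface.vol3_carrier (S : OrientedSurface) : vol3 S.carrier = 0 := by
  refine measure_null_of_locally_null _ fun p hp => ?_
  rcases S.local_form p hp with ⟨-, U, h, hU, hpU, H⟩ |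
    ⟨-, U, h, b, hU, hpU, hh, hb, hmem, hgrad, -⟩
  · refine ⟨S.carrier ∩ U, inter_mem_nhdsWithin _ (hU.mem_nhds hpU), ?_⟩
    refine measure_mono_null ?_ H.vol3_zeros
    exact fun q hq => ⟨hq.2, (H.mem_iff q hq.2).1 hq.1⟩
  · refine ⟨S.carrier ∩ U, inter_mem_nhdsWithin _ (hU.mem_nhds hpU), ?_⟩
    refine vol3_zeros_of_gradient hh fun q hq => ⟨((hmem q hq.2).1 hq.1).1, ?_⟩
    obtain ⟨c, hc, hd⟩ := hgrad q hq.2 hq.1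
    exact MagneticLink.exists_dX_ne_zero hc (S.norm_normal q hq.1) (S.normal_tangent q hq.1) hd

lemma ae_mem_complSurfaces {K : ℕ} (S : Fin K → OrientedSurface) :
    ∀ᵐ p ∂vol3, p ∈ complSurfaces S := by
  have : vol3 (⋃ k, (S k).carrier) = 0 := measure_iUnion_null fun k => (S k).vol3_carrier
  exact measure_eq_zero_iff_ae_notMem.1 this

/-! ### Test functions -/

lemma IsTest.mono {U V : Set S3} (h : U ⊆ V) {f : E4 → ℝ} (hf : IsTest U f) : IsTest V f :=
  ⟨hf.1, hf.2.trans h⟩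

lemma IsTest.mul_left {U : Set S3} {f g : E4 → ℝ} (hf : IsTest U f) (hg : ContDiff ℝ ∞ g) :
    IsTest U (fun p => f p * g p) :=
  ⟨hf.1.mul hg, (tsupport_mul_subset_left (f := fun p : S3 => f p) (g := fun p : S3 => g p)).trans
    hf.2⟩

lemma IsTest.mul_right {U : Set S3} {f g : E4 → ℝ} (hf : IsTest U f) (hg : ContDiff ℝ ∞ g) :
    IsTest U (fun p => g p * f p) :=
  ⟨hg.mul hf.1, (tsupport_mul_subset_right (f := fun p : S3 => g p) (g := fun p : S3 => f p)).trans
    hf.2⟩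

lemma IsTest.eq_zero {U : Set S3} {f : E4 → ℝ} (hf : IsTest U f) {p : S3} (hp : p ∉ U) :
    f p = 0 := by
  by_contra h
  exact hp (hf.2 (subset_tsupport (fun p : S3 => f p) h))

lemma IsTest.dX_eq_zero {U : Set S3} {f : E4 → ℝ} (hf : IsTest U f) (j : Fin 3) {p : S3}
    (hp : p ∉ U) : dX j f p = 0 :=
  MagneticLink.dX_eq_zero (hf.1.differentiable (by simp)).differentiableAt fun h => hp (hf.2 h)

lemma isTest_univ {f : E4 → ℝ} (hf : ContDiff ℝ ∞ f) : IsTest univ f := ⟨hf, subset_univ _⟩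

/-- Smooth Urysohn functions on the sphere. -/
lemma exists_smooth_cutoff {A B : Set S3} (hA : IsClosed A) (hB : IsClosed B)
    (hAB : Disjoint A B) : ∃ f : E4 → ℝ, ContDiff ℝ ∞ f ∧ (∀ x, f x ∈ Icc (0 : ℝ) 1) ∧
      (∀ᶠ p in 𝓝ˢ A, f (p : S3) = 1) ∧ (∀ᶠ p in 𝓝ˢ B, f (p : S3) = 0) := by
  obtain ⟨A', hA', hAA', hA'B⟩ := normal_exists_closure_subset hA hB.isOpen_compl
    (disjoint_left.1 hAB)
  have hd : Disjoint (closure A') B := disjoint_left.2 fun p hp hpB => hA'B hp hpB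
  obtain ⟨B', hB', hBB', hB'A⟩ := normal_exists_closure_subset hB
    (isClosed_closure (s := A')).isOpen_compl (fun p hp hpA => disjoint_left.1 hd hpA hp)
  have c1 : IsClosed (Subtype.val '' closure A' : Set E4) :=
    (isClosed_closure.isCompact.image continuous_subtype_val).isClosed
  have c2 : IsClosed (Subtype.val '' closure B' : Set E4) :=
    (isClosed_closure.isCompact.image continuous_subtype_val).isClosed
  have hd' : Disjoint (Subtype.val '' closure B' : Set E4) (Subtype.val '' closure A') := by
    rw [disjoint_image_iff Subtype.val_injective]
    exact disjoint_left.2 fun p hp hpA => hB'A hp hpA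
  obtain ⟨f, h0, h1, h2⟩ := exists_contMDiffMap_zero_one_of_isClosed (n := (⊤ : ℕ∞))
    (modelWithCornersSelf ℝ E4) c2 c1 hd'
  refine ⟨f, f.contMDiff.contDiff, h2, ?_, ?_⟩
  · filter_upwards [hA'.mem_nhdsSet.2 hAA'] with p hp
    exact h1 (mem_image_of_mem _ (subset_closure hp))
  · filter_upwards [hB'.mem_nhdsSet.2 hBB'] with p hp
    exact h0 (mem_image_of_mem _ (subset_closure hp))

/-- A cutoff function equal to `1` near a given closed set and supported in a given open set. -/
lemma exists_test_eq_one {A U : Set S3} (hA : IsClosed A) (hU : IsOpen U) (hAU : A ⊆ U) :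
    ∃ f : E4 → ℝ, IsTest U f ∧ (∀ x, f x ∈ Icc (0 : ℝ) 1) ∧ ∀ᶠ p in 𝓝ˢ A, f (p : S3) = 1 := by
  obtain ⟨f, h1, h2, h3, h4⟩ := exists_smooth_cutoff hA hU.isClosed_compl
    (disjoint_left.2 fun p hp hpU => hpU (hAU hp))
  refine ⟨f, ⟨h1, fun p hp => ?_⟩, h2, h3⟩
  by_contra hpU
  refine notMem_tsupport_iff_eventuallyEq.2 ?_ hp
  exact eventually_nhdsSet_iff_forall.1 h4 p hpU

/-! ### Polynomials on the sphere, and density of smooth spinors in `H¹(𝕊³)` -/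

/-- The coordinate functions of `ℝ⁴`. -/
def coord (i : Fin 4) : C(E4, ℝ) := ⟨fun x => x i, by fun_prop⟩

/-- The affine functions on `ℝ⁴`. -/
def affineFns : Submodule ℝ C(E4, ℝ) := Submodule.span ℝ ({1} ∪ range coord)

/-- The polynomial functions of degree at most `n` on `ℝ⁴`. -/
def polyFns (n : ℕ) : Submodule ℝ C(E4, ℝ) := affineFns ^ n

lemma one_le_affineFns : 1 ≤ affineFns :=
  Submodule.one_le.2 (Submodule.subset_span (Or.inl rfl))

lemma polyFns_mono : Monotone polyFns := fun _ _ h => pow_le_pow_right' one_le_affineFns h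

instance (n : ℕ) : FiniteDimensional ℝ (polyFns n) := by
  refine Module.Finite.iff_fg.2 (Submodule.FG.pow ?_ n)
  exact Submodule.fg_span ((finite_singleton _).union (finite_range _))

/-- The frame fields are linear, so they map affine functions to affine functions. -/
lemma affineFns_dX {f : C(E4, ℝ)} (hf : f ∈ affineFns) :
    ContDiff ℝ ∞ f ∧ ∀ j, ∃ g ∈ affineFns, ⇑g = dX j f := by
  have hmem (i : Fin 4) : coord i ∈ affineFns := Submodule.subset_span (Or.inr (mem_range_self i))
  induction hf using Submodule.span_induction with
  | mem x hx =>
    rcases hx with rfl | ⟨i, rfl⟩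
    · refine ⟨contDiff_const (c := (1 : ℝ)), fun j => ⟨0, zero_mem _, ?_⟩⟩
      funext p
      have : (⇑(1 : C(E4, ℝ))) = fun _ => (1 : ℝ) := rfl
      rw [this]
      simp [dX]
    · have hL : ⇑(coord i) = ⇑(EuclideanSpace.proj i : E4 →L[ℝ] ℝ) := rfl
      rw [hL]
      refine ⟨ContinuousLinearMap.contDiff _, fun j => ?_⟩
      have hd : dX j ⇑(EuclideanSpace.proj i : E4 →L[ℝ] ℝ) = fun p => frame j p i := by
        funext p
        rw [dX, ContinuousLinearMap.fderiv]
        rfl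
      rw [hd]
      fin_cases j <;> fin_cases i <;>
      first
        | (refine ⟨_, hmem 0, ?_⟩; funext p; simp [frame, coord]; done)
        | (refine ⟨_, hmem 1, ?_⟩; funext p; simp [frame, coord]; done)
        | (refine ⟨_, hmem 2, ?_⟩; funext p; simp [frame, coord]; done)
        | (refine ⟨_, hmem 3, ?_⟩; funext p; simp [frame, coord]; done)
        | (refine ⟨_, neg_mem (hmem 0), ?_⟩; funext p; simp [frame, coord]; done)
        | (refine ⟨_, neg_mem (hmem 1), ?_⟩; funext p; simp [frame, coord]; done)
        | (refine ⟨_, neg_mem (hmem 2), ?_⟩; funext p; simp [frame, coord]; done)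
        | (refine ⟨_, neg_mem (hmem 3), ?_⟩; funext p; simp [frame, coord])
  | zero =>
    refine ⟨contDiff_const (c := (0 : ℝ)), fun j => ⟨0, zero_mem _, ?_⟩⟩
    funext p
    have : (⇑(0 : C(E4, ℝ))) = fun _ => (0 : ℝ) := rfl
    rw [this]
    simp [dX]
  | add x y _ _ hx hy =>
    refine ⟨hx.1.add hy.1, fun j => ?_⟩
    obtain ⟨g, hg, e⟩ := hx.2 j
    obtain ⟨g', hg', e'⟩ := hy.2 j
    refine ⟨g + g', add_mem hg hg', ?_⟩
    funext p
    rw [ContinuousMap.coe_add, ContinuousMap.coe_add, e, e', Pi.add_apply, dX, dX, dX,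
      fderiv_add (hx.1.differentiable (by simp)).differentiableAt
        (hy.1.differentiable (by simp)).differentiableAt]
    rfl
  | smul a x _ hx =>
    refine ⟨hx.1.const_smul a, fun j => ?_⟩
    obtain ⟨g, hg, e⟩ := hx.2 j
    refine ⟨a • g, Submodule.smul_mem _ a hg, ?_⟩
    funext p
    rw [ContinuousMap.coe_smul, ContinuousMap.coe_smul, Pi.smul_apply, e, dX, dX,
      fderiv_const_smul (hx.1.differentiable (by simp)).differentiableAt]
    rfl

/-- Polynomial functions are smooth, and the frame fields do not raise their degree. -/
lemma polyFns_dX {n : ℕ} {f : C(E4, ℝ)} (hf : f ∈ polyFns n) :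
    ContDiff ℝ ∞ f ∧ ∀ j, ∃ g ∈ polyFns n, ⇑g = dX j f := by
  induction hf using Submodule.pow_induction_on_left' with
  | algebraMap r =>
    refine ⟨contDiff_const (c := r), fun j => ⟨0, zero_mem _, ?_⟩⟩
    funext p
    have : ⇑(algebraMap ℝ C(E4, ℝ) r) = fun _ => r := by
      funext x; simp [algebraMap_apply]
    rw [this]
    simp [dX]
  | add x y i _ _ hx hy =>
    refine ⟨hx.1.add hy.1, fun j => ?_⟩
    obtain ⟨g, hg, e⟩ := hx.2 j
    obtain ⟨g', hg', e'⟩ := hy.2 j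
    refine ⟨g + g', add_mem hg hg', ?_⟩
    funext p
    rw [ContinuousMap.coe_add, ContinuousMap.coe_add, e, e', Pi.add_apply, dX, dX, dX,
      fderiv_add (hx.1.differentiable (by simp)).differentiableAt
        (hy.1.differentiable (by simp)).differentiableAt]
    rfl
  | mem_mul m hm i x hx ih =>
    obtain ⟨hm1, hm2⟩ := affineFns_dX hm
    refine ⟨hm1.mul ih.1, fun j => ?_⟩
    obtain ⟨g, hg, e⟩ := hm2 j
    obtain ⟨g', hg', e'⟩ := ih.2 j
    refine ⟨m * g' + g * x, ?_, ?_⟩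
    · rw [polyFns, Nat.succ_eq_add_one, pow_succ']
      exact add_mem (Submodule.mul_mem_mul hm hg') (Submodule.mul_mem_mul hg hx)
    · funext p
      have := dX_smul (j := j) (hm1.differentiable (by simp)).differentiableAt
        (ih.1.differentiable (by simp)).differentiableAt (p := p)
      simp only [smul_eq_mul] at this
      change m p * g' p + g p * x p = dX j (fun q => m q * x q) p
      rw [this, e, e']

/-- Restriction to the sphere. -/
def restrictS : C(E4, ℝ) →ₗ[ℝ] C(S3, ℝ) where
  toFun f := f.comp ⟨Subtype.val, continuous_subtype_val⟩
  map_add' _ _ := rfl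
  map_smul' _ _ := rfl

/-- The subalgebra of polynomial functions on the sphere is dense among continuous functions. -/
lemma dense_poly : closure {f : C(S3, ℝ) | ∃ n, ∃ g ∈ polyFns n, f = restrictS g} = univ := by
  set A : Subalgebra ℝ C(S3, ℝ) := Algebra.adjoin ℝ (range fun i => restrictS (coord i))
  have hA : A.SeparatesPoints := by
    intro p q hpq
    have : ∃ i, (p : E4) i ≠ (q : E4) i := by
      by_contra! h
      exact hpq (Subtype.ext (PiLp.ext h))
    obtain ⟨i, hi⟩ := this
    exact ⟨_, ⟨_, Algebra.subset_adjoin (mem_range_self i), rfl⟩, hi⟩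
  have h1 := ContinuousMap.subalgebra_topologicalClosure_eq_top_of_separatesPoints A hA
  have h2 : closure (A : Set C(S3, ℝ)) = univ := by
    rw [← Subalgebra.topologicalClosure_coe, h1]; rfl
  refine univ_subset_iff.1 (h2 ▸ closure_mono ?_)
  intro f hf
  induction hf using Algebra.adjoin_induction with
  | mem x hx =>
    obtain ⟨i, rfl⟩ := hx
    refine ⟨1, coord i, ?_, rfl⟩
    rw [polyFns, pow_one]
    exact Submodule.subset_span (Or.inr (mem_range_self i))
  | algebraMap r =>
    refine ⟨0, algebraMap ℝ _ r, ?_, rfl⟩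
    rw [polyFns, pow_zero]
    exact Submodule.algebraMap_mem r
  | add x y _ _ hx hy =>
    obtain ⟨n, g, hg, rfl⟩ := hx
    obtain ⟨m, g', hg', rfl⟩ := hy
    refine ⟨max n m, g + g', add_mem (polyFns_mono (le_max_left _ _) hg)
      (polyFns_mono (le_max_right _ _) hg'), (map_add _ _ _).symm⟩
  | mul x y _ _ hx hy =>
    obtain ⟨n, g, hg, rfl⟩ := hx
    obtain ⟨m, g', hg', rfl⟩ := hy
    refine ⟨n + m, g * g', ?_, rfl⟩
    rw [polyFns, pow_add]
    exact Submodule.mul_mem_mul hg hg'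

/-- An `L²` function on the sphere which is orthogonal to `(1 - Δ) ζ` for all polynomials `ζ`
vanishes, where `Δ = ∑ X_j²`. -/
lemma ae_eq_zero_of_orthogonal_resolvent {y : S3 → ℝ} (hy : MemLp y 2 vol3)
    (h : ∀ ζ : E4 → ℝ, ContDiff ℝ ∞ ζ →
      ∫ p : S3, (ζ p - ∑ j, dX j (dX j ζ) p) * y p ∂vol3 = 0) :
    y =ᵐ[vol3] 0 := by
  set T : C(S3, ℝ) →L[ℝ] Lp ℝ 2 vol3 := ContinuousMap.toLp 2 vol3 ℝ
  set Y : Lp ℝ 2 vol3 := hy.toLp y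
  have hin (f : C(S3, ℝ)) (x : Lp ℝ 2 vol3) : inner ℝ (T f) x = ∫ p, f p * x p ∂vol3 := by
    rw [L2.inner_def]
    refine integral_congr_ae ?_
    filter_upwards [ContinuousMap.coeFn_toLp (p := 2) (𝕜 := ℝ) vol3 f] with p hp
    rw [hp]
    simp [mul_comm]
  have horth : ∀ n, ∀ ζ ∈ polyFns n, inner ℝ (T (restrictS ζ)) Y = 0 := by
    intro n
    set F : Submodule ℝ (Lp ℝ 2 vol3) := (polyFns n).map (T.toLinearMap ∘ₗ restrictS)
    have : FiniteDimensional ℝ F := inferInstance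
    have he := F.starProjection_apply_mem Y
    obtain ⟨ζ, hζ, hζe⟩ := he
    have hζe' : T (restrictS ζ) = F.starProjection Y := hζe
    have hort : ∀ w ∈ F, inner ℝ w (Y - F.starProjection Y) = 0 := fun w hw =>
      (F.sub_starProjection_mem_orthogonal Y) w hw
    obtain ⟨hsm, hder⟩ := polyFns_dX hζ
    -- `T ζ` is the projection of `Y` to the polynomials of degree `n`; testing with
    -- `η = (1 - Δ)ζ`, of the same degree, gives `∫ η ζ = 0`, and `∫ η ζ = ‖ζ‖² + ‖Xζ‖²`
    have hη : ∃ η ∈ polyFns n, ⇑η = fun p => ζ p - ∑ j, dX j (dX j ζ) p := by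
      choose g hg e using hder
      choose g' hg' e' using fun j => (polyFns_dX (hg j)).2 j
      refine ⟨ζ - ∑ j, g' j, sub_mem hζ (sum_mem fun j _ => hg' j), ?_⟩
      funext p
      simp [e', e]
    obtain ⟨η, hη, eη⟩ := hη
    have h1 : inner ℝ (T (restrictS η)) Y = 0 := by
      rw [hin, ← h ζ hsm]
      refine integral_congr_ae ?_
      filter_upwards [hy.coeFn_toLp] with p hp
      rw [hp]
      change η p * _ = _
      rw [eη]
    have h2 := hort _ ⟨η, hη, rfl⟩
    change inner ℝ (T (restrictS η)) _ = 0 at h2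
    rw [inner_sub_right, h1, zero_sub, neg_eq_zero, ← hζe', hin] at h2
    have h3 : ∫ p : S3, η p * ζ p ∂vol3 =
        ∫ p : S3, (ζ p ^ 2 + ∑ j, dX j ζ p ^ 2) ∂vol3 := by
      have e : ∀ p : S3, η p * ζ p =
          (ζ p ^ 2 + ∑ j, dX j ζ p ^ 2) - ∑ j, dX j (fun q => ζ q • dX j ζ q) p := by
        intro p
        have e1 (j : Fin 3) := dX_smul (j := j) (p := p) (hsm.differentiable (by simp)).differentiableAt
          ((contDiff_dX (j := j) hsm).differentiable (by simp)).differentiableAt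
        rw [Finset.sum_congr rfl (fun j _ => e1 j), eη]
        simp only [smul_eq_mul, Fin.sum_univ_three]
        ring
      have hs (j : Fin 3) : ContDiff ℝ ∞ fun q => ζ q • dX j ζ q := hsm.smul (contDiff_dX hsm)
      rw [integral_congr_ae (Eventually.of_forall e), integral_sub, integral_finsetSum]
      · simp only [integral_dX _ (hs _), Finset.sum_const_zero, sub_zero]
      · exact fun j _ => integrable_sphere (contDiff_dX (hs j)).continuous
      · refine integrable_sphere (f := fun p => ζ p ^ 2 + ∑ j, dX j ζ p ^ 2) ?_
        exact (hsm.continuous.pow 2).add (continuous_finsetSum _ fun j _ =>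
          (contDiff_dX hsm).continuous.pow 2)
      · exact integrable_finsetSum _ fun j _ => integrable_sphere (contDiff_dX (hs j)).continuous
    have h4 : inner ℝ (T (restrictS ζ)) (T (restrictS ζ)) ≤ 0 := by
      have h5 : ∫ p : S3, η p * ζ p ∂vol3 = 0 := by
        rw [← h2]
        refine integral_congr_ae ?_
        filter_upwards [ContinuousMap.coeFn_toLp (p := 2) (𝕜 := ℝ) vol3 (restrictS ζ)] with p hp
        rw [hp]; rfl
      rw [hin, ← h5, h3]
      refine integral_mono_ae ?_ ?_ ?_
      · refine Integrable.congr (f := fun p : S3 => ζ p * ζ p)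
          (integrable_sphere (f := fun p => ζ p * ζ p) (by fun_prop)) ?_
        filter_upwards [ContinuousMap.coeFn_toLp (p := 2) (𝕜 := ℝ) vol3 (restrictS ζ)] with p hp
        rw [hp]; rfl
      · refine integrable_sphere (f := fun p => ζ p ^ 2 + ∑ j, dX j ζ p ^ 2) ?_
        exact (hsm.continuous.pow 2).add (continuous_finsetSum _ fun j _ =>
          (contDiff_dX hsm).continuous.pow 2)
      · filter_upwards [ContinuousMap.coeFn_toLp (p := 2) (𝕜 := ℝ) vol3 (restrictS ζ)] with p hp
        rw [hp]
        change ζ p * ζ p ≤ _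
        have : 0 ≤ ∑ j, dX j ζ p ^ 2 := Finset.sum_nonneg fun j _ => sq_nonneg _
        nlinarith
    have h6 : T (restrictS ζ) = 0 := real_inner_self_nonpos.1 h4
    intro ξ hξ
    have h7 := hort _ ⟨ξ, hξ, rfl⟩
    rw [← hζe', h6, sub_zero] at h7
    exact h7
  have hall : ∀ f : C(S3, ℝ), inner ℝ (T f) Y = 0 := by
    have hc : IsClosed {f : C(S3, ℝ) | inner ℝ (T f) Y = 0} :=
      isClosed_eq (by fun_prop) continuous_const
    intro f
    have : f ∈ closure {f : C(S3, ℝ) | ∃ n, ∃ g ∈ polyFns n, f = restrictS g} := by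
      rw [dense_poly]; trivial
    refine closure_minimal ?_ hc this
    rintro _ ⟨n, g, hg, rfl⟩
    exact horth n g hg
  have hY : Y = 0 := by
    have hd : DenseRange T := ContinuousMap.toLp_denseRange (p := 2) ℝ vol3 ℝ (by simp)
    have h0 : (fun x : Lp ℝ 2 vol3 => inner ℝ x Y) = fun _ => 0 :=
      hd.equalizer (by fun_prop) continuous_const (funext hall)
    exact inner_self_eq_zero.1 (congrFun h0 Y)
  have := hy.coeFn_toLp
  change (Y : S3 → ℝ) =ᵐ[vol3] y at this
  rw [hY] at this
  exact this.symm.trans (Lp.coeFn_zero _ _ _)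

/-- `a = ∑_j X_j b_j` weakly on the open set `U`. -/
def WeakDiv {V : Type*} [NormedAddCommGroup V] [NormedSpace ℝ V] (U : Set S3) (a : S3 → V)
    (b : Fin 3 → S3 → V) : Prop :=
  ∀ f, IsTest U f → ∫ p : S3, (f p • a p + ∑ j, dX j f p • b j p) ∂vol3 = 0

/-- `G = X_j F` weakly on the open set `U`. -/
def WeakDeriv {V : Type*} [NormedAddCommGroup V] [NormedSpace ℝ V] (U : Set S3) (j : Fin 3)
    (F G : S3 → V) : Prop :=
  ∀ f, IsTest U f → ∫ p : S3, (f p • G p + dX j f p • F p) ∂vol3 = 0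

section
variable {V : Type*} [NormedAddCommGroup V] [NormedSpace ℝ V]

lemma weakDeriv_iff_weakDiv {U : Set S3} {j : Fin 3} {F G : S3 → V} :
    WeakDeriv U j F G ↔ WeakDiv U G (fun i => if i = j then F else 0) := by
  have e (f : E4 → ℝ) (p : S3) :
      ∑ i, dX i f p • (if i = j then F else 0 : S3 → V) p = dX j f p • F p := by
    rw [Finset.sum_eq_single j] <;> simp +contextual
  simp only [WeakDeriv, WeakDiv, e]

lemma integrable_contSmul {f : S3 → ℝ} (hf : Continuous f) {a : S3 → V} (ha : Integrable a vol3) :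
    Integrable (fun p => f p • a p) vol3 := by
  obtain ⟨C, hC⟩ := isCompact_univ.exists_bound_of_continuousOn hf.continuousOn
  exact ha.bdd_smul C hf.aestronglyMeasurable (Eventually.of_forall fun p => hC p (mem_univ p))

lemma integrable_smoothSmul {f : E4 → ℝ} (hf : ContDiff ℝ ∞ f) {a : S3 → V}
    (ha : Integrable a vol3) : Integrable (fun p : S3 => f p • a p) vol3 :=
  integrable_contSmul (f := fun p : S3 => f p) (hf.continuous.comp continuous_subtype_val) ha

lemma integrable_dXSmul {j : Fin 3} {f : E4 → ℝ} (hf : ContDiff ℝ ∞ f) {a : S3 → V}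
    (ha : Integrable a vol3) : Integrable (fun p : S3 => dX j f p • a p) vol3 :=
  integrable_smoothSmul (contDiff_dX hf) ha

lemma dX_add {j : Fin 3} {f g : E4 → V} {p : E4} (hf : DifferentiableAt ℝ f p)
    (hg : DifferentiableAt ℝ g p) : dX j (fun q => f q + g q) p = dX j f p + dX j g p := by
  simp only [dX]
  rw [fderiv_fun_add hf hg]
  rfl

/-- Split a test function on `U ∪ U'` with a cutoff. -/
lemma WeakDiv.union {U U' : Set S3} (hU : IsOpen U) (hU' : IsOpen U') {a : S3 → V}
    {b : Fin 3 → S3 → V} (ha : Integrable a vol3) (hb : ∀ j, Integrable (b j) vol3)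
    (h : WeakDiv U a b) (h' : WeakDiv U' a b) : WeakDiv (U ∪ U') a b := by
  intro f hf
  set T := tsupport (fun p : S3 => f p)
  have hT : IsClosed T := isClosed_tsupport _
  obtain ⟨ρ, hρ, -, h1, h0⟩ := exists_smooth_cutoff (hT.sdiff hU') hU.isClosed_compl
    (disjoint_left.2 fun p hp hpU => (hf.2 hp.1).elim hpU hp.2)
  have e1 : IsTest U (fun p => ρ p * f p) := by
    refine ⟨hρ.mul hf.1, fun p hp => ?_⟩
    by_contra hpU
    refine notMem_tsupport_iff_eventuallyEq.2 ?_ hp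
    filter_upwards [eventually_nhdsSet_iff_forall.1 h0 p hpU] with q hq
    simp [hq]
  have e2 : IsTest U' (fun p => (1 - ρ p) * f p) := by
    refine ⟨(contDiff_const.sub hρ).mul hf.1, fun p hp => ?_⟩
    by_contra hpU
    have hpT : p ∈ T := tsupport_mul_subset_right (f := fun p : S3 => 1 - ρ p)
      (g := fun p : S3 => f p) hp
    refine notMem_tsupport_iff_eventuallyEq.2 ?_ hp
    filter_upwards [eventually_nhdsSet_iff_forall.1 h1 p ⟨hpT, hpU⟩] with q hq
    simp [hq]
  have hint (g : E4 → ℝ) (hg : ContDiff ℝ ∞ g) :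
      Integrable (fun p : S3 => g p • a p + ∑ j, dX j g p • b j p) vol3 :=
    (integrable_smoothSmul hg ha).add (integrable_finsetSum _ fun j _ =>
      integrable_dXSmul hg (hb j))
  have e : ∀ p : S3, f p • a p + ∑ j, dX j f p • b j p =
      ((ρ p * f p) • a p + ∑ j, dX j (fun p => ρ p * f p) p • b j p) +
      (((1 - ρ p) * f p) • a p + ∑ j, dX j (fun p => (1 - ρ p) * f p) p • b j p) := by
    intro p
    have hd (j : Fin 3) : dX j f p =
        dX j (fun p => ρ p * f p) p + dX j (fun p => (1 - ρ p) * f p) p := by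
      rw [← dX_add (e1.1.differentiable (by simp)).differentiableAt
        (e2.1.differentiable (by simp)).differentiableAt]
      congr 1
      funext q; ring
    simp only [hd, add_smul, Finset.sum_add_distrib, sub_mul, one_mul, sub_smul]
    abel
  rw [integral_congr_ae (Eventually.of_forall e), integral_add (hint _ e1.1) (hint _ e2.1),
    h _ e1, h' _ e2, add_zero]

/-- Weak divergences are determined locally. -/
lemma weakDiv_of_local {W : Set S3} {a : S3 → V} {b : Fin 3 → S3 → V} (ha : Integrable a vol3)
    (hb : ∀ j, Integrable (b j) vol3)
    (h : ∀ p ∈ W, ∃ U, IsOpen U ∧ p ∈ U ∧ WeakDiv U a b) : WeakDiv W a b := by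
  intro f hf
  have hK : IsCompact (tsupport (fun p : S3 => f p)) := (isClosed_tsupport _).isCompact
  have key : ∃ U, IsOpen U ∧ tsupport (fun p : S3 => f p) ⊆ U ∧ WeakDiv U a b := by
    refine hK.induction_on (p := fun s => ∃ U, IsOpen U ∧ s ⊆ U ∧ WeakDiv U a b) ?_ ?_ ?_ ?_
    · refine ⟨∅, isOpen_empty, Subset.rfl, fun f hf => ?_⟩
      rw [integral_eq_zero_of_ae]
      refine Eventually.of_forall fun p => ?_
      simp [hf.eq_zero (notMem_empty p), hf.dX_eq_zero _ (notMem_empty p)]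
    · rintro s t hst ⟨U, h1, h2, h3⟩
      exact ⟨U, h1, hst.trans h2, h3⟩
    · rintro s t ⟨U, h1, h2, h3⟩ ⟨U', h1', h2', h3'⟩
      exact ⟨U ∪ U', h1.union h1', union_subset_union h2 h2', h3.union h1 h1' ha hb h3'⟩
    · intro p hp
      obtain ⟨U, h1, h2, h3⟩ := h p (hf.2 hp)
      exact ⟨U, mem_nhdsWithin_of_mem_nhds (h1.mem_nhds h2), U, h1, Subset.rfl, h3⟩
  obtain ⟨U, -, h2, h3⟩ := key
  exact h3 f ⟨hf.1, h2⟩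

lemma weakDeriv_of_local {W : Set S3} {j : Fin 3} {F G : S3 → V} (hF : Integrable F vol3)
    (hG : Integrable G vol3)
    (h : ∀ p ∈ W, ∃ U, IsOpen U ∧ p ∈ U ∧ WeakDeriv U j F G) : WeakDeriv W j F G := by
  simp only [weakDeriv_iff_weakDiv] at h ⊢
  refine weakDiv_of_local hG (fun i => ?_) h
  split_ifs
  exacts [hF, integrable_zero _ _ _]

end

lemma L2_integrable (ψ : L2) : Integrable ψ vol3 := (Lp.memLp ψ).integrable (by norm_num)

lemma HasWeakDeriv.weakDeriv {U : Set S3} {j : Fin 3} {ψ g : L2} (h : HasWeakDeriv U j ψ g) :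
    WeakDeriv U j ψ g := by
  intro f hf
  rw [integral_add (integrable_smoothSmul hf.1 (L2_integrable g))
    (integrable_dXSmul hf.1 (L2_integrable ψ))]
  have h1 := h.2 f hf
  rw [setIntegral_eq_integral_of_forall_compl_eq_zero,
    setIntegral_eq_integral_of_forall_compl_eq_zero] at h1
  · rw [h1]; exact neg_add_cancel _
  · intro p hp
    rw [frameDeriv_eq_dX, hf.dX_eq_zero j hp, zero_smul]
  · intro p hp
    rw [hf.eq_zero hp, zero_smul]

lemma hasWeakDeriv_of_weakDeriv {U : Set S3} {j : Fin 3} {ψ g : L2} (h : WeakDeriv U j ψ g)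
    (hU : ∀ᵐ p ∂vol3, p ∈ U) : HasWeakDeriv U j ψ g := by
  refine ⟨hU.mono fun p hp hp' => absurd hp hp', fun f hf => ?_⟩
  have h1 := h f hf
  rw [integral_add (integrable_smoothSmul hf.1 (L2_integrable g))
    (integrable_dXSmul hf.1 (L2_integrable ψ))] at h1
  rw [setIntegral_eq_integral_of_forall_compl_eq_zero,
    setIntegral_eq_integral_of_forall_compl_eq_zero]
  · exact eq_neg_of_add_eq_zero_left h1
  · intro p hp
    rw [frameDeriv_eq_dX, hf.dX_eq_zero j hp, zero_smul]
  · intro p hp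
    rw [hf.eq_zero hp, zero_smul]

/-- An `L²` spinor which annihilates all test functions on an open set of full measure vanishes. -/
lemma L2_eq_zero_of_test {U : Set S3} (hUo : IsOpen U) (hU : ∀ᵐ p ∂vol3, p ∈ U) {g : L2}
    (h : ∀ f, IsTest U f → ∫ p : S3, f p • g p ∂vol3 = 0) : g = 0 := by
  refine HasWeakDeriv.eq_zero hUo (j := 0) (hasWeakDeriv_of_weakDeriv ?_ hU)
  intro f hf
  rw [← h f hf]
  refine integral_congr_ae ?_
  filter_upwards [Lp.coeFn_zero Spinor 2 vol3] with p hp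
  rw [hp, Pi.zero_apply, smul_zero, add_zero]

lemma continuous_integral_smul {f : S3 → ℝ} (hf : Continuous f) :
    Continuous (fun ψ : L2 => ∫ p, f p • ψ p ∂vol3) := by
  have hm : MemLp f 2 vol3 := hf.memLp_of_hasCompactSupport (HasCompactSupport.of_compactSpace _)
  have := ((ContinuousLinearMap.lsmul ℝ ℝ : ℝ →L[ℝ] Spinor →L[ℝ] Spinor).lpPairing vol3 2 2
    (hm.toLp f)).continuous
  refine this.congr fun ψ => ?_
  rw [ContinuousLinearMap.lpPairing_eq_integral]
  refine integral_congr_ae ?_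
  filter_upwards [hm.coeFn_toLp] with p hp
  rw [hp]; rfl

/-- Weak derivatives pass to limits in `L²`. -/
lemma WeakDeriv.of_tendsto {ι : Type*} {l : Filter ι} [l.NeBot] {U : Set S3} {j : Fin 3}
    {u v : ι → L2} {ψ g : L2} (h : ∀ i, WeakDeriv U j (u i) (v i)) (hu : Tendsto u l (𝓝 ψ))
    (hv : Tendsto v l (𝓝 g)) : WeakDeriv U j ψ g := by
  intro f hf
  have hsplit (x y : L2) : ∫ p : S3, (f p • y p + dX j f p • x p) ∂vol3 =
      ∫ p : S3, f p • y p ∂vol3 + ∫ p : S3, dX j f p • x p ∂vol3 :=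
    integral_add (integrable_smoothSmul hf.1 (L2_integrable y))
      (integrable_dXSmul hf.1 (L2_integrable x))
  have c1 := ((continuous_integral_smul (f := fun p : S3 => f p)
    (hf.1.continuous.comp continuous_subtype_val)).tendsto g).comp hv
  have c2 := ((continuous_integral_smul (f := fun p : S3 => dX j f p)
    ((contDiff_dX hf.1).continuous.comp continuous_subtype_val)).tendsto ψ).comp hu
  have c3 := c1.add c2
  rw [hsplit]
  refine tendsto_nhds_unique c3 ((tendsto_const_nhds (x := (0 : Spinor))).congr fun i => ?_)
  have := h i f hf
  rw [hsplit] at this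
  exact this.symm

/-- Smooth functions have weak derivatives. -/
lemma weakDeriv_of_contDiff {V : Type*} [NormedAddCommGroup V] [NormedSpace ℝ V] [CompleteSpace V]
    (U : Set S3) (j : Fin 3) {s : E4 → V} (hs : ContDiff ℝ ∞ s) :
    WeakDeriv U j (fun p : S3 => s p) (fun p : S3 => dX j s p) := by
  intro f hf
  rw [← integral_dX j (hf.1.smul hs)]
  refine integral_congr_ae (Eventually.of_forall fun p => ?_)
  exact (dX_smul (hf.1.differentiable (by simp)).differentiableAt
    (hs.differentiable (by simp)).differentiableAt).symm

lemma memLp_sphere {V : Type*} [NormedAddCommGroup V] {s : E4 → V} (hs : Continuous s) :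
    MemLp (fun p : S3 => s p) 2 vol3 :=
  (hs.comp continuous_subtype_val).memLp_of_hasCompactSupport
    (HasCompactSupport.of_compactSpace _)

/-- A spinor field on `ℝ⁴`, restricted to the sphere, as an element of `L²`. -/
def toL2 (s : E4 → Spinor) (hs : Continuous s) : L2 := (memLp_sphere hs).toLp _

lemma coeFn_toL2 {s : E4 → Spinor} (hs : Continuous s) : toL2 s hs =ᵐ[vol3] fun p : S3 => s p :=
  MemLp.coeFn_toLp _

lemma WeakDeriv.congr_ae {V : Type*} [NormedAddCommGroup V] [NormedSpace ℝ V] {U : Set S3}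
    {j : Fin 3} {F G F' G' : S3 → V} (h : WeakDeriv U j F G) (hF : F =ᵐ[vol3] F')
    (hG : G =ᵐ[vol3] G') : WeakDeriv U j F' G' := by
  intro f hf
  rw [← h f hf]
  refine integral_congr_ae ?_
  filter_upwards [hF, hG] with p h1 h2
  rw [h1, h2]

/-- The smooth spinor fields with their frame derivatives, inside `L² × (L²)³`. -/
def smoothGraph : Submodule ℂ (PiLp 2 fun _ : Fin 4 => L2) where
  carrier := {x | ∃ s : E4 → Spinor, ContDiff ℝ ∞ s ∧ (x 0 =ᵐ[vol3] fun p : S3 => s p) ∧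
    ∀ j : Fin 3, x j.succ =ᵐ[vol3] fun p : S3 => dX j s p}
  zero_mem' := by
    refine ⟨fun _ => 0, contDiff_const, Lp.coeFn_zero _ _ _, fun j => ?_⟩
    refine (Lp.coeFn_zero Spinor 2 vol3).trans (Eventually.of_forall fun p => ?_)
    simp [dX]
  add_mem' := by
    rintro x y ⟨s, hs, h0, hj⟩ ⟨s', hs', h0', hj'⟩
    refine ⟨fun p => s p + s' p, hs.add hs', ?_, fun j => ?_⟩
    · filter_upwards [Lp.coeFn_add (x 0) (y 0), h0, h0'] with p e e1 e2
      rw [PiLp.add_apply, e, Pi.add_apply, e1, e2]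
    · filter_upwards [Lp.coeFn_add (x j.succ) (y j.succ), hj j, hj' j] with p e e1 e2
      rw [PiLp.add_apply, e, Pi.add_apply, e1, e2,
        dX_add (hs.differentiable (by simp)).differentiableAt
          (hs'.differentiable (by simp)).differentiableAt]
  smul_mem' := by
    rintro c x ⟨s, hs, h0, hj⟩
    refine ⟨fun p => c • s p, hs.const_smul c, ?_, fun j => ?_⟩
    · filter_upwards [Lp.coeFn_smul c (x 0), h0] with p e e1
      rw [PiLp.smul_apply, e, Pi.smul_apply, e1]
    · filter_upwards [Lp.coeFn_smul c (x j.succ), hj j] with p e e1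
      rw [PiLp.smul_apply, e, Pi.smul_apply, e1, dX, dX,
        fderiv_fun_const_smul (hs.differentiable (by simp)).differentiableAt]
      rfl

/-- Smooth spinor fields are dense in `H¹(𝕊³)²`. -/
theorem mem_closure_smoothGraph {x : PiLp 2 fun _ : Fin 4 => L2}
    (hx : ∀ j : Fin 3, WeakDeriv univ j (x 0) (x j.succ)) :
    x ∈ closure (smoothGraph : Set (PiLp 2 fun _ : Fin 4 => L2)) := by
  -- the component `z` of `x` orthogonal to the smooth graph is a weak solution of `(1 - Δ)z₀ = 0`
  set M := smoothGraph.topologicalClosure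
  have : CompleteSpace M := smoothGraph.isClosed_topologicalClosure.completeSpace_coe
  set y := M.starProjection x
  set z := x - y
  have hyM : y ∈ M := M.starProjection_apply_mem x
  have hzM : ∀ w ∈ smoothGraph, inner ℂ w z = 0 := fun w hw =>
    M.sub_starProjection_mem_orthogonal x w (smoothGraph.le_topologicalClosure hw)
  have hy (j : Fin 3) : WeakDeriv univ j (y 0) (y j.succ) := by
    obtain ⟨w, hw, hwy⟩ := mem_closure_iff_seq_limit.1 hyM
    refine WeakDeriv.of_tendsto (u := fun n => w n 0) (v := fun n => w n j.succ) (l := atTop) ?_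
      (((PiLp.continuous_apply 2 _ 0).tendsto y).comp hwy)
      (((PiLp.continuous_apply 2 _ j.succ).tendsto y).comp hwy)
    intro n
    obtain ⟨s, hs, h0, hj⟩ := hw n
    exact (weakDeriv_of_contDiff univ j hs).congr_ae h0.symm (hj j).symm
  have hz (j : Fin 3) : WeakDeriv univ j (z 0) (z j.succ) := by
    intro f hf
    have := congrArg₂ (· - ·) (hx j f hf) (hy j f hf)
    simp only [sub_zero] at this
    rw [← integral_sub] at this
    · rw [← this]
      refine integral_congr_ae ?_
      filter_upwards [Lp.coeFn_sub (x 0) (y 0), Lp.coeFn_sub (x j.succ) (y j.succ)] with p e1 e2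
      change f p • (x j.succ - y j.succ : L2) p + dX j f p • (x 0 - y 0 : L2) p = _
      rw [e1, e2, Pi.sub_apply, Pi.sub_apply, smul_sub, smul_sub]
      abel
    · exact (integrable_smoothSmul hf.1 (L2_integrable _)).add
        (integrable_dXSmul hf.1 (L2_integrable _))
    · exact (integrable_smoothSmul hf.1 (L2_integrable _)).add
        (integrable_dXSmul hf.1 (L2_integrable _))
  -- testing against `ζ ξ` for real smooth `ζ` and a constant spinor `ξ`
  have key (ξ : Spinor) (ζ : E4 → ℝ) (hζ : ContDiff ℝ ∞ ζ) :
      ∫ p : S3, (ζ p - ∑ j, dX j (dX j ζ) p) * (inner ℂ ξ (z 0 p)).re ∂vol3 = 0 := by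
    set s : E4 → Spinor := fun p => ζ p • ξ
    have hs : ContDiff ℝ ∞ s := hζ.smul contDiff_const
    have hds (j : Fin 3) (p : E4) : dX j s p = dX j ζ p • ξ := by
      have := dX_smul (j := j) (hζ.differentiable (by simp)).differentiableAt
        (differentiableAt_const ξ) (p := p)
      simp only [s, this]
      simp [dX]
    have hdsc (j : Fin 3) : Continuous (dX j s) := (contDiff_dX hs).continuous
    set w : PiLp 2 fun _ : Fin 4 => L2 := WithLp.toLp 2
      (Fin.cons (toL2 s hs.continuous) fun j => toL2 (dX j s) (hdsc j))
    have hw : w ∈ smoothGraph :=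
      ⟨s, hs, coeFn_toL2 hs.continuous, fun j => coeFn_toL2 (hdsc j)⟩
    have h1 := hzM w hw
    rw [PiLp.inner_apply, Fin.sum_univ_succ] at h1
    have hin (f : E4 → Spinor) (hf : Continuous f) (c : E4 → ℝ) (hc : ∀ p, f p = c p • ξ)
        (y : L2) : inner ℂ (toL2 f hf) y = inner ℂ ξ (∫ p : S3, c p • y p ∂vol3) := by
      have hcc : ξ ≠ 0 → Continuous c := by
        intro hξ
        have : c = fun p => (inner ℂ ξ (f p)).re / ‖ξ‖ ^ 2 := by
          funext p
          rw [hc, ← Complex.coe_smul, inner_smul_right, inner_self_eq_norm_sq_to_K]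
          have : ‖ξ‖ ≠ 0 := norm_ne_zero_iff.2 hξ
          rw [Complex.re_ofReal_mul, eq_div_iff (by positivity)]
          norm_cast
        rw [this]; fun_prop
      by_cases hξ : ξ = 0
      · have : toL2 f hf = 0 := by
          rw [Lp.eq_zero_iff_ae_eq_zero]
          filter_upwards [coeFn_toL2 hf] with p hp
          simp [hp, hc, hξ]
        rw [this, hξ, inner_zero_left, inner_zero_left]
      · rw [L2.inner_def, ← integral_inner (integrable_contSmul (f := fun p : S3 => c p)
          ((hcc hξ).comp continuous_subtype_val) (L2_integrable y))]
        refine integral_congr_ae ?_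
        filter_upwards [coeFn_toL2 hf] with p hp
        rw [hp, hc, ← Complex.coe_smul, ← Complex.coe_smul, inner_smul_left, inner_smul_right,
          Complex.conj_ofReal]
    have h2 : inner ℂ ξ (∫ p : S3, ζ p • z 0 p ∂vol3) +
        ∑ j : Fin 3, inner ℂ ξ (∫ p : S3, dX j ζ p • z j.succ p ∂vol3) = 0 := by
      rw [← h1]
      congr 1
      · exact (hin s hs.continuous ζ (fun p => rfl) (z 0)).symm
      · exact Finset.sum_congr rfl fun j _ => (hin _ (hdsc j) (dX j ζ) (hds j) (z j.succ)).symm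
    have h3 (j : Fin 3) : ∫ p : S3, dX j ζ p • z j.succ p ∂vol3 =
        - ∫ p : S3, dX j (dX j ζ) p • z 0 p ∂vol3 := by
      have := hz j (dX j ζ) (isTest_univ (contDiff_dX hζ))
      rw [integral_add (integrable_smoothSmul (contDiff_dX hζ) (L2_integrable _))
        (integrable_dXSmul (contDiff_dX hζ) (L2_integrable _))] at this
      exact eq_neg_of_add_eq_zero_left this
    simp only [h3] at h2
    rw [← inner_sum, ← inner_add_right, Finset.sum_neg_distrib, ← integral_finsetSum,
      ← sub_eq_add_neg, ← integral_sub, ← integral_inner] at h2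
    · have h4 := congrArg Complex.re h2
      rw [← RCLike.re_eq_complex_re, ← integral_re] at h4
      · rw [map_zero] at h4
        rw [← h4]
        refine integral_congr_ae (Eventually.of_forall fun p => ?_)
        simp only [← Finset.sum_smul, ← sub_smul]
        rw [← Complex.coe_smul, inner_smul_right, RCLike.re_eq_complex_re, Complex.re_ofReal_mul]
      · refine Integrable.const_inner ξ ((integrable_smoothSmul hζ (L2_integrable _)).sub
          (integrable_finsetSum _ fun j _ => integrable_dXSmul (contDiff_dX hζ) (L2_integrable _)))
    · exact (integrable_smoothSmul hζ (L2_integrable _)).sub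
        (integrable_finsetSum _ fun j _ => integrable_dXSmul (contDiff_dX hζ) (L2_integrable _))
    · exact integrable_smoothSmul hζ (L2_integrable _)
    · exact integrable_finsetSum _ fun j _ => integrable_dXSmul (contDiff_dX hζ) (L2_integrable _)
    · exact fun j _ => integrable_dXSmul (contDiff_dX hζ) (L2_integrable _)
  have hre (ξ : Spinor) : (fun p => (inner ℂ ξ (z 0 p)).re) =ᵐ[vol3] 0 := by
    refine ae_eq_zero_of_orthogonal_resolvent ?_ (key ξ)
    exact MemLp.re (𝕜 := ℂ) ((Lp.memLp (z 0)).const_inner ξ)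
  have hz0 : z 0 = 0 := by
    rw [Lp.eq_zero_iff_ae_eq_zero]
    have h1 := ae_all_iff.2 fun i : Fin 2 => hre (EuclideanSpace.single i 1)
    have h2 := ae_all_iff.2 fun i : Fin 2 => hre (EuclideanSpace.single i Complex.I)
    filter_upwards [h1, h2] with p e1 e2
    ext i
    have a1 := e1 i
    have a2 := e2 i
    simp only [EuclideanSpace.inner_single_left, Pi.zero_apply] at a1 a2
    apply Complex.ext
    · simpa using a1
    · simpa using a2
  have hzj (j : Fin 3) : z j.succ = 0 := by
    have h := hz j
    rw [hz0] at h
    exact (hasWeakDeriv_of_weakDeriv h (Eventually.of_forall fun p => mem_univ p)).eq_zero isOpen_univ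
  have hz00 : z = 0 := by
    ext1 i
    refine Fin.cases ?_ ?_ i
    · exact hz0
    · exact hzj
  have hxy : x = y := sub_eq_zero.1 hz00
  rw [hxy]
  exact hyM

/-- Smooth approximation in `H¹(𝕊³)²`. -/
theorem exists_smooth_approx {ψ : L2} {g : Fin 3 → L2} (h : ∀ j, WeakDeriv univ j ψ (g j)) :
    ∃ (s : ℕ → E4 → Spinor) (u : ℕ → L2) (v : ℕ → Fin 3 → L2), (∀ n, ContDiff ℝ ∞ (s n)) ∧
      (∀ n, u n =ᵐ[vol3] fun p : S3 => s n p) ∧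
      (∀ n j, v n j =ᵐ[vol3] fun p : S3 => dX j (s n) p) ∧
      Tendsto u atTop (𝓝 ψ) ∧ ∀ j, Tendsto (fun n => v n j) atTop (𝓝 (g j)) := by
  set x : PiLp 2 fun _ : Fin 4 => L2 := WithLp.toLp 2 (Fin.cons ψ g)
  obtain ⟨w, hw, hwx⟩ := mem_closure_iff_seq_limit.1 (mem_closure_smoothGraph (x := x) h)
  choose s hs h0 hj using hw
  exact ⟨s, fun n => w n 0, fun n j => w n j.succ, hs, h0, hj,
    ((PiLp.continuous_apply 2 _ 0).tendsto x).comp hwx,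
    fun j => ((PiLp.continuous_apply 2 _ j.succ).tendsto x).comp hwx⟩

/-! ### Clifford algebra -/

/-- Pauli matrices as operators on the spinor fibre. -/
def pauliOp (j : Fin 3) : Spinor →L[ℂ] Spinor :=
  Matrix.toEuclideanCLM (n := Fin 2) (𝕜 := ℂ) (pauli j)

lemma pauliOp_apply (j : Fin 3) (x : Spinor) :
    pauliOp j x = WithLp.toLp 2 ((pauli j).mulVec x) := rfl

lemma pauliOp_pauliOp (j : Fin 3) (x : Spinor) : pauliOp j (pauliOp j x) = x := by
  ext i
  have hI (c : ℂ) : -(Complex.I * c * Complex.I) = c := by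
    linear_combination -c * Complex.I_mul_I
  fin_cases j <;> fin_cases i <;>
    simp [pauliOp_apply, pauli, dotProduct, Fin.sum_univ_two, hI]

lemma inner_pauliOp (j : Fin 3) (x y : Spinor) :
    inner ℂ (pauliOp j x) y = inner ℂ x (pauliOp j y) := by
  fin_cases j <;>
    simp [pauliOp_apply, pauli, dotProduct, Fin.sum_univ_two, PiLp.inner_apply] <;> ring

lemma norm_pauliOp (j : Fin 3) (x : Spinor) : ‖pauliOp j x‖ = ‖x‖ := by
  have : ‖pauliOp j x‖ ^ 2 = ‖x‖ ^ 2 := by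
    have h := inner_pauliOp j x (pauliOp j x)
    rw [pauliOp_pauliOp, inner_self_eq_norm_sq_to_K, inner_self_eq_norm_sq_to_K] at h
    exact_mod_cast h
  exact (sq_eq_sq₀ (norm_nonneg _) (norm_nonneg _)).1 this

lemma clifford_ae (j : Fin 3) (ψ : L2) : clifford j ψ =ᵐ[vol3] fun p => pauliOp j (ψ p) :=
  ContinuousLinearMap.coeFn_compLpL _ _

/-- The Clifford product `∑_j σ_j y_j`; the Dirac expression is `-i` times this, up to a constant. -/
def slash (y : Fin 3 → Spinor) : Spinor := ∑ j, pauliOp j (y j)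

/-- `slash` on `L²`. -/
def slashL (g : Fin 3 → L2) : L2 := ∑ j, clifford j (g j)

lemma coeFn_sum_three (x : Fin 3 → L2) : ⇑(∑ j, x j) =ᵐ[vol3] fun p => ∑ j, x j p := by
  simp only [Fin.sum_univ_three]
  filter_upwards [Lp.coeFn_add (x 0 + x 1) (x 2), Lp.coeFn_add (x 0) (x 1)] with p h1 h2
  rw [h1, Pi.add_apply, h2, Pi.add_apply]

lemma slashL_ae (g : Fin 3 → L2) : slashL g =ᵐ[vol3] fun p => slash fun j => g j p := by
  filter_upwards [coeFn_sum_three fun j => clifford j (g j),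
    ae_all_iff.2 fun j => clifford_ae j (g j)] with p h1 h2
  rw [slashL, h1, slash]
  exact Finset.sum_congr rfl fun j _ => h2 j

lemma continuous_slashL : Continuous slashL := by
  unfold slashL; fun_prop

lemma norm_slash_le (y : Fin 3 → Spinor) : ‖slash y‖ ≤ ∑ j, ‖y j‖ := by
  refine (norm_sum_le _ _).trans (Finset.sum_le_sum fun j _ => (norm_pauliOp j _).le)

/-- The density `‖Py‖² - ∑ ‖y_j‖² + 2 Re⟨x, Py⟩`, `P = -i σ·y`, whose vanishing integral is the
Lichnerowicz formula. -/
def lichA (x : Spinor) (y : Fin 3 → Spinor) : ℝ :=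
  ‖slash y‖ ^ 2 - ∑ j, ‖y j‖ ^ 2 + 2 * (inner ℂ x ((-Complex.I) • slash y)).re

/-- The vector field whose divergence is `lichA`. -/
def lichB (j : Fin 3) (x : Spinor) (y : Fin 3 → Spinor) : ℝ :=
  (inner ℂ (pauliOp j x) (slash y)).re - (inner ℂ x (y j)).re

/-- The pointwise Lichnerowicz identity: `z j k` stands for `X_j X_k s`, with the commutators of the
frame fields. -/
lemma lichA_eq (x : Spinor) (y : Fin 3 → Spinor) (z : Fin 3 → Fin 3 → Spinor)
    (h01 : z 1 0 = z 0 1 + (2 : ℝ) • y 2) (h12 : z 2 1 = z 1 2 + (2 : ℝ) • y 0)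
    (h20 : z 0 2 = z 2 0 + (2 : ℝ) • y 1) :
    lichA x y = ∑ j, ((inner ℂ (pauliOp j (y j)) (slash y)).re +
      (inner ℂ (pauliOp j x) (slash (z j))).re - (inner ℂ (y j) (y j)).re -
      (inner ℂ x (z j j)).re) := by
  simp only [lichA, EuclideanSpace.norm_sq_eq, Fin.sum_univ_three, slash, h01, h12, h20]
  simp [pauliOp_apply, pauli, dotProduct, Fin.sum_univ_two, PiLp.inner_apply, Complex.sq_norm,
    Complex.normSq_apply, -inner_self_eq_norm_sq_to_K]
  ring

lemma dX_dX {V : Type*} [NormedAddCommGroup V] [NormedSpace ℝ V] {s : E4 → V}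
    (hs : ContDiff ℝ ∞ s) (j k : Fin 3) (p : E4) :
    dX j (dX k s) p = fderiv ℝ (fderiv ℝ s) p (frame j p) (frame k p) +
      fderiv ℝ s p (frame k (frame j p)) := by
  have h1 : HasFDerivAt (fderiv ℝ s) (fderiv ℝ (fderiv ℝ s) p) p :=
    ((hs.fderiv_right (m := ∞) (by simp)).differentiable (by simp)).differentiableAt.hasFDerivAt
  have h2 : HasFDerivAt (frame k) (frameL k) p := (frameL k).hasFDerivAt
  have := h1.clm_apply h2
  rw [dX, (show dX k s = fun q => fderiv ℝ s q (frame k q) from rfl), this.fderiv]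
  simp [add_comm]

lemma dX_comm {V : Type*} [NormedAddCommGroup V] [NormedSpace ℝ V] {s : E4 → V}
    (hs : ContDiff ℝ ∞ s) (j k l : Fin 3) (p : E4)
    (h : frame j (frame k p) = frame k (frame j p) + (2 : ℝ) • frame l p) :
    dX k (dX j s) p = dX j (dX k s) p + (2 : ℝ) • dX l s p := by
  rw [dX_dX hs, dX_dX hs, h, map_add, map_smul, ← add_assoc]
  congr 2
  have : IsSymmSndFDerivAt ℝ s p :=
    (contDiff_infty.1 hs 2).contDiffAt.isSymmSndFDerivAt
      (by rw [minSmoothness_of_isRCLikeNormedField]; rfl)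
  exact this.eq _ _

lemma hasDerivAt_rot_zero {V : Type*} [NormedAddCommGroup V] [NormedSpace ℝ V] {s : E4 → V}
    (hs : ContDiff ℝ ∞ s) (j : Fin 3) (p : E4) :
    HasDerivAt (fun t => s (rot j t p)) (dX j s p) 0 := by
  simpa [rot_zero] using hasDerivAt_comp_rot (j := j) (f := s) (p := p) (t := 0)
    (hs.differentiable (by simp)).differentiableAt

lemma dX_eq_of_hasDerivAt {V : Type*} [NormedAddCommGroup V] [NormedSpace ℝ V] {f : E4 → V}
    (hf : ContDiff ℝ ∞ f) {j : Fin 3} {p : E4} {v : V}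
    (h : HasDerivAt (fun t => f (rot j t p)) v 0) : dX j f p = v :=
  (hasDerivAt_rot_zero hf j p).unique h

lemma contDiff_inner_spinor {s t : E4 → Spinor} (hs : ContDiff ℝ ∞ s) (ht : ContDiff ℝ ∞ t) :
    ContDiff ℝ ∞ fun p => inner ℂ (s p) (t p) :=
  ContDiff.inner (𝕜 := ℂ) hs ht

lemma contDiff_clm {B : Spinor →L[ℂ] Spinor} {s : E4 → Spinor} (hs : ContDiff ℝ ∞ s) :
    ContDiff ℝ ∞ fun p => B (s p) := (B.restrictScalars ℝ).contDiff.comp hs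

lemma contDiff_re {f : E4 → ℂ} (hf : ContDiff ℝ ∞ f) : ContDiff ℝ ∞ fun p => (f p).re :=
  Complex.reCLM.contDiff.comp hf

lemma contDiff_slash {s : Fin 3 → E4 → Spinor} (hs : ∀ j, ContDiff ℝ ∞ (s j)) :
    ContDiff ℝ ∞ fun p => slash fun j => s j p :=
  ContDiff.sum fun j _ => contDiff_clm (hs j)

lemma hasDerivAt_inner_spinor {s t : ℝ → Spinor} {s' t' : Spinor} {x : ℝ}
    (hs : HasDerivAt s s' x) (ht : HasDerivAt t t' x) :
    HasDerivAt (fun r => inner ℂ (s r) (t r)) (inner ℂ (s x) t' + inner ℂ s' (t x)) x :=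
  hs.inner ℂ ht

lemma hasDerivAt_clm {B : Spinor →L[ℂ] Spinor} {s : ℝ → Spinor} {s' : Spinor} {x : ℝ}
    (hs : HasDerivAt s s' x) : HasDerivAt (fun r => B (s r)) (B s') x :=
  (B.restrictScalars ℝ).hasFDerivAt.comp_hasDerivAt x hs

lemma hasDerivAt_re {f : ℝ → ℂ} {f' : ℂ} {x : ℝ} (hf : HasDerivAt f f' x) :
    HasDerivAt (fun r => (f r).re) f'.re x :=
  Complex.reCLM.hasFDerivAt.comp_hasDerivAt x hf

lemma weakDiv_of_contDiff {V : Type*} [NormedAddCommGroup V] [NormedSpace ℝ V] [CompleteSpace V]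
    (U : Set S3) {a : E4 → V} {b : Fin 3 → E4 → V} (hb : ∀ j, ContDiff ℝ ∞ (b j))
    (h : ∀ p, a p = ∑ j, dX j (b j) p) : WeakDiv U (fun p => a p) (fun j p => b j p) := by
  intro f hf
  have e : ∀ p : S3, f p • a p + ∑ j, dX j f p • b j p = ∑ j, dX j (fun q => f q • b j q) p := by
    intro p
    rw [h, Finset.smul_sum, ← Finset.sum_add_distrib]
    exact Finset.sum_congr rfl fun j _ => (dX_smul (hf.1.differentiable (by simp)).differentiableAt
      ((hb j).differentiable (by simp)).differentiableAt).symm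
  rw [integral_congr_ae (Eventually.of_forall e), integral_finsetSum]
  · exact Finset.sum_eq_zero fun j _ => integral_dX j (hf.1.smul (hb j))
  · exact fun j _ => integrable_sphere (contDiff_dX (hf.1.smul (hb j))).continuous

/-- The Lichnerowicz identity for smooth spinors. -/
lemma weakDiv_lich_of_contDiff (U : Set S3) {s : E4 → Spinor} (hs : ContDiff ℝ ∞ s) :
    WeakDiv U (fun p => lichA (s p) fun j => dX j s p)
      (fun j p => lichB j (s p) fun k => dX k s p) := by
  have hy (k : Fin 3) : ContDiff ℝ ∞ (dX k s) := contDiff_dX hs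
  have hsl : ContDiff ℝ ∞ fun p => slash fun k => dX k s p := contDiff_slash hy
  have hb (j : Fin 3) : ContDiff ℝ ∞ fun p => lichB j (s p) fun k => dX k s p :=
    (contDiff_re (contDiff_inner_spinor (contDiff_clm hs) hsl)).sub
      (contDiff_re (contDiff_inner_spinor hs (hy j)))
  refine weakDiv_of_contDiff U (a := fun p => lichA (s p) fun j => dX j s p) hb fun p => ?_
  rw [lichA_eq (s p) (fun j => dX j s p) (fun j k => dX j (dX k s) p)]
  · refine Finset.sum_congr rfl fun j _ => ?_
    refine (dX_eq_of_hasDerivAt (hb j) ?_).symm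
    have d1 := hasDerivAt_rot_zero hs j p
    have d2 (k : Fin 3) := hasDerivAt_rot_zero (hy k) j p
    have d3 : HasDerivAt (fun t => slash fun k => dX k s (rot j t p))
        (slash fun k => dX j (dX k s) p) 0 :=
      HasDerivAt.fun_sum fun k _ => hasDerivAt_clm (d2 k)
    refine ((hasDerivAt_re (hasDerivAt_inner_spinor (hasDerivAt_clm (B := pauliOp j) d1) d3)).sub
      (hasDerivAt_re (hasDerivAt_inner_spinor d1 (d2 j)))).congr_deriv ?_
    simp only [rot_zero, Complex.add_re]
    ring
  · exact dX_comm hs 0 1 2 p (by ext i; fin_cases i <;> simp [frame] <;> ring)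
  · exact dX_comm hs 1 2 0 p (by ext i; fin_cases i <;> simp [frame] <;> ring)
  · exact dX_comm hs 2 0 1 p (by ext i; fin_cases i <;> simp [frame] <;> ring)

/-- The density of Green's formula for the Dirac operator. -/
def greenA (x : Spinor) (y : Fin 3 → Spinor) (x' : Spinor) (y' : Fin 3 → Spinor) : ℂ :=
  inner ℂ (slash y) x' + inner ℂ x (slash y')

/-- The vector field whose divergence is `greenA`. -/
def greenB (j : Fin 3) (x x' : Spinor) : ℂ := inner ℂ (pauliOp j x) x'

lemma weakDiv_green_of_contDiff (U : Set S3) {s t : E4 → Spinor} (hs : ContDiff ℝ ∞ s)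
    (ht : ContDiff ℝ ∞ t) :
    WeakDiv U (fun p => greenA (s p) (fun j => dX j s p) (t p) fun j => dX j t p)
      (fun j p => greenB j (s p) (t p)) := by
  have hb (j : Fin 3) : ContDiff ℝ ∞ fun p => greenB j (s p) (t p) :=
    contDiff_inner_spinor (contDiff_clm hs) ht
  refine weakDiv_of_contDiff U
    (a := fun p => greenA (s p) (fun j => dX j s p) (t p) fun j => dX j t p) hb fun p => ?_
  rw [greenA, slash, slash, sum_inner, inner_sum, ← Finset.sum_add_distrib]
  refine Finset.sum_congr rfl fun j _ => ?_
  refine (dX_eq_of_hasDerivAt (hb j) ?_).symm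
  refine (hasDerivAt_inner_spinor (hasDerivAt_clm (B := pauliOp j) (hasDerivAt_rot_zero hs j p))
    (hasDerivAt_rot_zero ht j p)).congr_deriv ?_
  simp only [rot_zero]
  rw [inner_pauliOp j (s p), add_comm]

/-! ### Integral identities for `H¹` spinors -/

/-- Multiplication of `L²` spinors by a bounded function. -/
def mulL2 (m : S3 → ℂ) (hm : MemLp m ⊤ vol3) : L2 →L[ℂ] L2 :=
  (ContinuousLinearMap.lsmul ℂ ℂ : ℂ →L[ℂ] Spinor →L[ℂ] Spinor).holderL vol3 ⊤ 2 2 (hm.toLp m)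

lemma mulL2_ae {m : S3 → ℂ} (hm : MemLp m ⊤ vol3) (ψ : L2) :
    mulL2 m hm ψ =ᵐ[vol3] fun p => m p • ψ p := by
  have h := ContinuousLinearMap.coeFn_holder (r := 2)
    (ContinuousLinearMap.lsmul ℂ ℂ : ℂ →L[ℂ] Spinor →L[ℂ] Spinor) (hm.toLp m) ψ
  filter_upwards [h, hm.coeFn_toLp] with p h1 h2
  rw [mulL2, ContinuousLinearMap.holderL_apply_apply, h1, h2]
  rfl

lemma memLp_top_ofReal {f : E4 → ℝ} (hf : Continuous f) :
    MemLp (fun p : S3 => (f p : ℂ)) ⊤ vol3 := by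
  have hc : Continuous fun p : S3 => (f p : ℂ) :=
    Complex.continuous_ofReal.comp (hf.comp continuous_subtype_val)
  exact hc.memLp_of_hasCompactSupport (HasCompactSupport.of_compactSpace _)

lemma integrable_inner_L2 (x y : L2) : Integrable (fun p => inner ℂ (x p) (y p)) vol3 :=
  L2.integrable_inner x y

lemma integral_smul_inner {f : E4 → ℝ} (hf : Continuous f) (x y : L2) :
    ∫ p : S3, f p • inner ℂ (x p) (y p) ∂vol3 = inner ℂ x (mulL2 _ (memLp_top_ofReal hf) y) := by
  rw [L2.inner_def]
  refine integral_congr_ae ?_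
  filter_upwards [mulL2_ae (memLp_top_ofReal hf) y] with p hp
  rw [hp, inner_smul_right, Complex.real_smul]

lemma integral_smul_re_inner {f : E4 → ℝ} (hf : ContDiff ℝ ∞ f) (x y : L2) :
    ∫ p : S3, f p • (inner ℂ (x p) (y p)).re ∂vol3 =
      (inner ℂ x (mulL2 _ (memLp_top_ofReal hf.continuous) y)).re := by
  rw [← integral_smul_inner hf.continuous]
  have h := integral_re (integrable_smoothSmul hf (integrable_inner_L2 x y))
  rw [← RCLike.re_eq_complex_re, ← h]
  refine integral_congr_ae (Eventually.of_forall fun p => ?_)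
  simp

lemma ae_eq_fun_three {x y : Fin 3 → S3 → Spinor} (h : ∀ j, x j =ᵐ[vol3] y j) :
    ∀ᵐ p ∂vol3, (fun j => x j p) = fun j => y j p := by
  filter_upwards [ae_all_iff.2 h] with p hp
  exact funext hp

lemma tendsto_inner_mul {f : E4 → ℝ} (hf : Continuous f) {x y : ℕ → L2} {x' y' : L2}
    (hx : Tendsto x atTop (𝓝 x')) (hy : Tendsto y atTop (𝓝 y')) :
    Tendsto (fun n => ∫ p : S3, f p • inner ℂ (x n p) (y n p) ∂vol3) atTop
      (𝓝 (∫ p : S3, f p • inner ℂ (x' p) (y' p) ∂vol3)) := by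
  simp only [integral_smul_inner hf]
  exact hx.inner (((mulL2 _ (memLp_top_ofReal hf)).continuous.tendsto y').comp hy)

lemma tendsto_re_inner_mul {f : E4 → ℝ} (hf : ContDiff ℝ ∞ f) {x y : ℕ → L2} {x' y' : L2}
    (hx : Tendsto x atTop (𝓝 x')) (hy : Tendsto y atTop (𝓝 y')) :
    Tendsto (fun n => ∫ p : S3, f p • (inner ℂ (x n p) (y n p)).re ∂vol3) atTop
      (𝓝 (∫ p : S3, f p • (inner ℂ (x' p) (y' p)).re ∂vol3)) := by
  simp only [integral_smul_re_inner hf]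
  exact (Complex.continuous_re.tendsto _).comp
    (hx.inner (((mulL2 _ (memLp_top_ofReal hf.continuous)).continuous.tendsto y').comp hy))

lemma integrable_re_inner_L2 (x y : L2) : Integrable (fun p => (inner ℂ (x p) (y p)).re) vol3 :=
  Integrable.re (𝕜 := ℂ) (integrable_inner_L2 x y)

lemma lichA_ae (ψ : L2) (g : Fin 3 → L2) : (fun p => lichA (ψ p) fun j => g j p) =ᵐ[vol3]
    fun p => (inner ℂ (slashL g p) (slashL g p)).re - ∑ j, (inner ℂ (g j p) (g j p)).re +
      2 * (inner ℂ (ψ p) (((-Complex.I) • slashL g : L2) p)).re := by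
  filter_upwards [slashL_ae g, Lp.coeFn_smul (-Complex.I) (slashL g)] with p h1 h2
  rw [h2, Pi.smul_apply, h1, lichA, ← RCLike.re_eq_complex_re]
  simp only [inner_self_eq_norm_sq]

lemma lichB_ae (j : Fin 3) (ψ : L2) (g : Fin 3 → L2) :
    (fun p => lichB j (ψ p) fun k => g k p) =ᵐ[vol3]
    fun p => (inner ℂ (clifford j ψ p) (slashL g p)).re - (inner ℂ (ψ p) (g j p)).re := by
  filter_upwards [slashL_ae g, clifford_ae j ψ] with p h1 h2
  rw [h1, h2, lichB]

lemma integrable_lichA (ψ : L2) (g : Fin 3 → L2) :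
    Integrable (fun p => lichA (ψ p) fun j => g j p) vol3 := by
  refine Integrable.congr ?_ (lichA_ae ψ g).symm
  exact ((integrable_re_inner_L2 _ _).sub (integrable_finsetSum _ fun j _ =>
    integrable_re_inner_L2 _ _)).add ((integrable_re_inner_L2 _ _).const_mul 2)

lemma integrable_lichB (j : Fin 3) (ψ : L2) (g : Fin 3 → L2) :
    Integrable (fun p => lichB j (ψ p) fun k => g k p) vol3 := by
  refine Integrable.congr ?_ (lichB_ae j ψ g).symm
  exact (integrable_re_inner_L2 _ _).sub (integrable_re_inner_L2 _ _)

lemma integral_lich {f : E4 → ℝ} (hf : ContDiff ℝ ∞ f) (ψ : L2) (g : Fin 3 → L2) :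
    ∫ p : S3, (f p • lichA (ψ p) (fun j => g j p) +
      ∑ j, dX j f p • lichB j (ψ p) fun k => g k p) ∂vol3 =
    (∫ p : S3, f p • (inner ℂ (slashL g p) (slashL g p)).re ∂vol3 -
      ∑ j, ∫ p : S3, f p • (inner ℂ (g j p) (g j p)).re ∂vol3 +
      2 * ∫ p : S3, f p • (inner ℂ (ψ p) (((-Complex.I) • slashL g : L2) p)).re ∂vol3) +
    ∑ j, (∫ p : S3, dX j f p • (inner ℂ (clifford j ψ p) (slashL g p)).re ∂vol3 -
      ∫ p : S3, dX j f p • (inner ℂ (ψ p) (g j p)).re ∂vol3) := by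
  have i0 (x y : L2) := integrable_smoothSmul hf (integrable_re_inner_L2 x y)
  have i1 (j : Fin 3) (x y : L2) := integrable_dXSmul (j := j) hf (integrable_re_inner_L2 x y)
  rw [integral_add (integrable_smoothSmul hf (integrable_lichA ψ g))
    (integrable_finsetSum _ fun j _ => integrable_dXSmul hf (integrable_lichB j ψ g)),
    integral_finsetSum _ fun j _ => integrable_dXSmul hf (integrable_lichB j ψ g)]
  congr 1
  · rw [← integral_finsetSum _ fun j _ => i0 _ _, ← integral_sub (i0 _ _)
      (integrable_finsetSum _ fun j _ => i0 _ _), ← integral_const_mul, ← integral_add]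
    · refine integral_congr_ae ?_
      filter_upwards [lichA_ae ψ g] with p hp
      rw [hp]
      simp only [smul_eq_mul, ← Finset.mul_sum]
      ring
    · exact (i0 _ _).sub (integrable_finsetSum _ fun j _ => i0 _ _)
    · exact (i0 _ _).const_mul 2
  · refine Finset.sum_congr rfl fun j _ => ?_
    rw [← integral_sub (i1 j _ _) (i1 j _ _)]
    refine integral_congr_ae ?_
    filter_upwards [lichB_ae j ψ g] with p hp
    rw [hp, smul_sub]

/-- The Lichnerowicz identity for spinors in `H¹(𝕊³)`. -/
theorem weakDiv_lich {ψ : L2} {g : Fin 3 → L2} (h : ∀ j, WeakDeriv univ j ψ (g j)) :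
    WeakDiv univ (fun p => lichA (ψ p) fun j => g j p) (fun j p => lichB j (ψ p) fun k => g k p) := by
  obtain ⟨s, u, v, hs, hu, hv, hut, hvt⟩ := exists_smooth_approx h
  intro f hf
  have hvt' : Tendsto v atTop (𝓝 g) := tendsto_pi_nhds.2 hvt
  have hsl : Tendsto (fun n => slashL (v n)) atTop (𝓝 (slashL g)) :=
    (continuous_slashL.tendsto g).comp hvt'
  have hzero (n : ℕ) : ∫ p : S3, (f p • lichA (u n p) (fun j => v n j p) +
      ∑ j, dX j f p • lichB j (u n p) fun k => v n k p) ∂vol3 = 0 := by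
    rw [← weakDiv_lich_of_contDiff univ (hs n) f hf]
    refine integral_congr_ae ?_
    filter_upwards [hu n, ae_eq_fun_three (hv n)] with p h1 h2
    rw [h1, h2]
  rw [integral_lich hf.1]
  simp only [integral_lich hf.1] at hzero
  refine tendsto_nhds_unique (l := atTop) ?_ ((tendsto_const_nhds (x := (0 : ℝ))).congr fun n => (hzero n).symm)
  refine Tendsto.add (Tendsto.add (Tendsto.sub ?_ ?_) (Tendsto.const_mul 2 ?_)) ?_
  · exact tendsto_re_inner_mul hf.1 hsl hsl
  · exact tendsto_finsetSum _ fun j _ => tendsto_re_inner_mul hf.1 (hvt j) (hvt j)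
  · exact tendsto_re_inner_mul hf.1 hut (hsl.const_smul _)
  · refine tendsto_finsetSum _ fun j _ => Tendsto.sub ?_ ?_
    · exact tendsto_re_inner_mul (contDiff_dX hf.1) (((clifford j).continuous.tendsto ψ).comp hut) hsl
    · exact tendsto_re_inner_mul (contDiff_dX hf.1) hut (hvt j)

lemma greenA_ae (ψ : L2) (g : Fin 3 → L2) (ψ' : L2) (g' : Fin 3 → L2) :
    (fun p => greenA (ψ p) (fun j => g j p) (ψ' p) fun j => g' j p) =ᵐ[vol3]
    fun p => inner ℂ (slashL g p) (ψ' p) + inner ℂ (ψ p) (slashL g' p) := by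
  filter_upwards [slashL_ae g, slashL_ae g'] with p h1 h2
  rw [h1, h2, greenA]

lemma greenB_ae (j : Fin 3) (ψ ψ' : L2) : (fun p => greenB j (ψ p) (ψ' p)) =ᵐ[vol3]
    fun p => inner ℂ (clifford j ψ p) (ψ' p) := by
  filter_upwards [clifford_ae j ψ] with p h1
  rw [h1, greenB]

lemma integrable_greenA (ψ : L2) (g : Fin 3 → L2) (ψ' : L2) (g' : Fin 3 → L2) :
    Integrable (fun p => greenA (ψ p) (fun j => g j p) (ψ' p) fun j => g' j p) vol3 :=
  ((integrable_inner_L2 _ _).add (integrable_inner_L2 _ _)).congr (greenA_ae ψ g ψ' g').symm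

lemma integrable_greenB (j : Fin 3) (ψ ψ' : L2) :
    Integrable (fun p => greenB j (ψ p) (ψ' p)) vol3 :=
  (integrable_inner_L2 _ _).congr (greenB_ae j ψ ψ').symm

lemma integral_green {f : E4 → ℝ} (hf : ContDiff ℝ ∞ f) (ψ : L2) (g : Fin 3 → L2) (ψ' : L2)
    (g' : Fin 3 → L2) :
    ∫ p : S3, (f p • greenA (ψ p) (fun j => g j p) (ψ' p) (fun j => g' j p) +
      ∑ j, dX j f p • greenB j (ψ p) (ψ' p)) ∂vol3 =
    (∫ p : S3, f p • inner ℂ (slashL g p) (ψ' p) ∂vol3 +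
      ∫ p : S3, f p • inner ℂ (ψ p) (slashL g' p) ∂vol3) +
    ∑ j, ∫ p : S3, dX j f p • inner ℂ (clifford j ψ p) (ψ' p) ∂vol3 := by
  have i0 (x y : L2) := integrable_smoothSmul hf (integrable_inner_L2 x y)
  rw [integral_add (integrable_smoothSmul hf (integrable_greenA ψ g ψ' g'))
    (integrable_finsetSum _ fun j _ => integrable_dXSmul hf (integrable_greenB j ψ ψ')),
    integral_finsetSum _ fun j _ => integrable_dXSmul hf (integrable_greenB j ψ ψ'),
    ← integral_add (i0 _ _) (i0 _ _)]
  congr 1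
  · refine integral_congr_ae ?_
    filter_upwards [greenA_ae ψ g ψ' g'] with p hp
    rw [hp, smul_add]
  · refine Finset.sum_congr rfl fun j _ => integral_congr_ae ?_
    filter_upwards [greenB_ae j ψ ψ'] with p hp
    rw [hp]

/-- Green's formula for the Dirac operator, for spinors in `H¹(𝕊³)`. -/
theorem weakDiv_green {ψ ψ' : L2} {g g' : Fin 3 → L2} (h : ∀ j, WeakDeriv univ j ψ (g j))
    (h' : ∀ j, WeakDeriv univ j ψ' (g' j)) :
    WeakDiv univ (fun p => greenA (ψ p) (fun j => g j p) (ψ' p) fun j => g' j p)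
      (fun j p => greenB j (ψ p) (ψ' p)) := by
  obtain ⟨s, u, v, hs, hu, hv, hut, hvt⟩ := exists_smooth_approx h
  obtain ⟨s', u', v', hs', hu', hv', hut', hvt'⟩ := exists_smooth_approx h'
  intro f hf
  have hsl : Tendsto (fun n => slashL (v n)) atTop (𝓝 (slashL g)) :=
    (continuous_slashL.tendsto g).comp (tendsto_pi_nhds.2 hvt)
  have hsl' : Tendsto (fun n => slashL (v' n)) atTop (𝓝 (slashL g')) :=
    (continuous_slashL.tendsto g').comp (tendsto_pi_nhds.2 hvt')
  have hzero (n : ℕ) : ∫ p : S3, (f p • greenA (u n p) (fun j => v n j p) (u' n p)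
      (fun j => v' n j p) + ∑ j, dX j f p • greenB j (u n p) (u' n p)) ∂vol3 = 0 := by
    rw [← weakDiv_green_of_contDiff univ (hs n) (hs' n) f hf]
    refine integral_congr_ae ?_
    filter_upwards [hu n, ae_eq_fun_three (hv n), hu' n, ae_eq_fun_three (hv' n)] with p h1 h2 h3 h4
    rw [h1, h2, h3, h4]
  rw [integral_green hf.1]
  simp only [integral_green hf.1] at hzero
  refine tendsto_nhds_unique (l := atTop) ?_ ((tendsto_const_nhds (x := (0 : ℂ))).congr fun n => (hzero n).symm)
  refine Tendsto.add (Tendsto.add ?_ ?_) ?_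
  · exact tendsto_inner_mul hf.1.continuous hsl hut'
  · exact tendsto_inner_mul hf.1.continuous hut hsl'
  · exact tendsto_finsetSum _ fun j _ => tendsto_inner_mul (contDiff_dX hf.1).continuous
      (((clifford j).continuous.tendsto ψ).comp hut) hut'

/-! ### Truncation of spinors -/

/-- The bounded spinor `w / (1 + δ|w|²)`; it tends to `w` as `δ → 0`. -/
def trunc (δ : ℝ) (w : Spinor) : Spinor := (1 + δ * ‖w‖ ^ 2)⁻¹ • w

/-- The derivative of `trunc δ` at `w` in the direction `g`. -/
def dTrunc (δ : ℝ) (w g : Spinor) : Spinor :=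
  (1 + δ * ‖w‖ ^ 2)⁻¹ • g -
    (2 * δ * (inner ℂ w g).re * ((1 + δ * ‖w‖ ^ 2)⁻¹ * (1 + δ * ‖w‖ ^ 2)⁻¹)) • w

lemma trunc_den_pos {δ : ℝ} (hδ : 0 ≤ δ) (w : Spinor) : 0 < 1 + δ * ‖w‖ ^ 2 := by positivity

lemma continuous_trunc {δ : ℝ} (hδ : 0 ≤ δ) : Continuous (trunc δ) := by
  have h (w : Spinor) : 1 + δ * ‖w‖ ^ 2 ≠ 0 := (trunc_den_pos hδ w).ne'
  unfold trunc
  fun_prop (disch := exact h _)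

lemma continuous_dTrunc {δ : ℝ} (hδ : 0 ≤ δ) : Continuous fun z : Spinor × Spinor => dTrunc δ z.1 z.2 := by
  have h (z : Spinor × Spinor) : 1 + δ * ‖z.1‖ ^ 2 ≠ 0 := (trunc_den_pos hδ z.1).ne'
  unfold dTrunc
  fun_prop (disch := exact h _)

lemma norm_trunc_le {δ : ℝ} (hδ : 0 ≤ δ) (w : Spinor) : ‖trunc δ w‖ ≤ ‖w‖ := by
  rw [trunc, norm_smul, Real.norm_of_nonneg (inv_nonneg.2 (trunc_den_pos hδ w).le)]
  refine mul_le_of_le_one_left (norm_nonneg _) (inv_le_one_of_one_le₀ ?_)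
  nlinarith [mul_nonneg hδ (sq_nonneg ‖w‖)]

lemma norm_dTrunc_le {δ : ℝ} (hδ : 0 ≤ δ) (w g : Spinor) : ‖dTrunc δ w g‖ ≤ 2 * ‖g‖ := by
  have hd := trunc_den_pos hδ w
  set d := 1 + δ * ‖w‖ ^ 2 with hdef
  have h1 : d⁻¹ ≤ 1 := inv_le_one_of_one_le₀ (by nlinarith [mul_nonneg hδ (sq_nonneg ‖w‖)])
  have h2 : |(inner ℂ w g).re| ≤ ‖w‖ * ‖g‖ :=
    (Complex.abs_re_le_norm _).trans (norm_inner_le_norm w g)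
  have h3 : ‖d⁻¹ • g‖ ≤ ‖g‖ := by
    rw [norm_smul, Real.norm_of_nonneg (inv_nonneg.2 hd.le)]
    exact mul_le_of_le_one_left (norm_nonneg _) h1
  have h4 : ‖(2 * δ * (inner ℂ w g).re * (d⁻¹ * d⁻¹)) • w‖ ≤ ‖g‖ := by
    rw [norm_smul, Real.norm_eq_abs, abs_mul, abs_mul, abs_of_nonneg (by positivity : 0 ≤ 2 * δ),
      abs_of_nonneg (by positivity : 0 ≤ d⁻¹ * d⁻¹)]
    calc 2 * δ * |(inner ℂ w g).re| * (d⁻¹ * d⁻¹) * ‖w‖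
        ≤ 2 * δ * (‖w‖ * ‖g‖) * (d⁻¹ * d⁻¹) * ‖w‖ := by gcongr
      _ = (2 * (δ * ‖w‖ ^ 2) * (d⁻¹ * d⁻¹)) * ‖g‖ := by ring
      _ ≤ 1 * ‖g‖ := by
        gcongr
        rw [← mul_inv, ← div_eq_mul_inv, div_le_one (by positivity)]
        nlinarith [sq_nonneg (δ * ‖w‖ ^ 2)]
      _ = ‖g‖ := one_mul _
  calc ‖dTrunc δ w g‖ ≤ _ := norm_sub_le _ _
    _ ≤ ‖g‖ + ‖g‖ := add_le_add h3 h4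
    _ = 2 * ‖g‖ := by ring

lemma hasDerivAt_trunc {δ : ℝ} (hδ : 0 ≤ δ) {s : ℝ → Spinor} {s' : Spinor} {x : ℝ} (hs : HasDerivAt s s' x) :
    HasDerivAt (fun r => trunc δ (s r)) (dTrunc δ (s x) s') x := by
  have hd := (trunc_den_pos hδ (s x)).ne'
  have h1 : HasDerivAt (fun r => ‖s r‖ ^ 2) (2 * (inner ℂ (s x) s').re) x := by
    have := hasDerivAt_re (hasDerivAt_inner_spinor hs hs)
    have e : (fun r => ‖s r‖ ^ 2) = fun r => (inner ℂ (s r) (s r)).re := by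
      funext r
      exact (inner_self_eq_norm_sq (𝕜 := ℂ) (s r)).symm
    rw [e]
    refine this.congr_deriv ?_
    have := inner_re_symm (𝕜 := ℂ) s' (s x)
    simp only [RCLike.re_eq_complex_re] at this
    rw [Complex.add_re, this]; ring
  have h2 := (((h1.const_mul δ).const_add 1).fun_inv hd).smul hs
  refine h2.congr_deriv ?_
  rw [dTrunc, div_eq_mul_inv, pow_two (1 + δ * ‖s x‖ ^ 2), mul_inv]
  module

lemma norm_trunc_sub_le {δ : ℝ} (hδ : 0 ≤ δ) (x y : Spinor) :
    ‖trunc δ x - trunc δ y‖ ≤ 2 * ‖x - y‖ := by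
  have hl (t : ℝ) : HasDerivAt (fun t : ℝ => y + t • (x - y)) (x - y) t := by
    simpa using ((hasDerivAt_id t).smul_const (x - y)).const_add y
  have h := norm_image_sub_le_of_norm_deriv_le_segment_01'
    (f := fun t : ℝ => trunc δ (y + t • (x - y)))
    (fun t _ => (hasDerivAt_trunc hδ (hl t)).hasDerivWithinAt) (fun t _ => norm_dTrunc_le hδ _ _)
  simpa using h

lemma contDiff_trunc {δ : ℝ} (hδ : 0 ≤ δ) {s : E4 → Spinor} (hs : ContDiff ℝ ∞ s) :
    ContDiff ℝ ∞ fun p => trunc δ (s p) := by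
  have h1 : ContDiff ℝ ∞ fun p => ‖s p‖ ^ 2 := hs.norm_sq ℂ
  exact ((contDiff_const.add (contDiff_const.mul h1)).inv
    fun _ => (trunc_den_pos hδ _).ne').smul hs

lemma dX_trunc {δ : ℝ} (hδ : 0 ≤ δ) {s : E4 → Spinor} (hs : ContDiff ℝ ∞ s) (j : Fin 3) (p : E4) :
    dX j (fun p => trunc δ (s p)) p = dTrunc δ (s p) (dX j s p) := by
  have h := hasDerivAt_trunc hδ (hasDerivAt_rot_zero hs j p)
  rw [rot_zero] at h
  exact dX_eq_of_hasDerivAt (contDiff_trunc hδ hs) h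

lemma memLp_trunc {δ : ℝ} (hδ : 0 ≤ δ) (ψ : L2) : MemLp (fun p => trunc δ (ψ p)) 2 vol3 :=
  (Lp.memLp ψ).mono ((continuous_trunc hδ).comp_aestronglyMeasurable (Lp.aestronglyMeasurable ψ))
    (Eventually.of_forall fun _ => norm_trunc_le hδ _)

lemma memLp_dTrunc {δ : ℝ} (hδ : 0 ≤ δ) (ψ g : L2) : MemLp (fun p => dTrunc δ (ψ p) (g p)) 2 vol3 := by
  have hψg : AEStronglyMeasurable (fun p => (ψ p, g p)) vol3 :=
    (Lp.aestronglyMeasurable ψ).prodMk (Lp.aestronglyMeasurable g)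
  have hm := Continuous.comp_aestronglyMeasurable (g := fun z : Spinor × Spinor => dTrunc δ z.1 z.2)
    (f := fun p => (ψ p, g p)) (continuous_dTrunc hδ) hψg
  exact (Lp.memLp g).of_le_mul hm (Eventually.of_forall fun _ => norm_dTrunc_le hδ _ _)

lemma dTrunc_sub (δ : ℝ) (w g g' : Spinor) : dTrunc δ w (g - g') = dTrunc δ w g - dTrunc δ w g' := by
  simp only [dTrunc, inner_sub_right, Complex.sub_re]
  module

lemma trunc_smul (δ : ℝ) {u : ℂ} (hu : ‖u‖ = 1) (w : Spinor) :
    trunc δ (u • w) = u • trunc δ w := by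
  rw [trunc, trunc, norm_smul, hu, one_mul, smul_comm]

lemma inner_unit_smul {u : ℂ} (hu : ‖u‖ = 1) (x y : Spinor) :
    inner ℂ (u • x) (u • y) = inner ℂ x y := by
  rw [inner_smul_left, inner_smul_right, ← mul_assoc, ← Complex.normSq_eq_conj_mul_self,
    Complex.normSq_eq_norm_sq, hu]
  simp

lemma dTrunc_smul (δ : ℝ) {u : ℂ} (hu : ‖u‖ = 1) (w g : Spinor) :
    dTrunc δ (u • w) (u • g) = u • dTrunc δ w g := by
  rw [dTrunc, dTrunc, inner_unit_smul hu, norm_smul, hu, one_mul, smul_sub, smul_comm u,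
    smul_comm u]

lemma exists_integral_norm_le : ∃ C : ℝ, ∀ x : L2, ∫ p, ‖x p‖ ∂vol3 ≤ C * ‖x‖ := by
  refine ⟨(vol3 univ ^ (1 / 2 : ℝ)).toReal, fun x => ?_⟩
  have h := eLpNorm_le_eLpNorm_mul_rpow_measure_univ (μ := vol3) (p := 1) (q := 2)
    (by norm_num) (Lp.aestronglyMeasurable x)
  norm_num at h
  rw [integral_norm_eq_lintegral_enorm (Lp.aestronglyMeasurable x), ← eLpNorm_one_eq_lintegral_enorm,
    Lp.norm_def, mul_comm, ← ENNReal.toReal_mul]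
  refine ENNReal.toReal_mono ?_ ?_
  · exact ENNReal.mul_ne_top (Lp.eLpNorm_ne_top x)
      (ENNReal.rpow_ne_top_of_nonneg (by norm_num) (measure_ne_top _ _))
  · simpa using h

lemma tendsto_integral_norm_sub {x : ℕ → L2} {y : L2} (h : Tendsto x atTop (𝓝 y)) :
    Tendsto (fun n => ∫ p, ‖x n p - y p‖ ∂vol3) atTop (𝓝 0) := by
  obtain ⟨C, hC⟩ := exists_integral_norm_le
  have h1 : Tendsto (fun n => C * ‖x n - y‖) atTop (𝓝 0) := by
    simpa using (tendsto_iff_norm_sub_tendsto_zero.1 h).const_mul C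
  refine squeeze_zero (fun n => integral_nonneg fun p => norm_nonneg _) (fun n => ?_) h1
  refine le_of_eq_of_le (integral_congr_ae ?_) (hC (x n - y))
  filter_upwards [Lp.coeFn_sub (x n) y] with p hp
  rw [hp, Pi.sub_apply]

/-- The chain rule for the truncation of spinors in `H¹(𝕊³)`. -/
theorem weakDeriv_trunc {δ : ℝ} (hδ : 0 ≤ δ) {ψ : L2} {g : Fin 3 → L2}
    (h : ∀ j, WeakDeriv univ j ψ (g j)) (j : Fin 3) :
    WeakDeriv univ j (fun p => trunc δ (ψ p)) (fun p => dTrunc δ (ψ p) (g j p)) := by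
  obtain ⟨s, u, v, hs, hu, hv, hut, hvt⟩ := exists_smooth_approx h
  obtain ⟨ns, hns, hae⟩ := (tendstoInMeasure_of_tendsto_Lp hut).exists_seq_tendsto_ae
  intro f hf
  have hzero (n : ℕ) : ∫ p : S3, (f p • dTrunc δ (u (ns n) p) (v (ns n) j p) +
      dX j f p • trunc δ (u (ns n) p)) ∂vol3 = 0 := by
    rw [← weakDeriv_of_contDiff univ j (contDiff_trunc hδ (hs (ns n))) f hf]
    refine integral_congr_ae ?_
    filter_upwards [hu (ns n), hv (ns n) j] with p h1 h2
    rw [h1, h2, dX_trunc hδ (hs _)]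
  obtain ⟨C, hC⟩ := isCompact_univ.exists_bound_of_continuousOn
    (hf.1.continuous.comp continuous_subtype_val : Continuous fun p : S3 => f p).continuousOn
  obtain ⟨C', hC'⟩ := isCompact_univ.exists_bound_of_continuousOn
    ((contDiff_dX (j := j) hf.1).continuous.comp continuous_subtype_val :
      Continuous fun p : S3 => dX j f p).continuousOn
  have i1 (x y : L2) : Integrable (fun p => dTrunc δ (x p) (y p)) vol3 :=
    (memLp_dTrunc hδ x y).integrable (by norm_num)
  have i2 (x : L2) : Integrable (fun p => trunc δ (x p)) vol3 :=
    (memLp_trunc hδ x).integrable (by norm_num)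
  have hvt' := (tendsto_integral_norm_sub (hvt j)).comp hns.tendsto_atTop
  -- the error from replacing the derivatives by their limit
  have t1 : Tendsto (fun n => ∫ p : S3, f p • (dTrunc δ (u (ns n) p) (v (ns n) j p) -
      dTrunc δ (u (ns n) p) (g j p)) ∂vol3) atTop (𝓝 0) := by
    have h1 : Tendsto (fun n => C * 2 * ∫ p, ‖v (ns n) j p - g j p‖ ∂vol3) atTop (𝓝 0) := by
      simpa using hvt'.const_mul (C * 2)
    refine squeeze_zero_norm (fun n => ?_) h1
    rw [← integral_const_mul]
    refine norm_integral_le_of_norm_le ?_ (Eventually.of_forall fun p => ?_)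
    · exact (((L2_integrable _).sub (L2_integrable _)).norm).const_mul _
    · rw [← dTrunc_sub, norm_smul, mul_assoc]
      gcongr
      · exact (norm_nonneg _).trans (hC p (mem_univ _))
      · exact hC p (mem_univ _)
      · exact norm_dTrunc_le hδ _ _
  -- with the limit derivative fixed, dominated convergence along an a.e. convergent subsequence
  have t2 : Tendsto (fun n => ∫ p : S3, f p • dTrunc δ (u (ns n) p) (g j p) ∂vol3) atTop
      (𝓝 (∫ p : S3, f p • dTrunc δ (ψ p) (g j p) ∂vol3)) := by
    refine tendsto_integral_of_dominated_convergence (fun p => C * (2 * ‖g j p‖))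
      (fun n => (integrable_smoothSmul hf.1 (i1 _ _)).aestronglyMeasurable)
      (((L2_integrable _).norm.const_mul _).const_mul _) (fun n => ?_) ?_
    · refine Eventually.of_forall fun p => ?_
      rw [norm_smul]
      gcongr
      · exact (norm_nonneg _).trans (hC p (mem_univ _))
      · exact hC p (mem_univ _)
      · exact norm_dTrunc_le hδ _ _
    · filter_upwards [hae] with p hp
      exact Tendsto.const_smul (((continuous_dTrunc hδ).tendsto (ψ p, g j p)).comp
        (hp.prodMk_nhds tendsto_const_nhds)) _
  have t3 : Tendsto (fun n => ∫ p : S3, dX j f p • trunc δ (u (ns n) p) ∂vol3) atTop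
      (𝓝 (∫ p : S3, dX j f p • trunc δ (ψ p) ∂vol3)) := by
    have h1 : Tendsto (fun n => C' * 2 * ∫ p, ‖u (ns n) p - ψ p‖ ∂vol3) atTop (𝓝 0) := by
      simpa using ((tendsto_integral_norm_sub hut).comp hns.tendsto_atTop).const_mul (C' * 2)
    refine tendsto_sub_nhds_zero_iff.1 (squeeze_zero_norm (fun n => ?_) h1)
    rw [← integral_sub (integrable_dXSmul hf.1 (i2 _)) (integrable_dXSmul hf.1 (i2 _)),
      ← integral_const_mul]
    refine norm_integral_le_of_norm_le ?_ (Eventually.of_forall fun p => ?_)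
    · exact (((L2_integrable _).sub (L2_integrable _)).norm).const_mul _
    · rw [← smul_sub, norm_smul, mul_assoc]
      gcongr
      · exact (norm_nonneg _).trans (hC' p (mem_univ _))
      · exact hC' p (mem_univ _)
      · exact norm_trunc_sub_le hδ _ _
  rw [integral_add (integrable_smoothSmul hf.1 (i1 _ _)) (integrable_dXSmul hf.1 (i2 _))]
  have t := (t1.add t2).add t3
  rw [zero_add] at t
  refine tendsto_nhds_unique (l := atTop) t
    ((tendsto_const_nhds (x := (0 : Spinor))).congr fun n => ?_)
  rw [← hzero n, integral_add (integrable_smoothSmul hf.1 (i1 _ _))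
    (integrable_dXSmul hf.1 (i2 _)), ← integral_add _ (integrable_smoothSmul hf.1 (i1 _ _))]
  · congr 1
    refine integral_congr_ae (Eventually.of_forall fun p => ?_)
    simp only [smul_sub, sub_add_cancel]
  · exact integrable_smoothSmul hf.1 ((i1 _ _).sub (i1 _ _))

/-! ### Removing a set of codimension two -/

/-- `Γ` has cutoff functions (equal to `0` near `Γ` and tending to `1` off `Γ`) whose gradients are
bounded in `L²` and supported in sets of small volume. -/
def HasCutoffs (Γ : Set S3) : Prop :=
  ∃ (C : ℝ) (η : ℕ → E4 → ℝ) (T : ℕ → Set S3) (L : ℕ → ℝ),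
    (∀ n, IsTest Γᶜ (η n)) ∧ (∀ n p, |η n p| ≤ 1) ∧
    (∀ᵐ p : S3 ∂vol3, Tendsto (fun n => η n p) atTop (𝓝 1)) ∧ (∀ n, MeasurableSet (T n)) ∧
    Tendsto (fun n => vol3 (T n)) atTop (𝓝 0) ∧ (∀ n, 0 ≤ L n) ∧
    (∀ n j (p : S3), |dX j (η n) p| ≤ (T n).indicator (fun _ => L n) p) ∧
    ∀ n, L n ^ 2 * vol3.real (T n) ≤ C

lemma setIntegral_le_sqrt {k : S3 → ℝ} (hk : MemLp k 2 vol3) (hk0 : ∀ p, 0 ≤ k p) (T : Set S3) :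
    ∫ p in T, k p ∂vol3 ≤ √(vol3.real T) * √(∫ p in T, k p ^ 2 ∂vol3) := by
  have h := integral_mul_le_Lp_mul_Lq_of_nonneg (μ := vol3.restrict T) (p := 2) (q := 2)
    Real.HolderConjugate.two_two (f := fun _ => (1 : ℝ)) (g := k)
    (Eventually.of_forall fun _ => zero_le_one) (Eventually.of_forall hk0)
    (memLp_const 1) (by simpa using hk.restrict T)
  simpa [Real.sqrt_eq_rpow, Measure.real] using h

/-- A weak divergence `a = ∑_j X_j b_j` off `Γ` has integral zero over the whole sphere if the `b_j`
are dominated by an `L²` function. -/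
lemma HasCutoffs.integral_eq_zero {Γ : Set S3} (hΓ : HasCutoffs Γ) {V : Type*}
    [NormedAddCommGroup V] [NormedSpace ℝ V] {a : S3 → V} {b : Fin 3 → S3 → V}
    (h : WeakDiv Γᶜ a b) (ha : Integrable a vol3) (hb : ∀ j, Integrable (b j) vol3) {k : S3 → ℝ}
    (hk : MemLp k 2 vol3) (hk0 : ∀ p, 0 ≤ k p) (hbk : ∀ j, ∀ᵐ p ∂vol3, ‖b j p‖ ≤ k p) :
    ∫ p, a p ∂vol3 = 0 := by
  obtain ⟨C, η, T, L, hη, hη1, hlim, hTm, hT0, hL0, hd, hC⟩ := hΓ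
  have t1 : Tendsto (fun n => ∫ p : S3, η n p • a p ∂vol3) atTop (𝓝 (∫ p, a p ∂vol3)) := by
    refine tendsto_integral_of_dominated_convergence (fun p => ‖a p‖)
      (fun n => (integrable_smoothSmul (hη n).1 ha).aestronglyMeasurable) ha.norm (fun n => ?_) ?_
    · refine Eventually.of_forall fun p => ?_
      rw [norm_smul]
      exact mul_le_of_le_one_left (norm_nonneg _) (hη1 n p)
    · filter_upwards [hlim] with p hp
      simpa using hp.smul_const (a p)
  have hk2 : Integrable (fun p => k p ^ 2) vol3 := hk.integrable_sq
  -- by the Cauchy–Schwarz inequality the gradient terms are `O(‖k‖_{L²(T n)})`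
  have t2 : Tendsto (fun n => 3 * (√C * √(∫ p in T n, k p ^ 2 ∂vol3))) atTop (𝓝 0) := by
    have := hk2.tendsto_setIntegral_nhds_zero hT0
    have h2 := (Real.continuous_sqrt.tendsto _).comp this
    rw [Real.sqrt_zero] at h2
    simpa using (h2.const_mul √C).const_mul 3
  refine tendsto_nhds_unique t1 (squeeze_zero_norm (fun n => ?_) t2)
  have h1 := h _ (hη n)
  rw [integral_add (integrable_smoothSmul (hη n).1 ha) (integrable_finsetSum _ fun j _ =>
    integrable_dXSmul (hη n).1 (hb j)), integral_finsetSum _ fun j _ =>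
    integrable_dXSmul (hη n).1 (hb j)] at h1
  rw [eq_neg_of_add_eq_zero_left h1, norm_neg]
  refine (norm_sum_le _ _).trans ?_
  have hj (j : Fin 3) : ‖∫ p : S3, dX j (η n) p • b j p ∂vol3‖ ≤
      √C * √(∫ p in T n, k p ^ 2 ∂vol3) := by
    calc ‖∫ p : S3, dX j (η n) p • b j p ∂vol3‖
        ≤ ∫ p, (T n).indicator (fun p => L n * k p) p ∂vol3 := by
          refine norm_integral_le_of_norm_le ?_ ?_
          · exact ((hk.integrable (by norm_num)).const_mul _).indicator (hTm n)
          · filter_upwards [hbk j] with p hp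
            rw [norm_smul, Real.norm_eq_abs]
            have := hd n j p
            by_cases hpT : p ∈ T n
            · rw [indicator_of_mem hpT] at this ⊢
              exact mul_le_mul this hp (norm_nonneg _) (hL0 n)
            · rw [indicator_of_notMem hpT] at this ⊢
              rw [le_antisymm this (abs_nonneg _), zero_mul]
      _ = L n * ∫ p in T n, k p ∂vol3 := by
          rw [integral_indicator (hTm n), integral_const_mul]
      _ ≤ L n * (√(vol3.real (T n)) * √(∫ p in T n, k p ^ 2 ∂vol3)) := by
          gcongr
          · exact hL0 n
          · exact setIntegral_le_sqrt hk hk0 _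
      _ = √(L n ^ 2 * vol3.real (T n)) * √(∫ p in T n, k p ^ 2 ∂vol3) := by
          rw [Real.sqrt_mul (sq_nonneg _), Real.sqrt_sq (hL0 n), mul_assoc]
      _ ≤ √C * √(∫ p in T n, k p ^ 2 ∂vol3) := by
          gcongr
          exact hC n
  refine (Finset.sum_le_sum fun j _ => hj j).trans ?_
  simp

/-! ### Spinors which are locally in `H¹` up to a gauge transformation -/

/-- On `U`, the spinor `u v` agrees with a spinor in `H¹(𝕊³)`, and its frame derivatives are
`u gv_j`. -/
def GaugeH1 (U : Set S3) (u : S3 → ℂ) (v : S3 → Spinor) (gv : Fin 3 → S3 → Spinor) : Prop :=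
  ∃ (w : L2) (G : Fin 3 → L2), (∀ j, WeakDeriv univ j w (G j)) ∧
    ∀ᵐ p ∂vol3, p ∈ U → w p = u p • v p ∧ ∀ j, G j p = u p • gv j p

lemma GaugeH1.mono {U U' : Set S3} (hU : U' ⊆ U) {u : S3 → ℂ} {v : S3 → Spinor}
    {gv : Fin 3 → S3 → Spinor} (h : GaugeH1 U u v gv) : GaugeH1 U' u v gv := by
  obtain ⟨w, G, h1, h2⟩ := h
  exact ⟨w, G, h1, h2.mono fun p hp hpU => hp (hU hpU)⟩

/-- The truncation of an `L²` spinor. -/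
def truncL {δ : ℝ} (hδ : 0 ≤ δ) (ψ : L2) : L2 := (memLp_trunc hδ ψ).toLp _

/-- The derivative of the truncation of an `L²` spinor. -/
def dTruncL {δ : ℝ} (hδ : 0 ≤ δ) (ψ g : L2) : L2 := (memLp_dTrunc hδ ψ g).toLp _

lemma truncL_ae {δ : ℝ} (hδ : 0 ≤ δ) (ψ : L2) : truncL hδ ψ =ᵐ[vol3] fun p => trunc δ (ψ p) :=
  MemLp.coeFn_toLp _

lemma dTruncL_ae {δ : ℝ} (hδ : 0 ≤ δ) (ψ g : L2) :
    dTruncL hδ ψ g =ᵐ[vol3] fun p => dTrunc δ (ψ p) (g p) :=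
  MemLp.coeFn_toLp _

lemma GaugeH1.trunc {U : Set S3} {u : S3 → ℂ} (hu : ∀ p, ‖u p‖ = 1) {ψ : L2} {g : Fin 3 → L2}
    (h : GaugeH1 U u ψ fun j => g j) {δ : ℝ} (hδ : 0 ≤ δ) :
    GaugeH1 U u (truncL hδ ψ) fun j => dTruncL hδ ψ (g j) := by
  obtain ⟨w, G, h1, h2⟩ := h
  refine ⟨truncL hδ w, fun j => dTruncL hδ w (G j), fun j => ?_, ?_⟩
  · exact (weakDeriv_trunc hδ h1 j).congr_ae (truncL_ae hδ w).symm (dTruncL_ae hδ w (G j)).symm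
  · filter_upwards [h2, truncL_ae hδ w, truncL_ae hδ ψ, ae_all_iff.2 fun j => dTruncL_ae hδ w (G j),
      ae_all_iff.2 fun j => dTruncL_ae hδ ψ (g j)] with p e1 e2 e3 e4 e5 hpU
    obtain ⟨a1, a2⟩ := e1 hpU
    refine ⟨by rw [e2, e3, a1, trunc_smul δ (hu p)], fun j => ?_⟩
    rw [e4, e5, a1, a2, dTrunc_smul δ (hu p)]

lemma slash_smul (u : ℂ) (y : Fin 3 → Spinor) : (slash fun j => u • y j) = u • slash y := by
  simp [slash, Finset.smul_sum]

lemma lichA_smul {u : ℂ} (hu : ‖u‖ = 1) (x : Spinor) (y : Fin 3 → Spinor) :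
    (lichA (u • x) fun j => u • y j) = lichA x y := by
  rw [lichA, slash_smul, smul_comm (-Complex.I) u, inner_unit_smul hu]
  simp only [norm_smul, hu, one_mul]
  rfl

lemma lichB_smul {u : ℂ} (hu : ‖u‖ = 1) (j : Fin 3) (x : Spinor) (y : Fin 3 → Spinor) :
    (lichB j (u • x) fun j => u • y j) = lichB j x y := by
  rw [lichB, slash_smul, map_smul, inner_unit_smul hu, inner_unit_smul hu]
  rfl

lemma greenA_smul {u : ℂ} (hu : ‖u‖ = 1) (x : Spinor) (y : Fin 3 → Spinor) (x' : Spinor)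
    (y' : Fin 3 → Spinor) :
    (greenA (u • x) (fun j => u • y j) (u • x') fun j => u • y' j) = greenA x y x' y' := by
  rw [greenA, slash_smul, slash_smul, inner_unit_smul hu, inner_unit_smul hu]
  rfl

lemma greenB_smul {u : ℂ} (hu : ‖u‖ = 1) (j : Fin 3) (x x' : Spinor) :
    greenB j (u • x) (u • x') = greenB j x x' := by
  rw [greenB, map_smul, inner_unit_smul hu]
  rfl

lemma WeakDiv.congr_on {V : Type*} [NormedAddCommGroup V] [NormedSpace ℝ V] {U : Set S3}
    {a a' : S3 → V} {b b' : Fin 3 → S3 → V} (h : WeakDiv U a b)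
    (he : ∀ᵐ p ∂vol3, p ∈ U → a p = a' p ∧ ∀ j, b j p = b' j p) : WeakDiv U a' b' := by
  intro f hf
  rw [← h f hf]
  refine integral_congr_ae ?_
  filter_upwards [he] with p hp
  by_cases hpU : p ∈ U
  · obtain ⟨e1, e2⟩ := hp hpU
    simp only [e1, e2]
  · simp only [hf.eq_zero hpU, hf.dX_eq_zero _ hpU, zero_smul]

lemma WeakDiv.mono {V : Type*} [NormedAddCommGroup V] [NormedSpace ℝ V] {U U' : Set S3}
    {a : S3 → V} {b : Fin 3 → S3 → V} (hU : U' ⊆ U) (h : WeakDiv U a b) : WeakDiv U' a b :=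
  fun f hf => h f (hf.mono hU)

lemma GaugeH1.weakDiv_lich {U : Set S3} {u : S3 → ℂ} (hu : ∀ p, ‖u p‖ = 1) {ψ : S3 → Spinor}
    {g : Fin 3 → S3 → Spinor} (h : GaugeH1 U u ψ g) :
    WeakDiv U (fun p => lichA (ψ p) fun j => g j p) (fun j p => lichB j (ψ p) fun k => g k p) := by
  obtain ⟨w, G, h1, h2⟩ := h
  refine ((MagneticLink.weakDiv_lich h1).mono (subset_univ U)).congr_on ?_
  filter_upwards [h2] with p hp hpU
  obtain ⟨e1, e2⟩ := hp hpU
  simp only [e1, e2, lichA_smul (hu p), lichB_smul (hu p), implies_true, and_self]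

lemma GaugeH1.weakDiv_green {U : Set S3} {u : S3 → ℂ} (hu : ∀ p, ‖u p‖ = 1) {ψ ψ' : S3 → Spinor}
    {g g' : Fin 3 → S3 → Spinor} (h : GaugeH1 U u ψ g) (h' : GaugeH1 U u ψ' g') :
    WeakDiv U (fun p => greenA (ψ p) (fun j => g j p) (ψ' p) fun j => g' j p)
      (fun j p => greenB j (ψ p) (ψ' p)) := by
  obtain ⟨w, G, h1, h2⟩ := h
  obtain ⟨w', G', h1', h2'⟩ := h'
  refine ((MagneticLink.weakDiv_green h1 h1').mono (subset_univ U)).congr_on ?_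
  filter_upwards [h2, h2'] with p hp hp' hpU
  obtain ⟨e1, e2⟩ := hp hpU
  obtain ⟨e1', e2'⟩ := hp' hpU
  simp only [e1, e2, e1', e2', greenA_smul (hu p), greenB_smul (hu p), implies_true, and_self]

lemma norm_trunc_le_const {δ : ℝ} (hδ : 0 < δ) (w : Spinor) : ‖trunc δ w‖ ≤ 1 + δ⁻¹ := by
  have hd := trunc_den_pos hδ.le w
  rw [trunc, norm_smul, Real.norm_of_nonneg (inv_nonneg.2 hd.le), inv_mul_le_iff₀ hd]
  have h1 : δ * δ⁻¹ = 1 := mul_inv_cancel₀ hδ.ne'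
  have h2 : (1 + δ * ‖w‖ ^ 2) * (1 + δ⁻¹) =
      1 + δ⁻¹ + δ * ‖w‖ ^ 2 + ‖w‖ ^ 2 * (δ * δ⁻¹) := by ring
  rw [h2, h1]
  have := inv_pos.2 hδ
  nlinarith [sq_nonneg (‖w‖ - 1), mul_nonneg hδ.le (sq_nonneg ‖w‖), norm_nonneg w]

lemma continuous_slash : Continuous slash := by unfold slash; fun_prop

lemma continuous_lichA : Continuous fun z : Spinor × (Fin 3 → Spinor) => lichA z.1 z.2 := by
  have := continuous_slash
  unfold lichA
  refine Continuous.add (by fun_prop) (continuous_const.mul (Complex.continuous_re.comp ?_))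
  have h : Continuous fun z : Spinor × (Fin 3 → Spinor) => (-Complex.I) • slash z.2 :=
    have h' : Continuous fun z : Spinor × (Fin 3 → Spinor) => slash z.2 :=
      continuous_slash.comp continuous_snd
    by fun_prop
  exact continuous_fst.inner h

lemma abs_lichB_le (j : Fin 3) (x : Spinor) (y : Fin 3 → Spinor) :
    |lichB j x y| ≤ ‖x‖ * (2 * ∑ k, ‖y k‖) := by
  have h1 : |(inner ℂ (pauliOp j x) (slash y)).re| ≤ ‖x‖ * ∑ k, ‖y k‖ := by
    refine (Complex.abs_re_le_norm _).trans ((norm_inner_le_norm _ _).trans ?_)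
    rw [norm_pauliOp]
    gcongr
    exact norm_slash_le y
  have h2 : |(inner ℂ x (y j)).re| ≤ ‖x‖ * ∑ k, ‖y k‖ := by
    refine (Complex.abs_re_le_norm _).trans ((norm_inner_le_norm _ _).trans ?_)
    gcongr
    exact Finset.single_le_sum (f := fun k => ‖y k‖) (fun k _ => norm_nonneg _) (Finset.mem_univ j)
  rw [lichB]
  refine (abs_sub _ _).trans ?_
  linarith

lemma abs_lichA_le (x : Spinor) (y : Fin 3 → Spinor) :
    |lichA x y| ≤ ‖x‖ ^ 2 + 3 * (∑ k, ‖y k‖) ^ 2 := by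
  have h1 := norm_slash_le y
  have h2 : |2 * (inner ℂ x ((-Complex.I) • slash y)).re| ≤ 2 * (‖x‖ * ∑ k, ‖y k‖) := by
    rw [abs_mul, abs_two]
    gcongr
    refine (Complex.abs_re_le_norm _).trans ((norm_inner_le_norm _ _).trans ?_)
    rw [norm_smul]
    simp only [norm_neg, Complex.norm_I, one_mul]
    gcongr
  have h3 : ∑ j, ‖y j‖ ^ 2 ≤ (∑ k, ‖y k‖) ^ 2 :=
    Finset.sum_sq_le_sq_sum_of_nonneg fun k _ => norm_nonneg _
  have h4 : 0 ≤ ∑ j, ‖y j‖ ^ 2 := Finset.sum_nonneg fun k _ => sq_nonneg _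
  have h5 : ‖slash y‖ ^ 2 ≤ (∑ k, ‖y k‖) ^ 2 := pow_le_pow_left₀ (norm_nonneg _) h1 2
  have h6 := two_mul_le_add_sq ‖x‖ (∑ k, ‖y k‖)
  have h7 := sq_nonneg ‖slash y‖
  obtain ⟨h8, h9⟩ := abs_le.1 h2
  rw [lichA, abs_le]
  constructor <;> nlinarith

lemma memLp_sum_norm (g : Fin 3 → L2) : MemLp (fun p => ∑ k, ‖g k p‖) 2 vol3 :=
  memLp_finsetSum _ fun k _ => (Lp.memLp (g k)).norm

lemma tendsto_trunc {δ : ℕ → ℝ} (h : Tendsto δ atTop (𝓝 0)) (w : Spinor) :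
    Tendsto (fun n => trunc (δ n) w) atTop (𝓝 w) := by
  have h1 : Tendsto (fun n => (1 + δ n * ‖w‖ ^ 2)⁻¹) atTop (𝓝 (1 + 0 * ‖w‖ ^ 2)⁻¹) :=
    ((h.mul_const _).const_add 1).inv₀ (by simp)
  simpa [trunc] using h1.smul_const w

lemma tendsto_dTrunc {δ : ℕ → ℝ} (h : Tendsto δ atTop (𝓝 0)) (w g : Spinor) :
    Tendsto (fun n => dTrunc (δ n) w g) atTop (𝓝 g) := by
  have h1 : Tendsto (fun n => (1 + δ n * ‖w‖ ^ 2)⁻¹) atTop (𝓝 (1 + 0 * ‖w‖ ^ 2)⁻¹) :=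
    ((h.mul_const _).const_add 1).inv₀ (by simp)
  have h2 := ((h.const_mul 2).mul_const (inner ℂ w g).re).mul (h1.mul h1)
  simpa [dTrunc] using (h1.smul_const g).sub (h2.smul_const w)

lemma tendsto_delta : Tendsto (fun n : ℕ => 1 / ((n : ℝ) + 1)) atTop (𝓝 0) :=
  tendsto_one_div_add_atTop_nhds_zero_nat

/-- The Lichnerowicz formula for spinors which off `Γ` are gauge equivalent to `H¹` spinors. The
vector field `lichB` is dominated by an `L²` function only for bounded `ψ`, so the formula is first
proved for the truncations of `ψ`. -/
theorem integral_lichA_eq_zero {Γ : Set S3} (hΓ : HasCutoffs Γ) {ψ : L2} {g : Fin 3 → L2}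
    (h : ∀ q ∉ Γ, ∃ U u, IsOpen U ∧ q ∈ U ∧ (∀ p, ‖u p‖ = 1) ∧ GaugeH1 U u ψ fun j => g j) :
    ∫ p, lichA (ψ p) (fun j => g j p) ∂vol3 = 0 := by
  have hpos (n : ℕ) : 0 < 1 / ((n : ℝ) + 1) := by positivity
  have hzero (n : ℕ) : ∫ p, lichA (truncL (hpos n).le ψ p)
      (fun j => dTruncL (hpos n).le ψ (g j) p) ∂vol3 = 0 := by
    have iA := integrable_lichA (truncL (hpos n).le ψ) fun j => dTruncL (hpos n).le ψ (g j)
    have iB (j : Fin 3) :=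
      integrable_lichB j (truncL (hpos n).le ψ) fun j => dTruncL (hpos n).le ψ (g j)
    refine hΓ.integral_eq_zero (weakDiv_of_local iA iB fun q hq => ?_) iA iB
      (k := fun p => (1 + (1 / ((n : ℝ) + 1))⁻¹) * (2 * ∑ k, ‖dTruncL (hpos n).le ψ (g k) p‖))
      (((memLp_sum_norm _).const_mul 2).const_mul _) (fun p => by positivity) fun j => ?_
    · obtain ⟨U, u, hU, hqU, hu, H⟩ := h q hq
      exact ⟨U, hU, hqU, (H.trunc hu (hpos n).le).weakDiv_lich hu⟩
    · filter_upwards [truncL_ae (hpos n).le ψ] with p hp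
      refine (abs_lichB_le j _ _).trans ?_
      gcongr
      rw [hp]
      exact norm_trunc_le_const (hpos n) _
  refine tendsto_nhds_unique (l := atTop) ?_
    ((tendsto_const_nhds (x := (0 : ℝ))).congr fun n => (hzero n).symm)
  refine tendsto_integral_of_dominated_convergence
    (fun p => ‖ψ p‖ ^ 2 + 3 * (2 * ∑ k, ‖g k p‖) ^ 2)
    (fun n => (integrable_lichA _ _).aestronglyMeasurable) ?_ (fun n => ?_) ?_
  · exact ((Lp.memLp ψ).norm.integrable_sq).add
      (((memLp_sum_norm g).const_mul 2).integrable_sq.const_mul 3)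
  · filter_upwards [truncL_ae (hpos n).le ψ,
      ae_all_iff.2 fun j => dTruncL_ae (hpos n).le ψ (g j)] with p h1 h2
    refine (abs_lichA_le _ _).trans ?_
    rw [Finset.mul_sum]
    gcongr with k
    · rw [h1]; exact norm_trunc_le (hpos n).le _
    · rw [h2]; exact norm_dTrunc_le (hpos n).le _ _
  · filter_upwards [ae_all_iff.2 fun n => truncL_ae (hpos n).le ψ,
      ae_all_iff.2 fun n => ae_all_iff.2 fun j => dTruncL_ae (hpos n).le ψ (g j)] with p h1 h2
    simp only [h1, h2]
    have key := Tendsto.comp (g := fun z : Spinor × (Fin 3 → Spinor) => lichA z.1 z.2)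
      (f := fun n : ℕ => (trunc (1 / ((n : ℝ) + 1)) (ψ p),
        fun j => dTrunc (1 / ((n : ℝ) + 1)) (ψ p) (g j p)))
      (continuous_lichA.tendsto (ψ p, fun j => g j p)) ((tendsto_trunc tendsto_delta
      _).prodMk_nhds (tendsto_pi_nhds.2 fun j => tendsto_dTrunc tendsto_delta _ _))
    exact key

/-- Green's formula for the Dirac operator, for a spinor `ψ` which is gauge equivalent to `H¹`
spinors off `Γ` with `L²` derivatives, and an `L²` spinor `v` which in the same gauge is locally in
`H¹` off `Γ`, with `σ·Xv ∈ L²`. The derivatives of `v` itself need not be in `L²`. -/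
theorem green_formula {Γ : Set S3} (hΓ : HasCutoffs Γ) {ψ : L2} {g : Fin 3 → L2} {v : L2}
    {gv : Fin 3 → S3 → Spinor} {r : L2} (hr : r =ᵐ[vol3] fun p => slash fun j => gv j p)
    (h : ∀ q ∉ Γ, ∃ U u, IsOpen U ∧ q ∈ U ∧ (∀ p, ‖u p‖ = 1) ∧ GaugeH1 U u ψ (fun j => g j) ∧
      GaugeH1 U u v gv) :
    inner ℂ (slashL g) v + inner ℂ ψ r = 0 := by
  have hpos (n : ℕ) : 0 < 1 / ((n : ℝ) + 1) := by positivity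
  have hzero (n : ℕ) : ∫ p, (inner ℂ (slashL (fun j => dTruncL (hpos n).le ψ (g j)) p) (v p) +
      inner ℂ (truncL (hpos n).le ψ p) (r p)) ∂vol3 = 0 := by
    have iA := (integrable_inner_L2 (slashL fun j => dTruncL (hpos n).le ψ (g j)) v).add
      (integrable_inner_L2 (truncL (hpos n).le ψ) r)
    have iB (j : Fin 3) := integrable_greenB j (truncL (hpos n).le ψ) v
    refine hΓ.integral_eq_zero (weakDiv_of_local iA iB fun q hq => ?_) iA iB
      (k := fun p => (1 + (1 / ((n : ℝ) + 1))⁻¹) * ‖v p‖)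
      ((Lp.memLp v).norm.const_mul _) (fun p => by positivity) fun j => ?_
    · obtain ⟨U, u, hU, hqU, hu, H, H'⟩ := h q hq
      refine ⟨U, hU, hqU, ((H.trunc hu (hpos n).le).weakDiv_green hu H').congr_on ?_⟩
      filter_upwards [hr, slashL_ae fun j => dTruncL (hpos n).le ψ (g j)] with p h1 h2 _
      refine ⟨?_, fun j => rfl⟩
      simp only [greenA, h1, h2]
    · filter_upwards [truncL_ae (hpos n).le ψ] with p hp
      refine (norm_inner_le_norm _ _).trans ?_
      rw [norm_pauliOp]
      gcongr
      rw [hp]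
      exact norm_trunc_le_const (hpos n) _
  rw [L2.inner_def, L2.inner_def, ← integral_add (integrable_inner_L2 _ _)
    (integrable_inner_L2 _ _)]
  refine tendsto_nhds_unique (l := atTop) ?_
    ((tendsto_const_nhds (x := (0 : ℂ))).congr fun n => (hzero n).symm)
  refine tendsto_integral_of_dominated_convergence
    (fun p => (2 * ∑ k, ‖g k p‖) * ‖v p‖ + ‖ψ p‖ * ‖r p‖)
    (fun n => ((integrable_inner_L2 _ _).add (integrable_inner_L2 _ _)).aestronglyMeasurable)
    ?_ (fun n => ?_) ?_
  · exact (((memLp_sum_norm g).const_mul 2).integrable_mul (Lp.memLp v).norm).add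
      ((Lp.memLp ψ).norm.integrable_mul (Lp.memLp r).norm)
  · filter_upwards [truncL_ae (hpos n).le ψ, slashL_ae fun j => dTruncL (hpos n).le ψ (g j),
      ae_all_iff.2 fun j => dTruncL_ae (hpos n).le ψ (g j)] with p h1 h2 h3
    refine (norm_add_le _ _).trans (add_le_add ?_ ?_)
    · refine (norm_inner_le_norm _ _).trans ?_
      gcongr
      rw [h2, Finset.mul_sum]
      refine (norm_slash_le _).trans (Finset.sum_le_sum fun k _ => ?_)
      rw [h3]
      exact norm_dTrunc_le (hpos n).le _ _
    · refine (norm_inner_le_norm _ _).trans ?_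
      gcongr
      rw [h1]
      exact norm_trunc_le (hpos n).le _
  · filter_upwards [ae_all_iff.2 fun n => truncL_ae (hpos n).le ψ,
      ae_all_iff.2 fun n => slashL_ae fun j => dTruncL (hpos n).le ψ (g j),
      ae_all_iff.2 fun n => ae_all_iff.2 fun j => dTruncL_ae (hpos n).le ψ (g j),
      slashL_ae g] with p h1 h2 h3 h4
    simp only [h1, h2, h3, h4]
    refine Tendsto.add (Tendsto.inner ?_ tendsto_const_nhds)
      (Tendsto.inner (tendsto_trunc tendsto_delta _) tendsto_const_nhds)
    have key := Tendsto.comp (g := slash)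
      (f := fun n : ℕ => fun j => dTrunc (1 / ((n : ℝ) + 1)) (ψ p) (g j p))
      (continuous_slash.tendsto fun j => g j p)
      (tendsto_pi_nhds.2 fun j => tendsto_dTrunc tendsto_delta _ _)
    exact key

/-- Localisation: a spinor whose gauge transform has weak derivatives on `U` is gauge equivalent
to `H¹` spinors near every point of `U`. The neighbourhood does not depend on the spinor. -/
lemma exists_gaugeH1 {U : Set S3} (hU : IsOpen U) {u : S3 → ℂ} (hum : Measurable u)
    (hu : ∀ p, ‖u p‖ = 1) {q : S3} (hq : q ∈ U) :
    ∃ U', IsOpen U' ∧ q ∈ U' ∧ ∀ (ψ : L2) (g : Fin 3 → L2),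
      (∀ j, WeakDeriv U j (fun p => u p • ψ p) (fun p => u p • g j p)) →
      GaugeH1 U' u ψ fun j => g j := by
  obtain ⟨ζ, hζ, -, hζ1⟩ := exists_test_eq_one (A := {q}) isClosed_singleton hU
    (singleton_subset_iff.2 hq)
  have hζq : ∀ᶠ p : S3 in 𝓝 q, ζ p = 1 := by simpa using hζ1
  obtain ⟨U', hU'1, hU'o, hqU'⟩ := eventually_nhds_iff.1 hζq
  refine ⟨U', hU'o, hqU', fun ψ g H => ?_⟩
  have hut : MemLp u ⊤ vol3 := memLp_top_of_bound hum.aestronglyMeasurable 1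
    (Eventually.of_forall fun p => (hu p).le)
  have hm (f : E4 → ℝ) (hf : ContDiff ℝ ∞ f) : MemLp (fun p : S3 => (f p : ℂ) * u p) ⊤ vol3 :=
    hut.mul (memLp_top_ofReal hf.continuous)
  have hdζ (j : Fin 3) : ContDiff ℝ ∞ (dX j ζ) := contDiff_dX hζ.1
  refine ⟨mulL2 _ (hm ζ hζ.1) ψ, fun j => mulL2 _ (hm ζ hζ.1) (g j) + mulL2 _ (hm _ (hdζ j)) ψ,
    fun j f hf => ?_, ?_⟩
  · rw [← H j _ (hζ.mul_right hf.1)]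
    refine integral_congr_ae ?_
    filter_upwards [mulL2_ae (hm ζ hζ.1) ψ, mulL2_ae (hm ζ hζ.1) (g j), mulL2_ae (hm _ (hdζ j)) ψ,
      Lp.coeFn_add (mulL2 _ (hm ζ hζ.1) (g j)) (mulL2 _ (hm _ (hdζ j)) ψ)] with p e1 e2 e3 e4
    have e5 := dX_smul (j := j) (p := p) (hf.1.differentiable (by simp)).differentiableAt
      (hζ.1.differentiable (by simp)).differentiableAt
    simp only [smul_eq_mul] at e5
    rw [e5, e4, Pi.add_apply, e1, e2, e3]
    simp only [mul_smul, Complex.coe_smul, smul_add, add_smul]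
    abel
  · filter_upwards [mulL2_ae (hm ζ hζ.1) ψ, ae_all_iff.2 fun j => mulL2_ae (hm ζ hζ.1) (g j),
      ae_all_iff.2 fun j => mulL2_ae (hm _ (hdζ j)) ψ, ae_all_iff.2 fun j =>
      Lp.coeFn_add (mulL2 _ (hm ζ hζ.1) (g j)) (mulL2 _ (hm _ (hdζ j)) ψ)] with p e1 e2 e3 e4 hp
    have z1 : ζ p = 1 := hU'1 p hp
    refine ⟨by rw [e1, z1]; simp, fun j => ?_⟩
    have z2 : dX j ζ p = 0 := by
      rw [dX_congr (g := fun _ => (1 : ℝ)) (hζ.1.differentiable (by simp)).differentiableAt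
        (by fun_prop) (eventually_of_mem (hU'o.mem_nhds hp) hU'1)]
      simp [dX]
    rw [e4, Pi.add_apply, e2, e3, z1, z2]
    simp

/-! ### Cutoff functions around knots -/

/-- Mollification of a Lipschitz function at scale `r`. -/
lemma exists_mollification {f : E4 → ℝ} {L : NNReal} (hf : LipschitzWith L f) {r : ℝ} (hr : 0 < r) :
    ∃ F : E4 → ℝ, ContDiff ℝ ∞ F ∧ LipschitzWith L F ∧
      (∀ x a, (∀ y ∈ Metric.ball x r, f y = a) → F x = a) ∧
      ∀ C, (∀ x, |f x| ≤ C) → ∀ x, |F x| ≤ C := by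
  let φ : ContDiffBump (0 : E4) := ⟨r / 2, r, half_pos hr, half_lt_self hr⟩
  have hφc : Continuous (φ.normed volume) := φ.contDiff_normed (n := 0) |>.continuous
  have hφs : HasCompactSupport (φ.normed (volume : Measure E4)) := φ.hasCompactSupport_normed
  have hint (x : E4) : Integrable (fun t => φ.normed volume t * f (x - t)) := by
    refine Continuous.integrable_of_hasCompactSupport ?_ (hφs.mul_right)
    exact hφc.mul (hf.continuous.comp (by fun_prop))
  have h1 : ∫ t, φ.normed (volume : Measure E4) t = 1 := φ.integral_normed
  have hi1 : Integrable (φ.normed (volume : Measure E4)) := φ.integrable_normed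
  refine ⟨fun x => ∫ t, φ.normed volume t * f (x - t), ?_, ?_, fun x a h => ?_, fun C h x => ?_⟩
  · exact hφs.contDiff_convolution_left (ContinuousLinearMap.mul ℝ ℝ)
      φ.contDiff_normed hf.continuous.locallyIntegrable
  · refine LipschitzWith.of_dist_le_mul fun x y => ?_
    rw [dist_eq_norm, ← integral_sub (hint x) (hint y)]
    calc ‖∫ t, (φ.normed volume t * f (x - t) - φ.normed volume t * f (y - t))‖
        ≤ ∫ t, φ.normed volume t * (L * dist x y) := by
          refine norm_integral_le_of_norm_le (hi1.mul_const _) (Eventually.of_forall fun t => ?_)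
          rw [← mul_sub, norm_mul, Real.norm_of_nonneg (φ.nonneg_normed t)]
          refine mul_le_mul_of_nonneg_left ?_ (φ.nonneg_normed t)
          have := hf.dist_le_mul (x - t) (y - t)
          rwa [dist_sub_right, dist_eq_norm] at this
      _ = L * dist x y := by rw [integral_mul_const, h1, one_mul]
  · calc ∫ t, φ.normed volume t * f (x - t) = ∫ t, φ.normed volume t * a := by
          refine integral_congr_ae (Eventually.of_forall fun t => ?_)
          by_cases ht : t ∈ Metric.ball (0 : E4) r
          · have : x - t ∈ Metric.ball x r := by simpa [dist_eq_norm] using ht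
            simp only [h _ this]
          · have : t ∉ Function.support (φ.normed (volume : Measure E4)) := by
              rwa [φ.support_normed_eq]
            simp only [Function.notMem_support.1 this, zero_mul]
      _ = a := by rw [integral_mul_const, h1, one_mul]
  · calc |∫ t, φ.normed volume t * f (x - t)| ≤ ∫ t, φ.normed volume t * C := by
          rw [← Real.norm_eq_abs]
          refine norm_integral_le_of_norm_le (hi1.mul_const _) (Eventually.of_forall fun t => ?_)
          rw [norm_mul, Real.norm_of_nonneg (φ.nonneg_normed t)]
          exact mul_le_mul_of_nonneg_left (h _) (φ.nonneg_normed t)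
      _ = C := by rw [integral_mul_const, h1, one_mul]

/-- The tubes around `Γ` have volume `O(r²)`. -/
def HasSmallTubes (Γ : Set S3) : Prop :=
  ∃ C, 0 ≤ C ∧ ∀ r, 0 < r → r ≤ 1 → vol3 (Metric.thickening r Γ) ≤ ENNReal.ofReal (C * r ^ 2)

lemma HasSmallTubes.iUnion {ι : Type*} [Finite ι] {Γ : ι → Set S3} (h : ∀ i, HasSmallTubes (Γ i)) :
    HasSmallTubes (⋃ i, Γ i) := by
  have := Fintype.ofFinite ι
  choose C h0 h using h
  refine ⟨∑ i, C i, Finset.sum_nonneg fun i _ => h0 i, fun r hr hr1 => ?_⟩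
  rw [Metric.thickening_iUnion, Finset.sum_mul,
    ENNReal.ofReal_sum_of_nonneg fun i _ => mul_nonneg (h0 i) (sq_nonneg r)]
  exact (measure_iUnion_fintype_le _ _).trans (Finset.sum_le_sum fun i _ => h i r hr hr1)

lemma IsKnot.isCompact {γ : Set S3} (h : IsKnot γ) : IsCompact γ := by
  obtain ⟨c, hc, hper, -, -, hγ⟩ := h
  rw [Topology.IsEmbedding.subtypeVal.isCompact_iff, ← hγ, ← Function.Periodic.image_Icc
    (c := (1 : ℝ)) hper one_pos 0]
  exact isCompact_Icc.image hc.continuous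

lemma IsKnot.nonempty {γ : Set S3} (h : IsKnot γ) : γ.Nonempty := by
  obtain ⟨c, -, -, -, -, hγ⟩ := h
  have : c 0 ∈ Subtype.val '' γ := hγ ▸ mem_range_self 0
  obtain ⟨p, hp, -⟩ := this
  exact ⟨p, hp⟩

/-- A tube of radius `r` around a curve of finite length is covered by `O(1/r)` balls of radius
`O(r)`. -/
lemma IsKnot.hasSmallTubes {γ : Set S3} (h : IsKnot γ) : HasSmallTubes γ := by
  obtain ⟨c, hc, hper, -, -, hγ⟩ := h
  obtain ⟨C, hC, hball⟩ := exists_vol3_ball_le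
  obtain ⟨M, hM⟩ := isCompact_Icc.exists_bound_of_continuousOn (s := Icc (0 : ℝ) 1)
    (hc.continuous_deriv (by simp)).continuousOn
  have hM0 : 0 ≤ M := (norm_nonneg _).trans (hM 0 (by simp))
  have hmem (t : ℝ) : ∃ p : S3, p ∈ γ ∧ (p : E4) = c t := by
    have : c t ∈ Subtype.val '' γ := hγ ▸ mem_range_self t
    exact this
  choose P hPγ hP using hmem
  have hlip (s t : ℝ) (hs : s ∈ Icc (0 : ℝ) 1) (ht : t ∈ Icc (0 : ℝ) 1) :
      dist (P s) (P t) ≤ M * |s - t| := by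
    rw [Subtype.dist_eq, hP, hP, dist_eq_norm, ← Real.norm_eq_abs]
    exact (convex_Icc 0 1).norm_image_sub_le_of_norm_deriv_le
      (fun x _ => (hc.differentiable (by simp)).differentiableAt) hM ht hs
  refine ⟨2 * (C * (M + 1) ^ 3), by positivity, fun r hr hr1 => ?_⟩
  set N : ℕ := ⌈1 / r⌉₊ with hN
  have hN1 : 1 / r ≤ N := Nat.le_ceil _
  have hN2 : (N : ℝ) < 1 / r + 1 := Nat.ceil_lt_add_one (by positivity)
  have hNpos : (0 : ℝ) < N := lt_of_lt_of_le (by positivity) hN1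
  have hNr : 1 ≤ N * r := by rwa [div_le_iff₀ hr] at hN1
  have hsub : Metric.thickening r γ ⊆ ⋃ i ∈ Finset.range N, Metric.ball (P (i / N)) ((M + 1) * r) := by
    intro x hx
    obtain ⟨y, hy, hxy⟩ := Metric.mem_thickening_iff.1 hx
    have : (y : E4) ∈ c '' Ico 0 1 := by
      obtain ⟨s, hs⟩ : (y : E4) ∈ range c := hγ ▸ mem_image_of_mem _ hy
      obtain ⟨t, ht, hst⟩ := Function.Periodic.exists_mem_Ico₀ (c := (1 : ℝ)) hper one_pos s
      exact ⟨t, ht, hst ▸ hs⟩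
    obtain ⟨t, ht, hty⟩ := this
    have hyP : y = P t := Subtype.ext (by rw [hP, hty])
    have htN : 0 ≤ t * N := mul_nonneg ht.1 hNpos.le
    have hk1 : (⌊t * N⌋₊ : ℝ) ≤ t * N := Nat.floor_le htN
    have hk2 : t * N < ⌊t * N⌋₊ + 1 := Nat.lt_floor_add_one _
    have hkN : ⌊t * N⌋₊ < N := by
      have : (⌊t * N⌋₊ : ℝ) < N := hk1.trans_lt (by nlinarith [ht.2])
      exact_mod_cast this
    refine mem_iUnion₂.2 ⟨⌊t * N⌋₊, Finset.mem_range.2 hkN, ?_⟩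
    have hd : |t - ⌊t * N⌋₊ / N| ≤ r := by
      have e : t - ⌊t * N⌋₊ / N = (t * N - ⌊t * N⌋₊) / N := by field_simp
      rw [e, abs_of_nonneg (div_nonneg (by linarith) hNpos.le), div_le_iff₀ hNpos]
      linarith
    have hle := hlip t (⌊t * N⌋₊ / N) ⟨ht.1, ht.2.le⟩
      ⟨by positivity, by rw [div_le_one hNpos]; exact_mod_cast hkN.le⟩
    rw [Metric.mem_ball]
    calc dist x (P (⌊t * N⌋₊ / N)) ≤ dist x y + dist y (P (⌊t * N⌋₊ / N)) := dist_triangle _ _ _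
      _ < r + M * r := by
          refine add_lt_add_of_lt_of_le hxy ?_
          rw [hyP]
          exact hle.trans (mul_le_mul_of_nonneg_left hd hM0)
      _ = (M + 1) * r := by ring
  calc vol3 (Metric.thickening r γ)
      ≤ ∑ i ∈ Finset.range N, vol3 (Metric.ball (P (i / N)) ((M + 1) * r)) :=
        (measure_mono hsub).trans (measure_biUnion_finset_le _ _)
    _ ≤ ∑ i ∈ Finset.range N, ENNReal.ofReal (C * ((M + 1) * r) ^ 3) :=
        Finset.sum_le_sum fun i _ => hball _ _ (by positivity)
    _ = ENNReal.ofReal (N * (C * ((M + 1) * r) ^ 3)) := by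
        rw [Finset.sum_const, Finset.card_range, nsmul_eq_mul,
          ENNReal.ofReal_mul (p := (N : ℝ)) (by positivity), ENNReal.ofReal_natCast]
    _ ≤ ENNReal.ofReal (2 * (C * (M + 1) ^ 3) * r ^ 2) := by
        refine ENNReal.ofReal_le_ofReal ?_
        have : N * r ≤ 2 := by
          have : N * r < (1 / r + 1) * r := mul_lt_mul_of_pos_right hN2 hr
          have e : (1 / r + 1) * r = 1 + r := by field_simp
          linarith
        calc N * (C * ((M + 1) * r) ^ 3) = N * r * (C * (M + 1) ^ 3 * r ^ 2) := by ring
          _ ≤ 2 * (C * (M + 1) ^ 3 * r ^ 2) := by gcongr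
          _ = _ := by ring

lemma HasSmallTubes.vol3_eq_zero {Γ : Set S3} (h : HasSmallTubes Γ) : vol3 Γ = 0 := by
  obtain ⟨C, -, h⟩ := h
  have hlim : Tendsto (fun r : ℝ => ENNReal.ofReal (C * r ^ 2)) (𝓝[>] 0) (𝓝 0) := by
    have : Continuous fun r : ℝ => ENNReal.ofReal (C * r ^ 2) :=
      ENNReal.continuous_ofReal.comp (by fun_prop)
    have h2 := (this.tendsto 0).mono_left (nhdsWithin_le_nhds (s := Ioi 0))
    simpa using h2
  refine le_antisymm (ge_of_tendsto hlim ?_) (zero_le)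
  filter_upwards [Ioc_mem_nhdsGT (zero_lt_one' ℝ)] with r hr
  exact (measure_mono (Metric.self_subset_thickening hr.1 Γ)).trans (h r hr.1 hr.2)

/-- Mollify a cutoff function of `L dist(·, Γ)`: its gradient is `O(L)` and supported in a tube of
volume `O(L⁻²)`. -/
lemma HasSmallTubes.hasCutoffs {Γ : Set S3} (hc : IsClosed Γ) (hne : Γ.Nonempty)
    (h : HasSmallTubes Γ) : HasCutoffs Γ := by
  have hnull := h.vol3_eq_zero
  obtain ⟨C, hC, h⟩ := h
  set G : Set E4 := Subtype.val '' Γ with hG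
  have hGne : G.Nonempty := hne.image _
  have hdist (p : S3) : Metric.infDist (p : E4) G = Metric.infDist p Γ :=
    Metric.infDist_image isometry_subtype_coe
  -- the scale of the `n`-th cutoff
  set L : ℕ → ℝ := fun n => n + 3 with hL
  have hL3 (n : ℕ) : 3 ≤ L n := by simp [hL]
  have hLpos (n : ℕ) : 0 < L n := by linarith [hL3 n]
  have hex (n : ℕ) : ∃ F : E4 → ℝ, ContDiff ℝ ∞ F ∧ LipschitzWith (L n).toNNReal F ∧
      (∀ x, Metric.infDist x G < 1 / (2 * L n) → F x = 0) ∧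
      (∀ x, 5 / (2 * L n) < Metric.infDist x G → F x = 1) ∧ ∀ x, |F x| ≤ 1 := by
    have hlip : LipschitzWith (L n).toNNReal
        fun x => min 1 (max 0 (L n * Metric.infDist x G - 1)) := by
      have h1 : LipschitzWith (L n).toNNReal fun x => L n * Metric.infDist x G - 1 := by
        refine LipschitzWith.of_dist_le_mul fun x y => ?_
        rw [Real.dist_eq, sub_sub_sub_cancel_right, ← mul_sub, abs_mul, abs_of_pos (hLpos n),
          Real.coe_toNNReal _ (hLpos n).le]
        have := (Metric.lipschitz_infDist_pt G).dist_le_mul x y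
        rw [Real.dist_eq, NNReal.coe_one, one_mul] at this
        exact mul_le_mul_of_nonneg_left this (hLpos n).le
      exact (h1.const_max 0).const_min 1
    have hLi : 0 < 1 / (2 * L n) := by have := hLpos n; positivity
    obtain ⟨F, h1, h2, h3, h4⟩ := exists_mollification hlip hLi
    have hLn := hLpos n
    refine ⟨F, h1, h2, fun x hx => h3 x 0 fun y hy => ?_, fun x hx => h3 x 1 fun y hy => ?_,
      h4 1 fun x => ?_⟩
    · have h5 : Metric.infDist y G ≤ Metric.infDist x G + dist y x := Metric.infDist_le_infDist_add_dist
      have h6 : Metric.infDist y G ≤ 1 / L n := by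
        have : 1 / L n = 1 / (2 * L n) + 1 / (2 * L n) := by field_simp; norm_num
        linarith [Metric.mem_ball.1 hy]
      have h7 : L n * Metric.infDist y G ≤ 1 := by rwa [le_div_iff₀' hLn] at h6
      rw [max_eq_left (by linarith), min_eq_right zero_le_one]
    · have h5 : Metric.infDist x G ≤ Metric.infDist y G + dist x y := Metric.infDist_le_infDist_add_dist
      have h6 : 2 / L n ≤ Metric.infDist y G := by
        have : 5 / (2 * L n) = 2 / L n + 1 / (2 * L n) := by field_simp; norm_num
        rw [dist_comm] at h5
        linarith [Metric.mem_ball.1 hy]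
      have h7 : 2 ≤ L n * Metric.infDist y G := by rwa [div_le_iff₀' hLn] at h6
      rw [max_eq_right (by linarith), min_eq_left (by linarith)]
    · rw [abs_of_nonneg (le_min zero_le_one (le_max_left _ _))]
      exact min_le_left _ _
  choose F hF hFL hF0 hF1 hFb using hex
  have hTsub (n : ℕ) : vol3 (Metric.thickening (3 / L n) Γ) ≤ ENNReal.ofReal (C * (3 / L n) ^ 2) :=
    h _ (div_pos three_pos (hLpos n)) ((div_le_one (hLpos n)).2 (hL3 n))
  have hLlim : Tendsto L atTop atTop := tendsto_atTop_add_const_right _ _ tendsto_natCast_atTop_atTop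
  refine ⟨9 * C, F, fun n => Metric.thickening (3 / L n) Γ, L, fun n => ⟨hF n, ?_⟩, hFb, ?_,
    fun n => Metric.isOpen_thickening.measurableSet, ?_, fun n => (hLpos n).le, fun n j p => ?_,
    fun n => ?_⟩
  · have hcl : IsClosed {p : S3 | 1 / (2 * L n) ≤ Metric.infDist p Γ} :=
      isClosed_le continuous_const (Metric.continuous_infDist_pt Γ)
    have hs : Function.support (fun p : S3 => F n p) ⊆
        {p : S3 | 1 / (2 * L n) ≤ Metric.infDist p Γ} := by
      intro p hp
      by_contra hlt
      refine hp (hF0 n p ?_)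
      rw [hdist]
      exact not_le.1 hlt
    intro p hp hpΓ
    have := closure_minimal hs hcl hp
    rw [mem_ofPred_eq, Metric.infDist_zero_of_mem hpΓ] at this
    have hLn := hLpos n
    exact absurd this (not_le.2 (by positivity))
  · have : ∀ᵐ p ∂vol3, p ∉ Γ := measure_eq_zero_iff_ae_notMem.1 hnull
    filter_upwards [this] with p hp
    have hpos : 0 < Metric.infDist p Γ := (hc.notMem_iff_infDist_pos hne).1 hp
    have hlim : Tendsto (fun n => 5 / (2 * L n)) atTop (𝓝 0) :=
      tendsto_const_nhds.div_atTop (hLlim.const_mul_atTop two_pos)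
    refine tendsto_const_nhds.congr' ?_
    filter_upwards [(tendsto_order.1 hlim).2 _ hpos] with n hn
    rw [hF1 n p (by rwa [hdist])]
  · refine tendsto_of_tendsto_of_tendsto_of_le_of_le tendsto_const_nhds ?_ (fun n => zero_le)
      hTsub
    have : Tendsto (fun n => C * (3 / L n) ^ 2) atTop (𝓝 (C * 0 ^ 2)) :=
      ((tendsto_const_nhds.div_atTop hLlim).pow 2).const_mul C
    simpa using ENNReal.tendsto_ofReal this
  · by_cases hp : p ∈ Metric.thickening (3 / L n) Γ
    · rw [indicator_of_mem hp]
      have h1 := norm_fderiv_le_of_lipschitz ℝ (hFL n) (x₀ := (p : E4))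
      rw [Real.coe_toNNReal _ (hLpos n).le] at h1
      have h2 := (fderiv ℝ (F n) p).le_of_opNorm_le h1 (frame j p)
      rw [norm_frame, norm_eq_of_mem_sphere, mul_one] at h2
      exact h2
    · rw [indicator_of_notMem hp, Metric.mem_thickening_iff_infDist_lt hne, ← hdist, not_lt] at *
      have hlt : 5 / (2 * L n) < Metric.infDist (p : E4) G := by
        refine lt_of_lt_of_le ?_ hp
        have := hLpos n
        rw [div_lt_div_iff₀ (by positivity) this]
        nlinarith
      have hev : ∀ᶠ x in 𝓝 (p : E4), F n x = 1 := by
        filter_upwards [(Metric.continuous_infDist_pt G).continuousAt.eventually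
          (lt_mem_nhds hlt)] with x hx
        exact hF1 n x hx
      have : fderiv ℝ (F n) p = 0 := by
        rw [Filter.EventuallyEq.fderiv_eq (f := fun _ => (1 : ℝ)) hev]
        simp
      simp [dX, this]
  · have h1 : vol3.real (Metric.thickening (3 / L n) Γ) ≤ C * (3 / L n) ^ 2 :=
      ENNReal.toReal_le_of_le_ofReal (by positivity) (hTsub n)
    have := hLpos n
    calc L n ^ 2 * vol3.real (Metric.thickening (3 / L n) Γ) ≤ L n ^ 2 * (C * (3 / L n) ^ 2) := by
          gcongr
      _ = 9 * C := by field_simp; norm_num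

variable {K : ℕ} {S : Fin K → OrientedSurface}

/-- The link `⋃ γ_k`. -/
def link (S : Fin K → OrientedSurface) : Set S3 := ⋃ k, (S k).boundary

lemma IsSeifertFamily.isClosed_link (hS : IsSeifertFamily S) : IsClosed (link S) :=
  isClosed_iUnion_of_finite fun k => (hS.knot k).isCompact.isClosed

lemma IsSeifertFamily.hasCutoffs (hS : IsSeifertFamily S) (hK : 1 ≤ K) : HasCutoffs (link S) := by
  refine HasSmallTubes.hasCutoffs hS.isClosed_link ?_
    (HasSmallTubes.iUnion fun k => (hS.knot k).hasSmallTubes)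
  obtain ⟨p, hp⟩ := (hS.knot ⟨0, hK⟩).nonempty
  exact ⟨p, mem_iUnion.2 ⟨_, hp⟩⟩

/-! ### Sets of area zero are removable -/

lemma dist_rotS_left (j : Fin 3) (s t : ℝ) (p : S3) : dist (rotS j s p) (rotS j t p) ≤ |s - t| := by
  rw [Subtype.dist_eq, coe_rotS, coe_rotS, dist_eq_norm, ← Real.norm_eq_abs]
  refine (convex_univ (𝕜 := ℝ)).norm_image_sub_le_of_norm_hasDerivWithin_le (C := 1)
    (fun x _ => (hasDerivAt_rot j p x).hasDerivWithinAt) (fun x _ => ?_) (mem_univ t)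
    (mem_univ s) |>.trans_eq (one_mul _)
  rw [norm_frame, norm_rot, norm_eq_of_mem_sphere]

lemma dist_rotS_right (j : Fin 3) (t : ℝ) (p q : S3) :
    dist (rotS j t p) (rotS j t q) = dist p q :=
  (rotIso j t).dist_map p q

lemma rotS_periodic (j : Fin 3) (p : S3) : Function.Periodic (fun t => rotS j t p) (2 * Real.pi) :=
  fun t => Subtype.ext (by simp [rot])

/-- The union of the integral curves of `X_j` through the points of `E`. -/
def orbit (j : Fin 3) (E : Set S3) : Set S3 := {p | ∃ t, rotS j t p ∈ E}

/-- The integral curves through a set of diameter `d` form a tube of radius `O(d)` around a circle. -/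
lemma exists_vol3_orbit_le : ∃ C : ℝ, 0 < C ∧ ∀ (j : Fin 3) (A : Set S3) (d : ℝ), 0 < d → d ≤ 1 →
    (∀ x ∈ A, ∀ y ∈ A, dist x y ≤ d) → vol3 (orbit j A) ≤ ENNReal.ofReal (C * d ^ 2) := by
  obtain ⟨C, hC, hball⟩ := exists_vol3_ball_le
  refine ⟨8 * (27 * C), by positivity, fun j A d hd hd1 hA => ?_⟩
  rcases A.eq_empty_or_nonempty with rfl | ⟨a, ha⟩
  · simp [orbit]
  set N : ℕ := ⌊2 * Real.pi / d⌋₊ + 1 with hN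
  have hsub : orbit j A ⊆ ⋃ i ∈ Finset.range N, Metric.ball (rotS j (i * d) a) (3 * d) := by
    rintro p ⟨t, ht⟩
    obtain ⟨s, ⟨hs0, hs1⟩, hs⟩ := (rotS_periodic j (rotS j t p)).exists_mem_Ico₀
      Real.two_pi_pos (-t)
    have hp : p = rotS j s (rotS j t p) := by
      have h1 : rotS j (-t) (rotS j t p) = p := by rw [rotS_rotS, neg_add_cancel, rotS_zero]
      exact h1.symm.trans hs
    have hsd : 0 ≤ s / d := by positivity
    have hk1 : (⌊s / d⌋₊ : ℝ) * d ≤ s := by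
      have := Nat.floor_le hsd
      rwa [le_div_iff₀ hd] at this
    have hk2 : s < (⌊s / d⌋₊ + 1) * d := by
      have := Nat.lt_floor_add_one (s / d)
      rwa [div_lt_iff₀ hd] at this
    have hkN : ⌊s / d⌋₊ < N :=
      Nat.lt_succ_of_le (Nat.floor_mono (div_le_div_of_nonneg_right hs1.le hd.le))
    refine mem_iUnion₂.2 ⟨_, Finset.mem_range.2 hkN, ?_⟩
    rw [Metric.mem_ball]
    calc dist p (rotS j (⌊s / d⌋₊ * d) a)
        ≤ dist (rotS j s (rotS j t p)) (rotS j s a) +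
          dist (rotS j s a) (rotS j (⌊s / d⌋₊ * d) a) := by
          conv_lhs => rw [hp]
          exact dist_triangle _ _ _
      _ ≤ d + |s - ⌊s / d⌋₊ * d| := by
          rw [dist_rotS_right]
          exact add_le_add (hA _ ht _ ha) (dist_rotS_left _ _ _ _)
      _ < 3 * d := by
          rw [abs_of_nonneg (by linarith)]
          linarith
  calc vol3 (orbit j A)
      ≤ ∑ i ∈ Finset.range N, vol3 (Metric.ball (rotS j (i * d) a) (3 * d)) :=
        (measure_mono hsub).trans (measure_biUnion_finset_le _ _)
    _ ≤ ∑ i ∈ Finset.range N, ENNReal.ofReal (C * (3 * d) ^ 3) :=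
        Finset.sum_le_sum fun i _ => hball _ _ (by positivity)
    _ = ENNReal.ofReal (N * (C * (3 * d) ^ 3)) := by
        rw [Finset.sum_const, Finset.card_range, nsmul_eq_mul,
          ENNReal.ofReal_mul (p := (N : ℝ)) (by positivity), ENNReal.ofReal_natCast]
    _ ≤ ENNReal.ofReal (8 * (27 * C) * d ^ 2) := by
        refine ENNReal.ofReal_le_ofReal ?_
        have h1 : (N : ℝ) ≤ 2 * Real.pi / d + 1 := by
          rw [hN, Nat.cast_add, Nat.cast_one]
          exact add_le_add_left (Nat.floor_le (by positivity)) _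
        have h2 : N * d ≤ 8 := by
          have : N * d ≤ (2 * Real.pi / d + 1) * d := mul_le_mul_of_nonneg_right h1 hd.le
          have e : (2 * Real.pi / d + 1) * d = 2 * Real.pi + d := by field_simp
          linarith [Real.pi_lt_d2]
        calc N * (C * (3 * d) ^ 3) = N * d * (27 * C * d ^ 2) := by ring
          _ ≤ 8 * (27 * C * d ^ 2) := by gcongr
          _ = _ := by ring

lemma exists_vol3_orbit_le_ediam : ∃ C : ENNReal, C ≠ ⊤ ∧ ∀ (j : Fin 3) (A : Set S3),
    Metric.ediam A ≤ 1 → vol3 (orbit j A) ≤ C * Metric.ediam A ^ (2 : ℝ) := by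
  obtain ⟨C, hC, h⟩ := exists_vol3_orbit_le
  refine ⟨ENNReal.ofReal C, ENNReal.ofReal_ne_top, fun j A hA => ?_⟩
  have hA' : Metric.ediam A ≠ ⊤ := ne_top_of_le_ne_top ENNReal.one_ne_top hA
  have hdist (d : ℝ) (hd : Metric.diam A ≤ d) : ∀ x ∈ A, ∀ y ∈ A, dist x y ≤ d := fun x hx y hy =>
    (Metric.dist_le_diam_of_mem' hA' hx hy).trans hd
  rcases (Metric.diam_nonneg (s := A)).eq_or_lt with h0 | h0
  · have hz : vol3 (orbit j A) = 0 := by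
      have hlim : Tendsto (fun r : ℝ => ENNReal.ofReal (C * r ^ 2)) (𝓝[>] 0) (𝓝 0) := by
        have : Continuous fun r : ℝ => ENNReal.ofReal (C * r ^ 2) :=
          ENNReal.continuous_ofReal.comp (by fun_prop)
        simpa using (this.tendsto 0).mono_left (nhdsWithin_le_nhds (s := Ioi 0))
      refine le_antisymm (ge_of_tendsto hlim ?_) (zero_le)
      filter_upwards [Ioc_mem_nhdsGT (zero_lt_one' ℝ)] with r hr
      exact h j A r hr.1 hr.2 (hdist r (h0 ▸ hr.1.le))
    rw [hz]
    exact zero_le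
  · have hd1 : Metric.diam A ≤ 1 := ENNReal.toReal_le_of_le_ofReal zero_le_one (by simpa using hA)
    refine (h j A _ h0 hd1 (hdist _ le_rfl)).trans_eq ?_
    rw [ENNReal.ofReal_mul hC.le, ENNReal.ofReal_pow h0.le, Metric.diam, ENNReal.ofReal_toReal hA',
      ENNReal.rpow_two]

/-- The projection along the integral curves of `X_j` maps area to volume absolutely
continuously. -/
lemma vol3_orbit_eq_zero (j : Fin 3) {E : Set S3} (hE : area E = 0) : vol3 (orbit j E) = 0 := by
  have hE' : μH[2] E = 0 := by
    have h1 : area E = (Measure.addHaarScalarFactor (volume : Measure (EuclideanSpace ℝ (Fin 2)))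
        μH[(2 : ℕ)] : ENNReal) * μH[(2 : ℕ)] E := rfl
    rw [hE, eq_comm, mul_eq_zero] at h1
    rcases h1 with h1 | h1
    · exact absurd (ENNReal.coe_eq_zero.1 h1)
        (Measure.addHaarScalarFactor_volume_hausdorffMeasure_ne_zero 2)
    · simpa using h1
  obtain ⟨C, hC, hvol⟩ := exists_vol3_orbit_le_ediam
  rw [Measure.hausdorffMeasure_apply] at hE'
  have h1 := ENNReal.iSup_eq_zero.1 (ENNReal.iSup_eq_zero.1 hE' 1) one_pos
  have hkey : ∀ ε : ENNReal, 0 < ε → vol3 (orbit j E) ≤ C * ε := by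
    intro ε hε
    rw [← h1] at hε
    simp only [iInf_lt_iff] at hε
    obtain ⟨t, hEt, ht1, hlt⟩ := hε
    have hsub : orbit j E ⊆ ⋃ n, orbit j (t n) := by
      rintro p ⟨s, hs⟩
      obtain ⟨n, hn⟩ := mem_iUnion.1 (hEt hs)
      exact mem_iUnion.2 ⟨n, s, hn⟩
    calc vol3 (orbit j E) ≤ ∑' n, vol3 (orbit j (t n)) :=
          (measure_mono hsub).trans (measure_iUnion_le _)
      _ ≤ ∑' n, C * ⨆ _ : (t n).Nonempty, Metric.ediam (t n) ^ (2 : ℝ) := by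
          refine ENNReal.tsum_le_tsum fun n => ?_
          rcases (t n).eq_empty_or_nonempty with h0 | h0
          · simp [h0, orbit]
          · simp only [h0, iSup_pos]
            exact hvol j _ (ht1 n)
      _ = C * ∑' n, ⨆ _ : (t n).Nonempty, Metric.ediam (t n) ^ (2 : ℝ) := ENNReal.tsum_mul_left
      _ ≤ C * ε := by gcongr
  have hlim : Tendsto (fun ε : ENNReal => C * ε) (𝓝[>] 0) (𝓝 (C * 0)) :=
    (ENNReal.Tendsto.const_mul tendsto_id (Or.inr hC)).mono_left nhdsWithin_le_nhds
  rw [mul_zero] at hlim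
  exact le_antisymm (ge_of_tendsto hlim (eventually_mem_nhdsWithin.mono fun ε hε => hkey ε hε))
    (zero_le)

/-- A smooth map whose fibres on the sphere are the integral curves of `X_j`: a point goes to the
matrix of the orthogonal projection onto the plane of its integral curve. -/
def orbitMap (j : Fin 3) (p : E4) : Fin 4 → Fin 4 → ℝ :=
  fun a b => p a * p b + frame j p a * frame j p b

lemma contDiff_orbitMap (j : Fin 3) : ContDiff ℝ ∞ (orbitMap j) := by
  have h1 (a : Fin 4) : ContDiff ℝ ∞ fun p : E4 => p a := by fun_prop
  have h2 (a : Fin 4) : ContDiff ℝ ∞ fun p : E4 => frame j p a := (h1 a).comp (contDiff_frame j)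
  exact contDiff_pi.2 fun a => contDiff_pi.2 fun b => ((h1 a).mul (h1 b)).add ((h2 a).mul (h2 b))

lemma orbitMap_rot (j : Fin 3) (t : ℝ) (p : E4) : orbitMap j (rot j t p) = orbitMap j p := by
  funext a b
  simp only [orbitMap, frame_rot]
  simp only [rot, PiLp.add_apply, PiLp.sub_apply, PiLp.smul_apply, smul_eq_mul]
  linear_combination (p a * p b + frame j p a * frame j p b) * Real.cos_sq_add_sin_sq t

/-- The point `q` lies in the plane spanned by `p` and `X_j(p)`, hence on the integral curve of
`X_j` through `p`. -/
lemma exists_rotS_eq {j : Fin 3} {p q : S3} (h : orbitMap j p = orbitMap j q) :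
    ∃ t, rotS j t p = q := by
  have hq (a : Fin 4) : (q : E4) a = (p : E4) a * inner ℝ (p : E4) q +
      frame j p a * inner ℝ (frame j p) (q : E4) := by
    have h1 : ∑ b, orbitMap j p a b * (q : E4) b = ∑ b, orbitMap j q a b * (q : E4) b := by rw [h]
    have h2 (x : E4) : ∑ b, orbitMap j x a b * (q : E4) b =
        x a * inner ℝ x (q : E4) + frame j x a * inner ℝ (frame j x) (q : E4) := by
      simp only [orbitMap, add_mul, Finset.sum_add_distrib, PiLp.inner_apply, Finset.mul_sum,
        RCLike.inner_apply, conj_trivial]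
      congr 1 <;> exact Finset.sum_congr rfl fun b _ => by ring
    rw [h2, h2, real_inner_comm (q : E4) (frame j q), inner_frame_self, mul_zero, add_zero,
      real_inner_self_eq_norm_sq, norm_eq_of_mem_sphere, one_pow, mul_one] at h1
    exact h1.symm
  set x := inner ℝ (p : E4) (q : E4)
  set y := inner ℝ (frame j p) (q : E4)
  have hqv : (q : E4) = x • (p : E4) + y • frame j p := by
    ext a
    rw [hq a]
    simp only [PiLp.add_apply, PiLp.smul_apply, smul_eq_mul]
    ring
  have hxy : x ^ 2 + y ^ 2 = 1 := by
    have h1 : ‖(q : E4)‖ ^ 2 = 1 := by rw [norm_eq_of_mem_sphere, one_pow]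
    rw [hqv, norm_add_sq_real, inner_smul_left, inner_smul_right, inner_frame_self, norm_smul,
      norm_smul, norm_frame, norm_eq_of_mem_sphere] at h1
    simpa using h1
  have hz : ‖(⟨x, y⟩ : ℂ)‖ = 1 := by
    rw [Complex.norm_eq_sqrt_sq_add_sq, hxy, Real.sqrt_one]
  have hz0 : (⟨x, y⟩ : ℂ) ≠ 0 := norm_ne_zero_iff.1 (by rw [hz]; exact one_ne_zero)
  refine ⟨Complex.arg ⟨x, y⟩, Subtype.ext ?_⟩
  rw [coe_rotS, rot, Complex.cos_arg hz0, Complex.sin_arg, hz, div_one, div_one, ← hqv]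

/-- A closed set of area zero is removable for weak derivatives: there are cutoff functions around
it which are constant along `X_j`. -/
lemma WeakDeriv.of_area_eq_zero {V : Type*} [NormedAddCommGroup V] [NormedSpace ℝ V] {U E : Set S3}
    (hEc : IsClosed E) (hE : area E = 0) {j : Fin 3} {F G : S3 → V} (hF : Integrable F vol3)
    (hG : Integrable G vol3) (h : WeakDeriv (U \ E) j F G) : WeakDeriv U j F G := by
  intro f hf
  have hπc := contDiff_orbitMap j
  have hEi : IsClosed ((fun p : S3 => orbitMap j p) '' E) :=
    (hEc.isCompact.image (hπc.continuous.comp continuous_subtype_val)).isClosed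
  obtain ⟨θ, hθs, hθ, hθr⟩ := hEi.isOpen_compl.exists_contDiff_support_eq (n := ⊤)
  have hθ0 (x) : 0 ≤ θ x := (hθr (mem_range_self x)).1
  have hθE (p : S3) : θ (orbitMap j p) = 0 ↔ p ∈ orbit j E := by
    have h1 : θ (orbitMap j p) = 0 ↔ orbitMap j p ∈ (fun p : S3 => orbitMap j p) '' E := by
      rw [← Function.notMem_support, hθs, notMem_compl_iff]
    rw [h1]
    constructor
    · rintro ⟨q, hq, hqp⟩
      obtain ⟨t, ht⟩ := exists_rotS_eq (p := p) (q := q) hqp.symm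
      exact ⟨t, ht ▸ hq⟩
    · rintro ⟨t, ht⟩
      exact ⟨_, ht, orbitMap_rot j t p⟩
  -- `χ n = 0` near `E`, `χ n → 1` off the orbit of `E`, and `X_j (χ n) = 0`
  set χ : ℕ → E4 → ℝ := fun n p => Real.smoothTransition (n * θ (orbitMap j p) - 1) with hχ
  have hχd (n : ℕ) : ContDiff ℝ ∞ (χ n) := by
    refine Real.smoothTransition.contDiff.comp (ContDiff.sub (contDiff_const.mul ?_) contDiff_const)
    exact hθ.comp hπc
  have hχX (n : ℕ) (p : E4) : dX j (χ n) p = 0 := by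
    refine dX_eq_of_hasDerivAt (hχd n) ?_
    simp only [hχ, orbitMap_rot]
    exact hasDerivAt_const _ _
  have hχ1 (n : ℕ) (p : E4) : |χ n p| ≤ 1 := by
    rw [abs_of_nonneg (Real.smoothTransition.nonneg _)]
    exact Real.smoothTransition.le_one _
  have htest (n : ℕ) : IsTest (U \ E) (fun p => f p * χ n p) := by
    refine ⟨hf.1.mul (hχd n), fun p hp => ⟨(hf.mul_left (hχd n)).2 hp, fun hpE => ?_⟩⟩
    have hcl : IsClosed {p : S3 | 1 ≤ n * θ (orbitMap j p)} :=
      isClosed_le continuous_const (continuous_const.mul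
        (hθ.continuous.comp (hπc.continuous.comp continuous_subtype_val)))
    have hs : Function.support (fun p : S3 => f p * χ n p) ⊆ {p : S3 | 1 ≤ n * θ (orbitMap j p)} := by
      intro q hq
      by_contra hlt
      have hlt' : n * θ (orbitMap j q) < 1 := not_le.1 hlt
      refine hq ?_
      simp only [hχ]
      rw [Real.smoothTransition.zero_of_nonpos (by linarith), mul_zero]
    have h1 : (1 : ℝ) ≤ n * θ (orbitMap j p) := closure_minimal hs hcl hp
    rw [(hθE p).2 ⟨0, by rwa [rotS_zero]⟩, mul_zero] at h1
    linarith
  have hi : Integrable (fun p : S3 => f p • G p + dX j f p • F p) vol3 :=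
    (integrable_smoothSmul hf.1 hG).add (integrable_dXSmul hf.1 hF)
  have hlim : Tendsto (fun n => ∫ p : S3, χ n p • (f p • G p + dX j f p • F p) ∂vol3) atTop
      (𝓝 (∫ p : S3, (f p • G p + dX j f p • F p) ∂vol3)) := by
    refine tendsto_integral_of_dominated_convergence _
      (fun n => (integrable_smoothSmul (hχd n) hi).aestronglyMeasurable) hi.norm (fun n => ?_) ?_
    · refine Eventually.of_forall fun p => ?_
      rw [norm_smul]
      exact mul_le_of_le_one_left (norm_nonneg _) (hχ1 n p)
    · have hnull : ∀ᵐ p ∂vol3, p ∉ orbit j E := measure_eq_zero_iff_ae_notMem.1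
        (vol3_orbit_eq_zero j hE)
      filter_upwards [hnull] with p hp
      have hpos : 0 < θ (orbitMap j p) := lt_of_le_of_ne (hθ0 _) fun h0 => hp ((hθE p).1 h0.symm)
      have hat : Tendsto (fun n : ℕ => (n : ℝ) * θ (orbitMap j p)) atTop atTop :=
        tendsto_natCast_atTop_atTop.atTop_mul_const hpos
      refine tendsto_const_nhds.congr' ?_
      filter_upwards [hat.eventually_ge_atTop 2] with n hn
      simp only [hχ]
      rw [Real.smoothTransition.one_of_one_le (by linarith), one_smul]
  refine tendsto_nhds_unique hlim (tendsto_const_nhds.congr fun n => ?_)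
  rw [← h _ (htest n)]
  refine integral_congr_ae (Eventually.of_forall fun p => ?_)
  have h1 := dX_smul (j := j) (p := p) (hf.1.differentiable (by simp)).differentiableAt
    ((hχd n).differentiable (by simp)).differentiableAt
  simp only [smul_eq_mul, hχX, mul_zero, zero_add] at h1
  simp only [h1, smul_add, mul_smul]
  rw [smul_comm (f p), smul_comm (dX j f p)]

/-! ### Gauging away the phase jumps -/

variable {K : ℕ} {S : Fin K → OrientedSurface} {α : Fin K → ℝ}

/-- The phase factor which is `e^{2πia}` on the positive side and `1` on the negative side. -/
def phase (a x : ℝ) : ℂ := if 0 < x then Complex.exp (2 * Complex.I * Real.pi * a) else 1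

/-- The gauge transformation which removes the phase jumps across the surfaces with local equations
`h k = 0`. -/
def gauge (α : Fin K → ℝ) (h : Fin K → E4 → ℝ) (p : S3) : ℂ := ∏ k, phase (α k) (h k p)

lemma norm_phase (a x : ℝ) : ‖phase a x‖ = 1 := by
  rw [phase]
  split_ifs
  · rw [Complex.norm_exp]
    simp
  · simp

lemma norm_gauge (α : Fin K → ℝ) (h : Fin K → E4 → ℝ) (p : S3) : ‖gauge α h p‖ = 1 := by
  simp [gauge, norm_phase]

lemma measurable_gauge (α : Fin K → ℝ) {h : Fin K → E4 → ℝ} (hh : ∀ k, Continuous (h k)) :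
    Measurable (gauge α h) := by
  refine Finset.measurable_prod _ fun k _ => ?_
  have hk : Continuous fun p : S3 => h k p := (hh k).comp continuous_subtype_val
  exact Measurable.ite (measurableSet_lt measurable_const hk.measurable)
    measurable_const measurable_const

lemma phase_eq_of_mul_pos {a x y : ℝ} (h : 0 < x * y) : phase a y = phase a x := by
  have : 0 < y ↔ 0 < x := ⟨fun hy => pos_of_mul_pos_left h hy.le, fun hx => pos_of_mul_pos_right h hx.le⟩
  simp only [phase, this]

lemma IsLocalEquation.mono {S : Set S3} {N : S3 → E4} {U U' : Set S3} {h : E4 → ℝ} (hU : U' ⊆ U)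
    (H : IsLocalEquation S N U h) : IsLocalEquation S N U' h :=
  ⟨H.smooth, fun p hp => H.mem_iff p (hU hp), fun p hp => H.gradient p (hU hp)⟩

lemma isLocalEquation_const {S : Set S3} {N : S3 → E4} {U : Set S3} (hU : Disjoint U S) {c : ℝ}
    (hc : c ≠ 0) : IsLocalEquation S N U fun _ => c :=
  ⟨contDiff_const, fun _ hp => ⟨fun hpS => absurd hpS (disjoint_left.1 hU hp), fun h => absurd h hc⟩,
    fun _ hp hpS => absurd hpS (disjoint_left.1 hU hp)⟩

lemma exists_localEquation {q : S3} (hq : q ∉ link S) (k : Fin K) :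
    ∃ U h, IsOpen U ∧ q ∈ U ∧ IsLocalEquation (S k).carrier (S k).normal U h := by
  by_cases hqS : q ∈ (S k).carrier
  · rcases (S k).local_form q hqS with h | h
    · obtain ⟨-, U, h, hU, hqU, H⟩ := h
      exact ⟨U, h, hU, hqU, H⟩
    · exact absurd (mem_iUnion.2 ⟨k, h⟩) hq
  · exact ⟨(S k).carrierᶜ, fun _ => 1, (S k).isCompact.isClosed.isOpen_compl, hqS,
      isLocalEquation_const disjoint_compl_left one_ne_zero⟩

lemma integrable_unimodular_smul {u : S3 → ℂ} (hum : Measurable u) (hu : ∀ p, ‖u p‖ = 1)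
    {F : S3 → Spinor} (hF : Integrable F vol3) : Integrable (fun p => u p • F p) vol3 :=
  hF.bdd_smul 1 hum.aestronglyMeasurable (Eventually.of_forall fun p => (hu p).le)

/-- Near a point of exactly one surface, the gauge transform of a spinor in the domain has weak
derivatives across the surface. -/
lemma weakDeriv_gauge_single {V : Set S3} (hV : IsOpen V) {k : Fin K}
    (hVR : Disjoint V (removedSet S k)) {h : E4 → ℝ}
    (H : IsLocalEquation (S k).carrier (S k).normal V h) {ψ : L2} {g : Fin 3 → L2}
    (hJ : PhaseJump S α k ψ g) {u : S3 → ℂ} {c : ℂ} (hu : ∀ p ∈ V, u p = phase (α k) (h p) * c)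
    (j : Fin 3) : WeakDeriv V j (fun p => u p • ψ p) (fun p => u p • g j p) := by
  intro f hf
  obtain ⟨τp, τm, hp, hm, -, -, hτ⟩ := hJ
  obtain ⟨-, e1⟩ := hp V h hV hVR H f hf j
  obtain ⟨-, e2⟩ := hm V h hV hVR H f hf j
  set e : ℂ := Complex.exp (2 * Complex.I * Real.pi * α k) with he
  set I : S3 → Spinor := fun p => f p • g j p + dX j f p • ψ p with hI
  have hIi : Integrable I vol3 := (integrable_smoothSmul hf.1 (L2_integrable (g j))).add
    (integrable_dXSmul hf.1 (L2_integrable ψ))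
  have hhc : Continuous fun p : S3 => h p := H.smooth.continuous.comp continuous_subtype_val
  set A : Set S3 := {p | p ∈ V ∧ 0 < 1 * h p} with hA
  set B : Set S3 := {p | p ∈ V ∧ 0 < -1 * h p} with hB
  have hAm : MeasurableSet A := hV.measurableSet.inter
    (measurableSet_lt measurable_const (hhc.measurable.const_mul 1))
  have hBm : MeasurableSet B := hV.measurableSet.inter
    (measurableSet_lt measurable_const (hhc.measurable.const_mul (-1)))
  -- the two sides contribute the traces with opposite signs, and the gauge compensates the jump
  have hsplit : (fun p : S3 => f p • u p • g j p + dX j f p • u p • ψ p) =ᵐ[vol3]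
      fun p => (e * c) • A.indicator I p + c • B.indicator I p := by
    have hnull : ∀ᵐ p ∂vol3, ¬ (p ∈ V ∧ h p = 0) :=
      measure_eq_zero_iff_ae_notMem.1 H.vol3_zeros
    filter_upwards [hnull] with p hp0
    by_cases hpV : p ∈ V
    · have e3 : f p • u p • g j p + dX j f p • u p • ψ p = u p • I p := by
        simp only [hI, smul_add]
        rw [smul_comm (f p), smul_comm (dX j f p)]
      rw [e3, hu p hpV, phase]
      rcases lt_trichotomy (h p) 0 with h1 | h1 | h1
      · have pA : p ∉ A := fun hh => absurd hh.2 (by linarith)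
        have pB : p ∈ B := ⟨hpV, by linarith⟩
        rw [if_neg (by linarith), indicator_of_notMem pA, indicator_of_mem pB]
        simp
      · exact absurd ⟨hpV, h1⟩ hp0
      · have pA : p ∈ A := ⟨hpV, by linarith⟩
        have pB : p ∉ B := fun hh => absurd hh.2 (by linarith)
        rw [if_pos h1, indicator_of_mem pA, indicator_of_notMem pB]
        simp [he]
    · have pA : p ∉ A := fun hh => hpV hh.1
      have pB : p ∉ B := fun hh => hpV hh.1
      rw [indicator_of_notMem pA, indicator_of_notMem pB, hf.eq_zero hpV, hf.dX_eq_zero j hpV]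
      simp
  have hT : ∫ p in (S k).carrier ∩ V, (f p * inner ℝ ((S k).normal p) (frame j p)) • τp p ∂area =
      Complex.exp (-(2 * Complex.I * Real.pi * α k)) •
        ∫ p in (S k).carrier ∩ V, (f p * inner ℝ ((S k).normal p) (frame j p)) • τm p ∂area := by
    rw [← integral_smul]
    refine integral_congr_ae ?_
    have hsub : (S k).carrier ∩ V ⊆ (S k).carrier \ removedSet S k :=
      fun p hp => ⟨hp.1, disjoint_left.1 hVR hp.2⟩
    filter_upwards [ae_restrict_of_ae_restrict_of_subset hsub hτ] with p hp
    rw [hp, smul_comm]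
  rw [integral_congr_ae hsplit, integral_add (f := fun p => (e * c) • A.indicator I p)
    (g := fun p => c • B.indicator I p) ((hIi.indicator hAm).smul (e * c))
    ((hIi.indicator hBm).smul c), integral_smul, integral_smul, integral_indicator hAm,
    integral_indicator hBm]
  have e1' : ∫ p in A, I p ∂vol3 = _ := e1
  have e2' : ∫ p in B, I p ∂vol3 = _ := e2
  rw [e1', e2', hT]
  have hee : e * Complex.exp (-(2 * Complex.I * Real.pi * α k)) = 1 := by
    rw [he, ← Complex.exp_add, add_neg_cancel, Complex.exp_zero]
  set T := ∫ p in (S k).carrier ∩ V, (f p * inner ℝ ((S k).normal p) (frame j p)) • τm p ∂area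
  simp only [neg_smul, one_smul, neg_neg, smul_neg, smul_smul]
  rw [mul_right_comm, hee, one_mul, neg_add_cancel]

/-- The gauge transform of a spinor in the domain of `𝒟_𝑨^{(min)}` is weakly differentiable off the
link. -/
theorem weakDeriv_gauge (hS : IsSeifertFamily S) {U : Set S3} (hU : IsOpen U)
    (hUΓ : Disjoint U (link S)) {h : Fin K → E4 → ℝ}
    (hh : ∀ k, IsLocalEquation (S k).carrier (S k).normal U (h k)) {ψ : L2} {g : Fin 3 → L2}
    (hg : ∀ j, HasWeakDeriv (complSurfaces S) j ψ (g j)) (hJ : ∀ k, PhaseJump S α k ψ g)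
    (j : Fin 3) :
    WeakDeriv U j (fun p => gauge α h p • ψ p) (fun p => gauge α h p • g j p) := by
  have hum := measurable_gauge α fun k => (hh k).smooth.continuous
  have hi (ψ : L2) := integrable_unimodular_smul hum (norm_gauge α h) (L2_integrable ψ)
  set E : Set S3 := ⋃ k, ⋃ l, ⋃ _ : k ≠ l, (S k).carrier ∩ (S l).carrier with hE
  have hEc : IsClosed E := isClosed_iUnion_of_finite fun k => isClosed_iUnion_of_finite fun l =>
    isClosed_iUnion_of_finite fun _ => (S k).isCompact.isClosed.inter (S l).isCompact.isClosed
  have hE0 : area E = 0 := measure_iUnion_null fun k => measure_iUnion_null fun l =>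
    measure_iUnion_null fun hkl => hS.area_inter k l hkl
  refine WeakDeriv.of_area_eq_zero hEc hE0 (hi _) (hi _)
    (weakDeriv_of_local (hi _) (hi _) fun q hq => ?_)
  -- the gauge factors of the surfaces which do not contain `q` are locally constant
  have hsign (T : Finset (Fin K)) (hT : ∀ l ∈ T, q ∉ (S l).carrier) :
      ∃ V, IsOpen V ∧ q ∈ V ∧ V ⊆ U ∧ ∀ p ∈ V, ∀ l ∈ T, 0 < h l q * h l p := by
    refine ⟨U ∩ ⋂ l ∈ T, {p : S3 | 0 < h l q * h l p}, hU.inter (isOpen_biInter_finset fun l _ =>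
      isOpen_lt continuous_const (continuous_const.mul
        ((hh l).smooth.continuous.comp continuous_subtype_val))), ⟨hq.1, ?_⟩, inter_subset_left,
      fun p hp l hl => mem_iInter₂.1 hp.2 l hl⟩
    refine mem_iInter₂.2 fun l hl => ?_
    have h1 : 0 < h l q * h l q := mul_self_pos.2 fun h0 => hT l hl ?_
    · exact h1
    exact ((hh l).mem_iff q hq.1).2 h0
  by_cases hex : ∃ k, q ∈ (S k).carrier
  · obtain ⟨k, hqk⟩ := hex
    obtain ⟨V, hV, hqV, hVU, hpos⟩ := hsign (Finset.univ.erase k) fun l hl hql => hq.2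
      (mem_iUnion.2 ⟨k, mem_iUnion.2 ⟨l, mem_iUnion.2 ⟨(Finset.ne_of_mem_erase hl).symm, hqk, hql⟩⟩⟩)
    refine ⟨V, hV, hqV, weakDeriv_gauge_single hV (k := k) ?_ ((hh k).mono hVU) (hJ k)
      (c := ∏ l ∈ Finset.univ.erase k, phase (α l) (h l q)) (fun p hp => ?_) j⟩
    · refine disjoint_left.2 fun p hp hpR => ?_
      rcases hpR with hpR | hpR
      · obtain ⟨l, hl, hpl⟩ := mem_iUnion₂.1 hpR
        have h1 := hpos p hp l (Finset.mem_erase.2 ⟨hl, Finset.mem_univ _⟩)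
        rw [((hh l).mem_iff p (hVU hp)).1 hpl, mul_zero] at h1
        exact lt_irrefl _ h1
      · exact disjoint_left.1 hUΓ (hVU hp) (mem_iUnion.2 ⟨k, hpR⟩)
    · rw [gauge, ← Finset.mul_prod_erase _ _ (Finset.mem_univ k)]
      congr 1
      exact Finset.prod_congr rfl fun l hl => phase_eq_of_mul_pos (hpos p hp l hl)
  · push Not at hex
    obtain ⟨V, hV, hqV, hVU, hpos⟩ := hsign Finset.univ fun l _ => hex l
    refine ⟨V, hV, hqV, fun f hf => ?_⟩
    have hVΩ : V ⊆ complSurfaces S := by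
      intro p hp hpS
      obtain ⟨l, hl⟩ := mem_iUnion.1 hpS
      have h1 := hpos p hp l (Finset.mem_univ _)
      rw [((hh l).mem_iff p (hVU hp)).1 hl, mul_zero] at h1
      exact lt_irrefl _ h1
    have h1 := (hg j).weakDeriv f (hf.mono hVΩ)
    have h2 : ∫ p : S3, gauge α h q • (f p • g j p + dX j f p • ψ p) ∂vol3 = 0 := by
      rw [integral_smul, h1, smul_zero]
    rw [← h2]
    refine integral_congr_ae (Eventually.of_forall fun p => ?_)
    by_cases hpV : p ∈ V
    · have : gauge α h p = gauge α h q :=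
        Finset.prod_congr rfl fun l hl => phase_eq_of_mul_pos (hpos p hpV l hl)
      simp only [this, smul_add]
      rw [smul_comm (f p), smul_comm (dX j f p)]
    · simp only [hf.eq_zero hpV, hf.dX_eq_zero j hpV]
      simp

/-- Spinors in the domain of `𝒟_𝑨^{(min)}` are, off the link, locally gauge equivalent to `H¹`
spinors. -/
lemma exists_gauge (hS : IsSeifertFamily S) {U : Set S3} (hU : IsOpen U)
    (hUΓ : Disjoint U (link S)) {h : Fin K → E4 → ℝ}
    (hh : ∀ k, IsLocalEquation (S k).carrier (S k).normal U (h k)) {q : S3} (hq : q ∈ U) :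
    ∃ U', IsOpen U' ∧ q ∈ U' ∧ ∀ (ψ : L2) (g : Fin 3 → L2),
      (∀ j, HasWeakDeriv (complSurfaces S) j ψ (g j)) → (∀ k, PhaseJump S α k ψ g) →
      GaugeH1 U' (gauge α h) ψ fun j => g j := by
  obtain ⟨U', hU', hqU', H⟩ := exists_gaugeH1 hU (measurable_gauge α fun k =>
    (hh k).smooth.continuous) (norm_gauge α h) hq
  exact ⟨U', hU', hqU', fun ψ g hg hJ => H ψ g fun j => weakDeriv_gauge hS hU hUΓ hh hg hJ j⟩

lemma exists_localEquations {q : S3} (hS : IsSeifertFamily S) (hq : q ∉ link S) :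
    ∃ (U : Set S3) (h : Fin K → E4 → ℝ), IsOpen U ∧ q ∈ U ∧ Disjoint U (link S) ∧
      ∀ k : Fin K, IsLocalEquation (S k).carrier (S k).normal U (h k) := by
  choose U h hU hqU H using fun k => exists_localEquation hq k
  refine ⟨(⋂ k, U k) ∩ (link S)ᶜ, h, (isOpen_iInter_of_finite hU).inter
    hS.isClosed_link.isOpen_compl, ⟨mem_iInter.2 hqU, hq⟩, disjoint_left.2 fun p hp => hp.2,
    fun k => (H k).mono fun p hp => mem_iInter.1 hp.1 k⟩

/-! ### Kernels of adjoint operators -/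

section
variable {T : L2 →ₗ.[ℂ] L2}

lemma mem_kerOp {R : L2 →ₗ.[ℂ] L2} {x : L2} : x ∈ kerOp R ↔ ∃ h : x ∈ R.domain, R ⟨x, h⟩ = 0 := by
  constructor
  · rintro ⟨y, hy, rfl⟩
    exact ⟨y.2, hy⟩
  · rintro ⟨h, h0⟩
    exact ⟨⟨x, h⟩, h0, rfl⟩

theorem kerOp_compOp_adjoint (hT : Dense (T.domain : Set L2)) :
    kerOp (compOp T T.adjoint) = kerOp T.adjoint := by
  ext x
  rw [mem_kerOp, mem_kerOp]
  constructor
  · rintro ⟨⟨y, hy, rfl⟩, h0⟩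
    refine ⟨y.2, ?_⟩
    have h1 : T ⟨T.adjoint y, hy⟩ = 0 := h0
    have h2 := (T.adjoint_isFormalAdjoint hT).symm ⟨T.adjoint y, hy⟩ y
    rw [h1, inner_zero_left] at h2
    exact inner_self_eq_zero.1 h2.symm
  · rintro ⟨h, h0⟩
    have hy : T.adjoint ⟨x, h⟩ ∈ T.domain := by rw [h0]; exact T.domain.zero_mem
    refine ⟨⟨⟨x, h⟩, hy, rfl⟩, ?_⟩
    have h1 : (⟨T.adjoint ⟨x, h⟩, hy⟩ : T.domain) = 0 := Subtype.ext h0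
    have h2 : T ⟨T.adjoint ⟨x, h⟩, hy⟩ = 0 := by rw [h1, LinearPMap.map_zero]
    exact h2

lemma adjoint_of_inner_eq (hT : Dense (T.domain : Set L2)) {v w : L2}
    (h : ∀ x : T.domain, inner ℂ w (x : L2) = inner ℂ v (T x)) :
    ∃ hv : v ∈ T.adjoint.domain, T.adjoint ⟨v, hv⟩ = w :=
  ⟨T.mem_adjoint_domain_of_exists v ⟨w, h⟩, T.adjoint_apply_eq hT _ h⟩

/-- For a symmetric operator `T` which is bounded below, a vector `v` with `T*v ⊥ ker T*` differs
from an element of the domain of the closure of `T` by an element of `ker T*`. -/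
lemma mem_sup_of_orthogonal (hT : Dense (T.domain : Set L2)) (hsymm : T.IsFormalAdjoint T) {C : ℝ}
    (hbd : ∀ x : T.domain, ‖(x : L2)‖ ≤ C * ‖T x‖) {W : Submodule ℂ L2}
    (hW : ∀ (x : ℕ → T.domain) (a b : L2), Tendsto (fun n => (x n : L2)) atTop (𝓝 a) →
      Tendsto (fun n => T (x n)) atTop (𝓝 b) → a ∈ W)
    (v : T.adjoint.domain) (hv : T.adjoint v ∈ (kerOp T.adjoint)ᗮ) :
    (v : L2) ∈ kerOp T.adjoint ⊔ W := by
  set Rn : Submodule ℂ L2 := LinearMap.range T.toFun with hRn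
  have hker : Rnᗮ ≤ kerOp T.adjoint := by
    intro y hy
    rw [mem_kerOp]
    refine adjoint_of_inner_eq hT fun x => ?_
    rw [inner_zero_left]
    exact ((Submodule.mem_orthogonal' _ _).1 hy _ ⟨x, rfl⟩).symm
  have hcl : T.adjoint v ∈ Rn.topologicalClosure := by
    rw [← Submodule.orthogonal_orthogonal_eq_closure]
    exact Submodule.orthogonal_le hker hv
  obtain ⟨y, hy, hylim⟩ := mem_closure_iff_seq_limit.1 hcl
  choose x hx using hy
  have hxT (n : ℕ) : T (x n) = y n := hx n
  have hcauchy : CauchySeq fun n => (x n : L2) := by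
    rw [Metric.cauchySeq_iff]
    intro ε hε
    have hC : 0 < |C| + 1 := by positivity
    obtain ⟨N, hN⟩ := Metric.cauchySeq_iff.1 hylim.cauchySeq (ε / (|C| + 1)) (div_pos hε hC)
    refine ⟨N, fun m hm n hn => ?_⟩
    have h1 := hbd (x m - x n)
    rw [T.map_sub, hxT, hxT, ← dist_eq_norm] at h1
    have h2 := (lt_div_iff₀ hC).1 (hN m hm n hn)
    rw [dist_eq_norm]
    calc ‖((x m : L2) - x n)‖ ≤ C * dist (y m) (y n) := h1
      _ ≤ |C| * dist (y m) (y n) := mul_le_mul_of_nonneg_right (le_abs_self C) dist_nonneg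
      _ ≤ dist (y m) (y n) * (|C| + 1) := by nlinarith [dist_nonneg (x := y m) (y := y n)]
      _ < ε := h2
  obtain ⟨a, ha⟩ := cauchySeq_tendsto_of_complete hcauchy
  have hTx : Tendsto (fun n => T (x n)) atTop (𝓝 (T.adjoint v)) := by simpa only [hxT] using hylim
  have haW : a ∈ W := hW x a _ ha hTx
  obtain ⟨had, hae⟩ := adjoint_of_inner_eq hT (v := a) (w := T.adjoint v) fun z => by
    refine tendsto_nhds_unique (hTx.inner tendsto_const_nhds) ?_
    refine (ha.inner tendsto_const_nhds).congr fun n => ?_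
    exact (hsymm _ _).symm
  have hdiff : (v : L2) - a ∈ kerOp T.adjoint := by
    rw [mem_kerOp]
    refine ⟨T.adjoint.domain.sub_mem v.2 had, ?_⟩
    have : (⟨(v : L2) - a, T.adjoint.domain.sub_mem v.2 had⟩ : T.adjoint.domain) = v - ⟨a, had⟩ := rfl
    rw [this, T.adjoint.map_sub, hae, sub_self]
  have := Submodule.add_mem_sup hdiff haW
  rwa [sub_add_cancel] at this

/-- If the domain of the adjoint contains arbitrarily many vectors which are linearly independent
modulo a space `W` which contains the domain of the closure of `T`, then `ker T*` is infinite dimensional. -/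
theorem not_finiteDimensional_kerOp_adjoint (hT : Dense (T.domain : Set L2))
    (hsymm : T.IsFormalAdjoint T) {C : ℝ} (hbd : ∀ x : T.domain, ‖(x : L2)‖ ≤ C * ‖T x‖)
    {W : Submodule ℂ L2} (hW : ∀ (x : ℕ → T.domain) (a b : L2),
      Tendsto (fun n => (x n : L2)) atTop (𝓝 a) → Tendsto (fun n => T (x n)) atTop (𝓝 b) → a ∈ W)
    (hind : ∀ m : ℕ, ∃ v : Fin m → T.adjoint.domain, ∀ c : Fin m → ℂ,
      ∑ i, c i • (v i : L2) ∈ W → c = 0) :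
    ¬ FiniteDimensional ℂ (kerOp T.adjoint) := by
  intro hfin
  set N := Module.finrank ℂ (kerOp T.adjoint) with hN
  -- of the `2N + 1` vectors, an `(N + 1)`-dimensional space has `T*v ⊥ ker T*`; modulo `W` it is
  -- contained in the `N`-dimensional space `ker T*`
  obtain ⟨v, hv⟩ := hind (2 * N + 1)
  let Λ : (Fin (2 * N + 1) → ℂ) →ₗ[ℂ] kerOp T.adjoint :=
    Fintype.linearCombination ℂ fun i => (kerOp T.adjoint).orthogonalProjectionOnto (T.adjoint (v i))
  have hdim : N + 1 ≤ Module.finrank ℂ (LinearMap.ker Λ) := by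
    have h1 := LinearMap.finrank_range_add_finrank_ker Λ
    have h2 : Module.finrank ℂ (LinearMap.range Λ) ≤ N := Submodule.finrank_le _
    rw [Module.finrank_fin_fun] at h1
    omega
  let Φ : LinearMap.ker Λ →ₗ[ℂ] L2 ⧸ W :=
    W.mkQ ∘ₗ (Fintype.linearCombination ℂ fun i => (v i : L2)) ∘ₗ (LinearMap.ker Λ).subtype
  have hΦ : Function.Injective Φ := by
    rw [← LinearMap.ker_eq_bot, LinearMap.ker_eq_bot']
    intro c hc
    have h1 : Fintype.linearCombination ℂ (fun i => (v i : L2)) c ∈ W :=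
      (Submodule.Quotient.mk_eq_zero W).1 hc
    rw [Fintype.linearCombination_apply] at h1
    exact Subtype.ext (hv c h1)
  have hrange : LinearMap.range Φ ≤ (kerOp T.adjoint).map W.mkQ := by
    rintro _ ⟨c, rfl⟩
    set vc : T.adjoint.domain := ∑ i, (c : Fin (2 * N + 1) → ℂ) i • v i with hvc
    have hcoe : (vc : L2) = ∑ i, (c : Fin (2 * N + 1) → ℂ) i • (v i : L2) := by
      simp [hvc]
    have hTvc : T.adjoint vc = ∑ i, (c : Fin (2 * N + 1) → ℂ) i • T.adjoint (v i) := by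
      change T.adjoint.toFun vc = _
      rw [hvc, map_sum]
      exact Finset.sum_congr rfl fun i _ => map_smul _ _ _
    have horth : T.adjoint vc ∈ (kerOp T.adjoint)ᗮ := by
      rw [← Submodule.orthogonalProjectionOnto_eq_zero_iff, hTvc, map_sum]
      have h2 : Λ c = 0 := c.2
      rw [Fintype.linearCombination_apply] at h2
      simpa only [map_smul] using h2
    have h3 := mem_sup_of_orthogonal hT hsymm hbd hW vc horth
    obtain ⟨k, hk, w, hw, hkw⟩ := Submodule.mem_sup.1 h3
    refine ⟨k, hk, ?_⟩
    have h4 : Φ c = W.mkQ (vc : L2) := by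
      rw [hcoe, ← Fintype.linearCombination_apply]
      rfl
    rw [h4, ← hkw, map_add, (Submodule.Quotient.mk_eq_zero W).2 hw |> (show W.mkQ w = 0 from ·),
      add_zero]
  have h5 : Module.finrank ℂ (LinearMap.ker Λ) ≤ N := by
    rw [← LinearMap.finrank_range_of_inj hΦ]
    exact (Submodule.finrank_mono hrange).trans (Submodule.finrank_map_le _ _)
  omega

end

/-! ### The minimal operator is densely defined, symmetric and bounded below -/

variable {K : ℕ} {S : Fin K → OrientedSurface} {α : Fin K → ℝ}

/-- `ψ` is in the domain of `𝒟_𝑨^{(min)}`, with frame derivatives `g j`. -/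
def IsMinPair (S : Fin K → OrientedSurface) (α : Fin K → ℝ) (ψ : L2) (g : Fin 3 → L2) : Prop :=
  (∀ j, HasWeakDeriv (complSurfaces S) j ψ (g j)) ∧ ∀ k, PhaseJump S α k ψ g

lemma IsMinPair.exists_apply {ψ : L2} {g : Fin 3 → L2} (h : IsMinPair S α ψ g) :
    ∃ hψ : ψ ∈ (diracMin S α).domain, diracMin S α ⟨ψ, hψ⟩ = diracExpr ψ g := by
  have h1 : (ψ, diracExpr ψ g) ∈ (diracMin S α).graph := by
    rw [diracMin_graph]
    exact ⟨g, h.1, h.2, rfl⟩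
  obtain ⟨y, hy, hTy⟩ := LinearPMap.mem_graph_iff _ |>.1 h1
  have hyψ : (y : L2) = ψ := hy
  subst hyψ
  exact ⟨y.2, hTy⟩

lemma exists_isMinPair (x : (diracMin S α).domain) :
    ∃ g, IsMinPair S α x g ∧ diracMin S α x = diracExpr x g := by
  have h1 : ((x : L2), diracMin S α x) ∈ (diracMin S α).graph := LinearPMap.mem_graph _ x
  rw [diracMin_graph] at h1
  obtain ⟨g, h2, h3, h4⟩ := h1
  exact ⟨g, ⟨h2, h3⟩, h4⟩

lemma clifford_clifford (j : Fin 3) (ψ : L2) : clifford j (clifford j ψ) = ψ := by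
  refine Lp.ext ?_
  filter_upwards [clifford_ae j (clifford j ψ), clifford_ae j ψ] with p h1 h2
  rw [h1, h2, pauliOp_pauliOp]

lemma diracExpr_eq (ψ : L2) (g : Fin 3 → L2) :
    diracExpr ψ g = (-Complex.I) • slashL g + (3 / 2 : ℂ) • ψ := by
  have h (j : Fin 3) : (-Complex.I) • clifford j (spinCov j ψ (g j)) =
      (-Complex.I) • clifford j (g j) + (1 / 2 : ℂ) • ψ := by
    rw [spinCov, map_add, map_smul, clifford_clifford, smul_add, smul_smul]
    congr 2
    linear_combination (-1 / 2 : ℂ) * Complex.I_mul_I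
  rw [diracExpr, Finset.sum_congr rfl fun j _ => h j, Finset.sum_add_distrib, ← Finset.smul_sum,
    slashL, Fin.sum_const]
  congr 1
  rw [← Nat.cast_smul_eq_nsmul ℂ, smul_smul]
  norm_num

lemma HasWeakDeriv.unique {Ω : Set S3} (hΩ : IsOpen Ω) {j : Fin 3} {ψ g g' : L2}
    (h : HasWeakDeriv Ω j ψ g) (h' : HasWeakDeriv Ω j ψ g') : g = g' := by
  have h1 := h.add (h'.smul (-1))
  rw [neg_one_smul, neg_one_smul, add_neg_cancel, ← sub_eq_add_neg] at h1
  exact sub_eq_zero.1 (h1.eq_zero hΩ)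

lemma dX_smul_const {j : Fin 3} {f : E4 → ℝ} (hf : ContDiff ℝ ∞ f) (ξ : Spinor) (p : E4) :
    dX j (fun q => f q • ξ) p = dX j f p • ξ := by
  rw [dX_smul (hf.differentiable (by simp)).differentiableAt (differentiableAt_const ξ)]
  simp [dX]

/-- Test functions with support off the surfaces have zero traces: multiplied with the indicator of
one side of `S_k`, which on the support agrees with a smooth cutoff `χ`, they stay smooth. -/
lemma hasTrace_zero_of_isTest {f : E4 → ℝ} (hf : IsTest (complSurfaces S) f) (ξ : Spinor)
    (k : Fin K) (R : Set S3) {s : ℝ} (hs : s ≠ 0)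
    (hc : Continuous fun p => f p • ξ) (hc' : ∀ j, Continuous fun p => dX j f p • ξ) :
    HasTrace (S k) R s (toL2 _ hc) (fun j => toL2 _ (hc' j)) (fun _ => 0) := by
  intro U h hU _ H φ hφ j
  refine ⟨by simp, ?_⟩
  simp only [smul_zero, integral_zero]
  have hΦ : ContDiff ℝ ∞ fun p => φ p * f p := hφ.1.mul hf.1
  have hhc : Continuous fun p : S3 => s * h p :=
    continuous_const.mul (H.smooth.continuous.comp continuous_subtype_val)
  set T := tsupport fun p : S3 => φ p * f p with hT
  have hTU : T ⊆ U := (hφ.mul_left hf.1).2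
  have hTh : ∀ p ∈ T, s * h p ≠ 0 := fun p hp => mul_ne_zero hs fun h0 =>
    (hf.mul_right hφ.1).2 hp (mem_iUnion.2 ⟨k, (H.mem_iff p (hTU hp)).2 h0⟩)
  have hTc : IsClosed T := isClosed_tsupport _
  obtain ⟨χ, hχ, -, hχ1, hχ0⟩ := exists_smooth_cutoff
    (hTc.inter (isClosed_le continuous_const hhc) : IsClosed (T ∩ {p | 0 ≤ s * h p}))
    (hTc.inter (isClosed_le hhc continuous_const) : IsClosed (T ∩ {p | s * h p ≤ 0}))
    (disjoint_left.2 fun p hp hp' => hTh p hp.1 (le_antisymm hp'.2 hp.2))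
  have hF : ContDiff ℝ ∞ fun p => (φ p * f p * χ p) • ξ := (hΦ.mul hχ).smul contDiff_const
  have hmeas : MeasurableSet {p : S3 | p ∈ U ∧ 0 < s * h p} :=
    hU.measurableSet.inter (measurableSet_lt measurable_const hhc.measurable)
  rw [← integral_dX j hF, ← integral_indicator hmeas]
  refine integral_congr_ae ?_
  filter_upwards [coeFn_toL2 hc, coeFn_toL2 (hc' j)] with p e1 e2
  rw [dX_smul_const (hΦ.mul hχ)]
  have dφ : DifferentiableAt ℝ φ p := (hφ.1.differentiable (by simp)).differentiableAt
  have df : DifferentiableAt ℝ f p := (hf.1.differentiable (by simp)).differentiableAt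
  have dΦ : DifferentiableAt ℝ (fun p => φ p * f p) p := (hΦ.differentiable (by simp)).differentiableAt
  have dΦχ : DifferentiableAt ℝ (fun p => φ p * f p * χ p) p :=
    ((hΦ.mul hχ).differentiable (by simp)).differentiableAt
  have e3 : φ p • toL2 _ (hc' j) p + frameDeriv j φ p • toL2 _ hc p =
      dX j (fun q => φ q * f q) p • ξ := by
    have := dX_smul (j := j) dφ df
    simp only [smul_eq_mul] at this
    rw [e1, e2, this, frameDeriv_eq_dX, add_smul, mul_smul, mul_smul]
  by_cases hpT : p ∈ T
  · rcases lt_or_gt_of_ne (hTh p hpT) with hlt | hgt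
    · rw [indicator_of_notMem fun hp => (hp.2.trans hlt).false]
      have hev : ∀ᶠ q : S3 in 𝓝 p, χ q = 0 :=
        hχ0.filter_mono (nhds_le_nhdsSet (show p ∈ T ∩ {p | s * h p ≤ 0} from ⟨hpT, hlt.le⟩))
      rw [dX_congr (g := fun _ => (0 : ℝ)) dΦχ (differentiableAt_const _)
        (hev.mono fun q hq => by simp [hq])]
      simp [dX]
    · rw [indicator_of_mem (show p ∈ {p : S3 | p ∈ U ∧ 0 < s * h p} from ⟨hTU hpT, hgt⟩), e3]
      have hev : ∀ᶠ q : S3 in 𝓝 p, χ q = 1 :=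
        hχ1.filter_mono (nhds_le_nhdsSet (show p ∈ T ∩ {p | 0 ≤ s * h p} from ⟨hpT, hgt.le⟩))
      rw [dX_congr dΦχ dΦ (hev.mono fun q hq => by simp [hq])]
  · have hev : ∀ᶠ q : S3 in 𝓝 p, φ q * f q = 0 := by
      filter_upwards [hTc.isOpen_compl.mem_nhds hpT] with q hq
      by_contra hne
      exact hq (subset_tsupport (fun p : S3 => φ p * f p) hne)
    rw [dX_congr (g := fun _ => (0 : ℝ)) dΦχ (differentiableAt_const _)
      (hev.mono fun q hq => by simp [hq])]
    have e4 : dX j (fun q => φ q * f q) p = 0 := by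
      rw [dX_congr (g := fun _ => (0 : ℝ)) dΦ (differentiableAt_const _) hev]
      simp [dX]
    have e5 : φ p • toL2 _ (hc' j) p + frameDeriv j φ p • toL2 _ hc p = 0 := by
      rw [e3, e4, zero_smul]
    refine Eq.trans ((Set.indicator_apply_eq_zero (f := fun p : S3 => φ p • toL2 _ (hc' j) p +
      frameDeriv j φ p • toL2 _ hc p)).2 fun _ => e5) ?_
    simp [dX]

lemma toL2_mem_domain {f : E4 → ℝ} (hf : IsTest (complSurfaces S) f) (ξ : Spinor)
    (hc : Continuous fun p => f p • ξ) : toL2 _ hc ∈ (diracMin S α).domain := by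
  have hc' (j : Fin 3) : Continuous fun p => dX j f p • ξ :=
    (contDiff_dX hf.1).continuous.smul continuous_const
  have h : IsMinPair S α (toL2 _ hc) fun j => toL2 _ (hc' j) := by
    refine ⟨fun j => hasWeakDeriv_of_weakDeriv ?_ (ae_mem_complSurfaces S), fun k => ?_⟩
    · refine (weakDeriv_of_contDiff _ j (s := fun p => f p • ξ) (hf.1.smul contDiff_const)).congr_ae
        (coeFn_toL2 hc).symm ?_
      simp only [dX_smul_const hf.1]
      exact (coeFn_toL2 (hc' j)).symm
    · exact ⟨fun _ => 0, fun _ => 0, hasTrace_zero_of_isTest hf ξ k _ one_ne_zero hc hc',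
        hasTrace_zero_of_isTest hf ξ k _ (neg_ne_zero.2 one_ne_zero) hc hc',
        MemHHalfLoc.zero _, MemHHalfLoc.zero _, by simp⟩
  exact h.exists_apply.1

/-- `𝒟_𝑨^{(min)}` is densely defined. -/
theorem dense_domain (S : Fin K → OrientedSurface) (α : Fin K → ℝ) :
    Dense ((diracMin S α).domain : Set L2) := by
  rw [Submodule.dense_iff_topologicalClosure_eq_top, Submodule.topologicalClosure_eq_top_iff,
    Submodule.eq_bot_iff]
  intro y hy
  refine L2_eq_zero_of_test (complSurfaces_isOpen S) (ae_mem_complSurfaces S) fun f hf => ?_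
  refine ext_inner_left ℂ fun ξ => ?_
  have hc : Continuous fun p => f p • ξ := hf.1.continuous.smul continuous_const
  have h1 := (Submodule.mem_orthogonal _ _).1 hy _ (toL2_mem_domain hf ξ hc)
  rw [inner_zero_right, ← h1, L2.inner_def,
    ← integral_inner (integrable_smoothSmul hf.1 (L2_integrable y))]
  refine integral_congr_ae ?_
  filter_upwards [coeFn_toL2 hc] with p hp
  rw [hp]
  simp only [RCLike.real_smul_eq_coe_smul (K := ℂ), inner_smul_left, inner_smul_right,
    RCLike.conj_ofReal]

lemma IsMinPair.exists_gaugeH1 (hS : IsSeifertFamily S) {ψ : L2} {g : Fin 3 → L2}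
    (h : IsMinPair S α ψ g) {q : S3} (hq : q ∉ link S) :
    ∃ U u, IsOpen U ∧ q ∈ U ∧ (∀ p, ‖u p‖ = 1) ∧ GaugeH1 U u ψ fun j => g j := by
  obtain ⟨U, e, hU, hqU, hUΓ, he⟩ := exists_localEquations hS hq
  obtain ⟨U', hU', hqU', H⟩ := exists_gauge (α := α) hS hU hUΓ he hqU
  exact ⟨U', gauge α e, hU', hqU', norm_gauge α e, H ψ g h.1 h.2⟩

/-- The integrated Lichnerowicz formula `‖(P + 1)ψ‖² = ‖Xψ‖² + ‖ψ‖²`, where `P = -i ∑ σ_j X_j`. -/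
lemma IsMinPair.norm_sq_eq (hS : IsSeifertFamily S) (hK : 1 ≤ K) {ψ : L2} {g : Fin 3 → L2}
    (h : IsMinPair S α ψ g) :
    ‖(-Complex.I) • slashL g + ψ‖ ^ 2 = ∑ j, ‖g j‖ ^ 2 + ‖ψ‖ ^ 2 := by
  have h0 := integral_lichA_eq_zero (hS.hasCutoffs hK) (ψ := ψ) (g := g) fun q hq =>
    h.exists_gaugeH1 hS hq
  have hn (x y : L2) : ∫ p, (inner ℂ (x p) (y p)).re ∂vol3 = (inner ℂ x y).re := by
    rw [L2.inner_def]
    exact integral_re (𝕜 := ℂ) (integrable_inner_L2 x y)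
  rw [integral_congr_ae (lichA_ae ψ g), integral_add, integral_sub, integral_finsetSum,
    integral_const_mul] at h0
  · simp only [hn] at h0
    have e (x : L2) : (inner ℂ x x : ℂ).re = ‖x‖ ^ 2 := inner_self_eq_norm_sq (𝕜 := ℂ) x
    simp only [e] at h0
    rw [norm_add_sq (𝕜 := ℂ), norm_smul, norm_neg, Complex.norm_I, one_mul, RCLike.re_eq_complex_re,
      ← inner_conj_symm, Complex.conj_re]
    linarith
  · exact fun j _ => integrable_re_inner_L2 _ _
  · exact integrable_re_inner_L2 _ _
  · exact integrable_finsetSum _ fun j _ => integrable_re_inner_L2 _ _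
  · exact (integrable_re_inner_L2 _ _).sub
      (integrable_finsetSum _ fun j _ => integrable_re_inner_L2 _ _)
  · exact (integrable_re_inner_L2 _ _).const_mul 2

/-- The Dirac operator controls the `H¹` norm. -/
lemma IsMinPair.norm_le (hS : IsSeifertFamily S) (hK : 1 ≤ K) {ψ : L2} {g : Fin 3 → L2}
    (h : IsMinPair S α ψ g) : ‖ψ‖ ≤ 2 * ‖diracExpr ψ g‖ ∧ ∀ j, ‖g j‖ ≤ 2 * ‖diracExpr ψ g‖ := by
  have h1 := h.norm_sq_eq hS hK
  -- the Dirac expression is `P + 3/2`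
  have h2 : (-Complex.I) • slashL g + ψ = diracExpr ψ g - (1 / 2 : ℂ) • ψ := by
    rw [diracExpr_eq, add_sub_assoc, ← sub_smul]
    norm_num
  have h3 : ‖diracExpr ψ g - (1 / 2 : ℂ) • ψ‖ ≤ ‖diracExpr ψ g‖ + ‖ψ‖ / 2 := by
    refine (norm_sub_le _ _).trans_eq ?_
    rw [norm_smul]
    norm_num
    ring
  rw [h2] at h1
  have hs : 0 ≤ ∑ j, ‖g j‖ ^ 2 := Finset.sum_nonneg fun j _ => sq_nonneg _
  have h4 : ‖ψ‖ ≤ ‖diracExpr ψ g‖ + ‖ψ‖ / 2 :=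
    (sq_le_sq₀ (norm_nonneg _) (norm_nonneg _)).1 (by linarith) |>.trans h3
  refine ⟨by linarith, fun j => ?_⟩
  have h5 : ‖g j‖ ^ 2 ≤ ∑ j, ‖g j‖ ^ 2 :=
    Finset.single_le_sum (f := fun j => ‖g j‖ ^ 2) (fun j _ => sq_nonneg _) (Finset.mem_univ j)
  have h6 : ‖g j‖ ≤ ‖diracExpr ψ g‖ + ‖ψ‖ / 2 :=
    (sq_le_sq₀ (norm_nonneg _) (norm_nonneg _)).1
      (by linarith [sq_nonneg ‖ψ‖]) |>.trans h3
  linarith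

/-- Spinors in `L²` which locally off the link are, in the gauge of the potential, in `H¹`, with
`σ·Xv ∈ L²`, satisfy Green's formula against the domain of `𝒟_𝑨^{(min)}`. -/
theorem IsMinPair.inner_diracExpr (hS : IsSeifertFamily S) (hK : 1 ≤ K) {ψ : L2} {g : Fin 3 → L2}
    (h : IsMinPair S α ψ g) {v : L2} {gv : Fin 3 → S3 → Spinor} {r : L2}
    (hr : r =ᵐ[vol3] fun p => slash fun j => gv j p)
    (hv : ∀ q ∉ link S, ∃ (U : Set S3) (e : Fin K → E4 → ℝ), IsOpen U ∧ q ∈ U ∧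
      Disjoint U (link S) ∧ (∀ k, IsLocalEquation (S k).carrier (S k).normal U (e k)) ∧
      GaugeH1 U (gauge α e) v gv) :
    inner ℂ (diracExpr ψ g) v = inner ℂ ψ ((-Complex.I) • r + (3 / 2 : ℂ) • v) := by
  have h0 : inner ℂ (slashL g) v + inner ℂ ψ r = 0 := by
    refine green_formula (hS.hasCutoffs hK) hr fun q hq => ?_
    obtain ⟨U, e, hU, hqU, hUΓ, he, hG⟩ := hv q hq
    obtain ⟨U', hU', hqU', H⟩ := exists_gauge (α := α) hS hU hUΓ he hqU
    exact ⟨U ∩ U', gauge α e, hU.inter hU', ⟨hqU, hqU'⟩, norm_gauge α e,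
      (H ψ g h.1 h.2).mono inter_subset_right, hG.mono inter_subset_left⟩
  rw [diracExpr_eq, inner_add_left, inner_add_right, inner_smul_left, inner_smul_left,
    inner_smul_right, inner_smul_right, map_neg, Complex.conj_I, map_div₀]
  simp only [map_ofNat]
  linear_combination Complex.I * h0

theorem isFormalAdjoint_self (hS : IsSeifertFamily S) (hK : 1 ≤ K) :
    (diracMin S α).IsFormalAdjoint (diracMin S α) := by
  intro x y
  obtain ⟨g, hg, hx⟩ := exists_isMinPair x
  obtain ⟨g', hg', hy⟩ := exists_isMinPair y
  rw [hx, hy, diracExpr_eq (y : L2) g']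
  refine hg.inner_diracExpr hS hK (slashL_ae g') fun q hq => ?_
  obtain ⟨U, e, hU, hqU, hUΓ, he⟩ := exists_localEquations hS hq
  obtain ⟨U', hU', hqU', H⟩ := exists_gauge (α := α) hS hU hUΓ he hqU
  exact ⟨U ∩ U', e, hU.inter hU', ⟨hqU, hqU'⟩, hUΓ.mono_left inter_subset_left,
    fun k => (he k).mono inter_subset_left, (H _ g' hg'.1 hg'.2).mono inter_subset_right⟩

/-- The spinors in `H¹(Ω)²`. -/
def sobolev (S : Fin K → OrientedSurface) : Submodule ℂ L2 where
  carrier := {ψ | ∃ g : Fin 3 → L2, ∀ j, HasWeakDeriv (complSurfaces S) j ψ (g j)}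
  zero_mem' := ⟨fun _ => 0, fun j => HasWeakDeriv.zero _ j⟩
  add_mem' := fun ⟨g, hg⟩ ⟨g', hg'⟩ => ⟨fun j => g j + g' j, fun j => (hg j).add (hg' j)⟩
  smul_mem' := fun a _ ⟨g, hg⟩ => ⟨fun j => a • g j, fun j => (hg j).smul a⟩

/-- The domain of the closure of `𝒟_𝑨^{(min)}` is contained in `H¹(Ω)²`. -/
theorem mem_sobolev_of_tendsto (hS : IsSeifertFamily S) (hK : 1 ≤ K)
    (x : ℕ → (diracMin S α).domain) (a b : L2) (hx : Tendsto (fun n => (x n : L2)) atTop (𝓝 a))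
    (hTx : Tendsto (fun n => diracMin S α (x n)) atTop (𝓝 b)) : a ∈ sobolev S := by
  choose g hg hgx using fun n => exists_isMinPair (x n)
  have hsub (m n : ℕ) (j : Fin 3) : ‖g m j - g n j‖ ≤
      2 * ‖diracMin S α (x m) - diracMin S α (x n)‖ := by
    obtain ⟨g', hg', hx'⟩ := exists_isMinPair (x m - x n)
    have h1 : g' j = g m j - g n j := by
      refine (hg'.1 j).unique (complSurfaces_isOpen S) ?_
      have := ((hg m).1 j).add (((hg n).1 j).smul (-1))
      simp only [neg_one_smul, ← sub_eq_add_neg] at this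
      exact this
    rw [← h1, ← LinearPMap.map_sub, hx']
    exact (hg'.norm_le hS hK).2 j
  have hlim (j : Fin 3) : ∃ c, Tendsto (fun n => g n j) atTop (𝓝 c) := by
    refine cauchySeq_tendsto_of_complete ?_
    rw [Metric.cauchySeq_iff]
    intro ε hε
    obtain ⟨N, hN⟩ := Metric.cauchySeq_iff.1 hTx.cauchySeq (ε / 2) (half_pos hε)
    refine ⟨N, fun m hm n hn => ?_⟩
    have h1 := hN m hm n hn
    rw [dist_eq_norm] at h1 ⊢
    linarith [hsub m n j]
  choose c hc using hlim
  exact ⟨c, fun j => hasWeakDeriv_of_weakDeriv (WeakDeriv.of_tendsto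
    (fun n => ((hg n).1 j).weakDeriv) hx (hc j)) (ae_mem_complSurfaces S)⟩

/-! ### Complex coordinates transverse to the boundary of a surface -/

lemma eq_sum_frame (p : S3) {v : E4} (h : inner ℝ (p : E4) v = 0) :
    v = ∑ j, inner ℝ (frame j p) v • frame j (p : E4) := by
  by_contra hne
  have h1 : inner ℝ (p : E4) (v - ∑ j, inner ℝ (frame j p) v • frame j (p : E4)) = 0 := by
    rw [inner_sub_right, h, inner_sum]
    simp [inner_smul_right, inner_frame_self]
  obtain ⟨k, hk⟩ := exists_frame_ne_zero h1 (sub_ne_zero.2 hne)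
  refine hk ?_
  have horth (i j : Fin 3) : inner ℝ (frame i (p : E4)) (frame j p) = if i = j then (1 : ℝ) else 0 := by
    by_cases hij : i = j
    · rw [if_pos hij, hij, real_inner_self_eq_norm_sq, norm_frame, norm_eq_of_mem_sphere, one_pow]
    · rw [if_neg hij]
      revert hij
      fin_cases i <;> fin_cases j <;> simp [frame, PiLp.inner_apply, Fin.sum_univ_four] <;> ring
  rw [real_inner_comm, inner_sub_right, inner_sum]
  simp [inner_smul_right, horth]

lemma fderiv_tangent (p : S3) {v : E4} (h : inner ℝ (p : E4) v = 0) (f : E4 → ℝ) :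
    fderiv ℝ f p v = ∑ j, inner ℝ (frame j p) v * dX j f p := by
  conv_lhs => rw [eq_sum_frame p h, map_sum]
  simp [dX]

/-- The tangent vector with components `a j` in the frame. -/
lemma fderiv_sum_frame (p : S3) (a : Fin 3 → ℝ) (f : E4 → ℝ) :
    fderiv ℝ f p (∑ j, a j • frame j p) = ∑ j, a j * dX j f p := by
  simp [dX]

lemma inner_sum_frame (p : S3) (a : Fin 3 → ℝ) :
    inner ℝ (p : E4) (∑ j, a j • frame j p) = 0 := by
  rw [inner_sum]
  simp [inner_smul_right, inner_frame_self]

lemma fderiv_complex {f g : E4 → ℝ} {x : E4} (hf : DifferentiableAt ℝ f x)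
    (hg : DifferentiableAt ℝ g x) (v : E4) :
    fderiv ℝ (fun y => (f y : ℂ) + (g y : ℂ) * Complex.I) x v =
      (fderiv ℝ f x v : ℂ) + (fderiv ℝ g x v : ℂ) * Complex.I := by
  have h1 : HasFDerivAt (fun y => (f y : ℂ)) (Complex.ofRealCLM.comp (fderiv ℝ f x)) x :=
    Complex.ofRealCLM.hasFDerivAt.comp x hf.hasFDerivAt
  have h2 : HasFDerivAt (fun y => (g y : ℂ)) (Complex.ofRealCLM.comp (fderiv ℝ g x)) x :=
    Complex.ofRealCLM.hasFDerivAt.comp x hg.hasFDerivAt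
  have h3 : HasFDerivAt (fun y => (f y : ℂ) + (g y : ℂ) * Complex.I) _ x :=
    h1.add (h2.mul_const Complex.I)
  rw [h3.fderiv]
  simp [mul_comm]

lemma fderiv_mul_of_eq_zero {f g : E4 → ℝ} {x : E4} (hf : DifferentiableAt ℝ f x)
    (hg : DifferentiableAt ℝ g x) (h : g x = 0) (v : E4) :
    fderiv ℝ (fun y => f y * g y) x v = f x * fderiv ℝ g x v := by
  rw [fderiv_fun_mul hf hg, h]
  simp

/-- `z` is a complex coordinate on the open set `V`, transverse to the boundary of the surface `S`:
the surface is `{z ∈ (-∞, 0]}`, its boundary is `{z = 0}`, and `dz` is isotropic along the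
boundary. -/
structure IsBoundaryCoordinate (S : OrientedSurface) (V : Set S3) (z : E4 → ℂ) : Prop where
  smooth : ContDiff ℝ ∞ z
  mem_iff : ∀ q ∈ V, q ∈ S.carrier ↔ (z q).im = 0 ∧ (z q).re ≤ 0
  localEquation : IsLocalEquation S.carrier S.normal {q | q ∈ V ∧ (z q).re < 0} fun x => (z x).im
  mem_boundary : ∀ q ∈ V, z q = 0 → q ∈ S.boundary
  isotropic : ∀ q ∈ V, z q = 0 → ∑ j, dX j z q ^ 2 = 0

/-- If `S = {h = 0, b ≥ 0}` near `p`, take `Re z = -(|∇h|² b - ⟨∇b, ∇h⟩ h)`, whose gradient along the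
boundary is orthogonal to `∇h`, and `Im z = √G h`, where `G` is the Gram determinant of the gradients.
The factor `√G` makes the gradients of `Re z` and `Im z` equally long along the boundary. -/
theorem exists_boundaryCoordinate {S : OrientedSurface} {p : S3} (hp : p ∈ S.boundary) :
    ∃ (V : Set S3) (z : E4 → ℂ), IsOpen V ∧ p ∈ V ∧ IsBoundaryCoordinate S V z ∧ z p = 0 ∧
      ∀ ζ : ℂ, ∃ v : E4, inner ℝ (p : E4) v = 0 ∧ fderiv ℝ z p v = ζ := by
  obtain ⟨hpS, U, h, b, hU, hpU, hh, hb, hmem, hgrad, hbp, v, hpv, hhv, hbv⟩ := hp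
  have hhp : h p = 0 := ((hmem p hpU).1 hpS).1
  have dh (x : E4) : DifferentiableAt ℝ h x := (hh.differentiable (by simp)).differentiableAt
  have db (x : E4) : DifferentiableAt ℝ b x := (hb.differentiable (by simp)).differentiableAt
  -- Gram matrix of the gradients of `h` and `b`
  set A : E4 → ℝ := fun x => ∑ j, dX j h x ^ 2 with hA
  set B : E4 → ℝ := fun x => ∑ j, dX j b x ^ 2 with hB
  set D : E4 → ℝ := fun x => ∑ j, dX j b x * dX j h x with hD
  set G : E4 → ℝ := fun x => A x * B x - D x ^ 2 with hG
  set e : Fin 3 → E4 → ℝ := fun j x => A x * dX j b x - D x * dX j h x with he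
  have cA : ContDiff ℝ ∞ A := ContDiff.sum fun j _ => (contDiff_dX hh).pow 2
  have cB : ContDiff ℝ ∞ B := ContDiff.sum fun j _ => (contDiff_dX hb).pow 2
  have cD : ContDiff ℝ ∞ D := ContDiff.sum fun j _ => (contDiff_dX hb).mul (contDiff_dX hh)
  have cG : ContDiff ℝ ∞ G := (cA.mul cB).sub (cD.pow 2)
  have heh (x : E4) : ∑ j, e j x * dX j h x = 0 := by
    simp only [he, hA, hD, Fin.sum_univ_three]; ring
  have heb (x : E4) : ∑ j, e j x * dX j b x = G x := by
    simp only [he, hG, hA, hB, hD, Fin.sum_univ_three]; ring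
  have hee (x : E4) : ∑ j, e j x ^ 2 = A x * G x := by
    simp only [he, hG, hA, hB, hD, Fin.sum_univ_three]; ring
  have hAp : 0 < A p := by
    obtain ⟨c, hc, hd⟩ := hgrad p hpU hpS
    obtain ⟨j, hj⟩ := exists_dX_ne_zero hc (S.norm_normal p hpS) (S.normal_tangent p hpS) hd
    exact Finset.sum_pos' (fun i _ => sq_nonneg _) ⟨j, Finset.mem_univ j, by positivity⟩
  have hGp : 0 < G p := by
    have : 0 < ∑ j, e j p ^ 2 := by
      by_contra hle
      have h0 : ∑ j, e j (p : E4) ^ 2 = 0 :=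
        le_antisymm (not_lt.1 hle) (Finset.sum_nonneg fun j _ => sq_nonneg _)
      have h1 (j : Fin 3) : e j p = 0 := by
        have := (Finset.sum_eq_zero_iff_of_nonneg fun j _ => sq_nonneg (e j (p : E4))).1 h0 j
          (Finset.mem_univ j)
        exact pow_eq_zero_iff two_ne_zero |>.1 this
      have h2 : A p * fderiv ℝ b p v = D p * fderiv ℝ h p v := by
        rw [fderiv_tangent p hpv, fderiv_tangent p hpv, Finset.mul_sum, Finset.mul_sum]
        refine Finset.sum_congr rfl fun j _ => ?_
        have := h1 j
        simp only [he] at this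
        linear_combination inner ℝ (frame j (p : E4)) v * this
      rw [hhv, mul_zero] at h2
      exact (mul_ne_zero hAp.ne' hbv) h2
    rw [hee] at this
    exact pos_of_mul_pos_right this hAp.le
  -- a positive function which equals `G` near `p`
  have hO : IsOpen {x : E4 | 0 < A x ∧ 0 < G x} :=
    (isOpen_lt continuous_const cA.continuous).inter (isOpen_lt continuous_const cG.continuous)
  obtain ⟨r, hr, hball⟩ := Metric.isOpen_iff.1 hO p ⟨hAp, hGp⟩
  let φ : ContDiffBump (p : E4) := ⟨r / 2, r, half_pos hr, half_lt_self hr⟩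
  set G' : E4 → ℝ := fun x => φ x * G x + (1 - φ x) with hG'
  have hG'pos (x : E4) : 0 < G' x := by
    rcases eq_or_lt_of_le (φ.nonneg (x := x)) with h0 | h0
    · simp [hG', ← h0]
    · have hx : x ∈ Metric.ball (p : E4) r := by
        have : x ∈ Function.support φ := h0.ne'
        rwa [φ.support_eq] at this
      have h1 := mul_pos h0 (hball hx).2
      have h2 : φ x ≤ 1 := φ.le_one
      simp only [hG']
      linarith
  have hG'eq (x : E4) (hx : x ∈ Metric.ball (p : E4) (r / 2)) : G' x = G x := by
    have : φ x = 1 := φ.one_of_mem_closedBall (Metric.ball_subset_closedBall hx)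
    simp [hG', this]
  have cG' : ContDiff ℝ ∞ G' := (φ.contDiff.mul cG).add (contDiff_const.sub φ.contDiff)
  -- the real and the imaginary part of `z` are `ρ = D h - A b` and `τ = s h`
  set s : E4 → ℝ := fun x => √(G' x) with hs
  have cs : ContDiff ℝ ∞ s := cG'.sqrt fun x => (hG'pos x).ne'
  have hspos (x : E4) : 0 < s x := Real.sqrt_pos.2 (hG'pos x)
  set ρ : E4 → ℝ := fun x => D x * h x - A x * b x with hρ
  set τ : E4 → ℝ := fun x => s x * h x with hτ
  have cρ : ContDiff ℝ ∞ ρ := (cD.mul hh).sub (cA.mul hb)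
  have cτ : ContDiff ℝ ∞ τ := cs.mul hh
  have dif {f : E4 → ℝ} (hf : ContDiff ℝ ∞ f) (x : E4) : DifferentiableAt ℝ f x :=
    (hf.differentiable (by simp)).differentiableAt
  set z : E4 → ℂ := fun x => (ρ x : ℂ) + (τ x : ℂ) * Complex.I with hz
  have cz : ContDiff ℝ ∞ z := (Complex.ofRealCLM.contDiff.comp cρ).add
    ((Complex.ofRealCLM.contDiff.comp cτ).mul contDiff_const)
  have hre (x : E4) : (z x).re = ρ x := by simp [hz]
  have him (x : E4) : (z x).im = τ x := by simp [hz]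
  have him0 (x : E4) : τ x = 0 ↔ h x = 0 := by simp [hτ, (hspos x).ne']
  have dρ (x w : E4) (h0 : h x = 0) (b0 : b x = 0) :
      fderiv ℝ ρ x w = D x * fderiv ℝ h x w - A x * fderiv ℝ b x w := by
    rw [hρ, fderiv_fun_sub (f := fun y => D y * h y) (g := fun y => A y * b y)
      ((dif cD x).mul (dh x)) ((dif cA x).mul (db x))]
    rw [sub_apply, fderiv_mul_of_eq_zero (dif cD x) (dh x) h0,
      fderiv_mul_of_eq_zero (dif cA x) (db x) b0]
  have dτ (x w : E4) (h0 : h x = 0) : fderiv ℝ τ x w = s x * fderiv ℝ h x w :=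
    fderiv_mul_of_eq_zero (dif cs x) (dh x) h0 w
  have dz (x w : E4) (h0 : h x = 0) (b0 : b x = 0) : fderiv ℝ z x w =
      ((D x * fderiv ℝ h x w - A x * fderiv ℝ b x w : ℝ) : ℂ) +
        ((s x * fderiv ℝ h x w : ℝ) : ℂ) * Complex.I := by
    rw [hz, fderiv_complex (dif cρ x) (dif cτ x), dρ x w h0 b0, dτ x w h0]
  set V : Set S3 := U ∩ {q | (q : E4) ∈ Metric.ball (p : E4) (r / 2)} with hV
  have hVo : IsOpen V := hU.inter (Metric.isOpen_ball.preimage continuous_subtype_val)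
  have hpos {q : S3} (hq : q ∈ V) : 0 < A q ∧ 0 < G q :=
    hball (Metric.ball_subset_ball (half_le_self hr.le) hq.2)
  have hzero {q : S3} (hq : q ∈ V) (hz0 : z q = 0) : h q = 0 ∧ b q = 0 := by
    have h1 : h q = 0 := by rw [← him0, ← him, hz0]; rfl
    refine ⟨h1, ?_⟩
    have h2 : ρ q = 0 := by rw [← hre, hz0]; rfl
    simp only [hρ, h1, mul_zero, zero_sub, neg_eq_zero, mul_eq_zero] at h2
    exact h2.resolve_left (hpos hq).1.ne'
  refine ⟨V, z, hVo, ⟨hpU, Metric.mem_ball_self (half_pos hr)⟩, ⟨cz, ?_, ⟨?_, ?_, ?_⟩, ?_, ?_⟩,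
    by simp [hz, hρ, hτ, hhp, hbp], ?_⟩
  · intro q hq
    rw [hmem q hq.1, him, him0, hre]
    refine and_congr_right fun h0 => ?_
    simp only [hρ, h0, mul_zero, zero_sub, neg_nonpos]
    exact (mul_nonneg_iff_of_pos_left (hpos hq).1).symm
  · simp only [him]; exact cτ
  · rintro q ⟨hq, hneg⟩
    rw [hmem q hq.1, him, him0]
    refine ⟨fun h => h.1, fun h0 => ⟨h0, ?_⟩⟩
    rw [hre] at hneg
    simp only [hρ, h0, mul_zero, zero_sub] at hneg
    exact (pos_of_mul_pos_right (by linarith : 0 < A q * b q) (hpos hq).1.le).le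
  · rintro q ⟨hq, -⟩ hqS
    obtain ⟨c, hc, hd⟩ := hgrad q hq.1 hqS
    refine ⟨s q * c, mul_pos (hspos q) hc, fun w hw => ?_⟩
    simp only [him]
    rw [dτ q w ((hmem q hq.1).1 hqS).1, hd w hw, mul_assoc]
  · intro q hq hz0
    obtain ⟨h0, b0⟩ := hzero hq hz0
    refine ⟨(hmem q hq.1).2 ⟨h0, b0.ge⟩, U, h, b, hU, hq.1, hh, hb, hmem, hgrad, b0,
      ∑ j, e j q • frame j q, inner_sum_frame q _, ?_, ?_⟩
    · rw [fderiv_sum_frame q (fun j => e j q), heh]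
    · rw [fderiv_sum_frame q (fun j => e j q), heb]
      exact (hpos hq).2.ne'
  · intro q hq hz0
    obtain ⟨h0, b0⟩ := hzero hq hz0
    have h1 (j : Fin 3) : dX j z q = -(e j q : ℂ) + ((s q * dX j h q : ℝ) : ℂ) * Complex.I := by
      rw [dX, dz _ _ h0 b0]
      simp only [he, dX]
      push_cast
      ring
    have h2 : ((s q : ℂ)) ^ 2 = (G q : ℂ) := by
      rw [← hG'eq q hq.2, ← Complex.ofReal_pow, hs]
      simp only
      rw [Real.sq_sqrt (hG'pos q).le]
    have h3 : ((∑ j, e j (q : E4) ^ 2 : ℝ) : ℂ) = A q * G q := by rw [hee]; push_cast; rfl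
    have h4 : ((∑ j, e j (q : E4) * dX j h q : ℝ) : ℂ) = 0 := by rw [heh]; simp
    have h5 : ((∑ j, dX j h (q : E4) ^ 2 : ℝ) : ℂ) = A q := rfl
    push_cast at h3 h4 h5
    have h6 (j : Fin 3) : dX j z q ^ 2 = (e j q : ℂ) ^ 2 - s q ^ 2 * ((dX j h q : ℝ) : ℂ) ^ 2 -
        2 * s q * Complex.I * (e j q * ((dX j h q : ℝ) : ℂ)) := by
      rw [h1]
      push_cast
      linear_combination ((s q : ℂ) * ((dX j h q : ℝ) : ℂ)) ^ 2 * Complex.I_sq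
    rw [Finset.sum_congr rfl fun j _ => h6 j, Finset.sum_sub_distrib, Finset.sum_sub_distrib,
      ← Finset.mul_sum, ← Finset.mul_sum, h3, h4, h5, h2]
    ring
  · intro ζ
    have hsp := hspos p
    set a : Fin 3 → ℝ := fun j => (-ζ.re / (A p * G p)) * e j p + (ζ.im / (s p * A p)) * dX j h p
      with ha
    have h1 : ∑ j, a j * dX j h p = ζ.im / s p := by
      have : ∑ j, a j * dX j h p = (-ζ.re / (A p * G p)) * ∑ j, e j (p : E4) * dX j h p +
          (ζ.im / (s p * A p)) * A p := by
        simp only [ha, hA, Fin.sum_univ_three]; ring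
      rw [this, heh]
      field_simp
      ring
    have h2 : ∑ j, a j * dX j b p = -ζ.re / A p + ζ.im / (s p * A p) * D p := by
      have : ∑ j, a j * dX j b p = (-ζ.re / (A p * G p)) * ∑ j, e j (p : E4) * dX j b p +
          (ζ.im / (s p * A p)) * D p := by
        simp only [ha, hD, Fin.sum_univ_three]; ring
      rw [this, heb]
      field_simp
    refine ⟨∑ j, a j • frame j p, inner_sum_frame p a, ?_⟩
    rw [dz _ _ hhp hbp, fderiv_sum_frame p a, fderiv_sum_frame p a, h1, h2]
    have h3 : D p * (ζ.im / s p) - A p * (-ζ.re / A p + ζ.im / (s p * A p) * D p) = ζ.re := by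
      field_simp
      ring
    have h4 : s p * (ζ.im / s p) = ζ.im := by field_simp
    rw [h3, h4, Complex.re_add_im]

/-- Metric regularity of a submersion. -/
lemma exists_preimage_near {Y : Type*} [NormedAddCommGroup Y] [NormedSpace ℝ Y] [CompleteSpace Y]
    {F : E4 → Y} {F' : E4 →L[ℝ] Y} {p : E4} (hF : HasStrictFDerivAt F F' p)
    (hs : Function.Surjective F') : ∃ C > 0, ∃ ε > 0, ∀ x ∈ Metric.ball p ε, ∀ y, ‖y - F x‖ < ε →
      ∃ x', F x' = y ∧ dist x' x ≤ C * ‖y - F x‖ := by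
  have hr : F'.range = ⊤ := LinearMap.range_eq_top.2 hs
  set R := F'.nonlinearRightInverseOfSurjective hr
  have hR : 0 < R.nnnorm := F'.nonlinearRightInverseOfSurjective_nnnorm_pos hr
  set c : NNReal := R.nnnorm⁻¹ / 2 with hc
  have hcpos : 0 < c := by positivity
  obtain ⟨s, hs, hap⟩ := hF.approximates_deriv_on_nhds (Or.inr hcpos)
  obtain ⟨δ, hδ, hball⟩ := Metric.mem_nhds_iff.1 hs
  have hc' : (0 : ℝ) < c := hcpos
  refine ⟨(c : ℝ)⁻¹, by positivity, min (δ / 2) (c * (δ / 2)), by positivity, fun x hx y hy => ?_⟩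
  set t : ℝ := (c : ℝ)⁻¹ * ‖y - F x‖ with ht
  have ht0 : 0 ≤ t := by positivity
  have htδ : t < δ / 2 := by
    rw [ht, inv_mul_lt_iff₀ hc']
    exact hy.trans_le (min_le_right _ _)
  have hsub : Metric.closedBall x t ⊆ s := by
    refine Subset.trans (fun w hw => ?_) hball
    have h1 : dist x p < δ / 2 := (Metric.mem_ball.1 hx).trans_le (min_le_left _ _)
    rw [Metric.mem_ball]
    linarith [dist_triangle w x p, Metric.mem_closedBall.1 hw]
  have hsurj := hap.surjOn_closedBall_of_nonlinearRightInverse R ht0 hsub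
  have hrad : ((R.nnnorm : ℝ)⁻¹ - c) * t = ‖y - F x‖ := by
    have : (R.nnnorm : ℝ)⁻¹ - c = c := by rw [hc]; push_cast; ring
    rw [this, ht, mul_inv_cancel_left₀ hc'.ne']
  obtain ⟨x', hx', hFx'⟩ := hsurj (show y ∈ _ by
    rw [hrad, Metric.mem_closedBall, dist_eq_norm])
  exact ⟨x', hFx', hx'⟩

/-! ### Volumes of the tubes `{|z| < ρ}` -/

/-- Balls of radius `r` in `𝕊³` have volume at least a multiple of `r³`. -/
lemma exists_le_vol3_ball : ∃ c : ℝ, 0 < c ∧ ∀ (p : S3) (r : ℝ), 0 < r → r ≤ 1 →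
    ENNReal.ofReal (c * r ^ 3) ≤ vol3 (Metric.ball p r) := by
  set V := (volume : Measure E4).real (Metric.ball 0 1)
  have hV : 0 < V := ENNReal.toReal_pos (Metric.measure_ball_pos _ _ one_pos).ne'
    measure_ball_lt_top.ne
  refine ⟨V / 1024, by positivity, fun p r hr hr1 => ?_⟩
  have h := congrArg (fun μ => μ (Metric.ball p r)) (map_radial one_pos (by linarith : 1 < 1 + r))
  simp only [Measure.smul_apply, smul_eq_mul] at h
  rw [Measure.map_apply measurable_radial measurableSet_ball,
    Measure.restrict_apply (measurable_radial measurableSet_ball)] at h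
  have hsub : Metric.ball ((1 + r / 2) • (p : E4)) (r / 4) ⊆
      radial ⁻¹' Metric.ball p r ∩ shell 1 (1 + r) := by
    intro x hx
    have hnp : ‖(1 + r / 2) • (p : E4)‖ = 1 + r / 2 := by
      rw [norm_smul, norm_eq_of_mem_sphere, mul_one, Real.norm_of_nonneg (by positivity)]
    have hx' : ‖x - (1 + r / 2) • (p : E4)‖ < r / 4 := by rwa [← dist_eq_norm]
    have h1 := abs_norm_sub_norm_le x ((1 + r / 2) • (p : E4))
    rw [hnp] at h1
    obtain ⟨h2, h3⟩ := abs_le.1 (h1.trans hx'.le)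
    have hx1 : 1 < ‖x‖ := by linarith
    have hx0 : 0 < ‖x‖ := by linarith
    refine ⟨?_, hx1, by linarith⟩
    rw [mem_preimage, Metric.mem_ball, Subtype.dist_eq, coe_radial (norm_pos_iff.1 hx0),
      dist_eq_norm]
    have e : ‖x‖⁻¹ • x - (p : E4) = ‖x‖⁻¹ • ((x - (1 + r / 2) • (p : E4)) -
        (‖x‖ - (1 + r / 2)) • (p : E4)) := by
      have : ‖x‖⁻¹ * ‖x‖ = 1 := inv_mul_cancel₀ hx0.ne'
      have e2 : (p : E4) = (‖x‖⁻¹ * ‖x‖) • (p : E4) := by rw [this, one_smul]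
      conv_lhs => rw [e2]
      module
    rw [e, norm_smul, norm_inv, norm_norm]
    have h4 : ‖(x - (1 + r / 2) • (p : E4)) - (‖x‖ - (1 + r / 2)) • (p : E4)‖ < r := by
      refine (norm_sub_le _ _).trans_lt ?_
      rw [norm_smul, norm_eq_of_mem_sphere, mul_one, Real.norm_eq_abs]
      linarith
    have h5 : ‖x‖⁻¹ ≤ 1 := inv_le_one_of_one_le₀ hx1.le
    exact (mul_le_of_le_one_left (norm_nonneg _) h5).trans_lt h4
  have hle := measure_mono (μ := (volume : Measure E4)) hsub
  rw [h, Measure.addHaar_ball _ _ (by positivity)] at hle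
  have hvol : (volume : Measure E4) (Metric.ball 0 1) = ENNReal.ofReal V :=
    (ofReal_measureReal measure_ball_lt_top.ne).symm
  have hdim : Module.finrank ℝ E4 = 4 := by simp
  rw [hdim, hvol, ← ENNReal.ofReal_mul (by positivity)] at hle
  have hup : ENNReal.ofReal (((1 + r) ^ 4 - 1 ^ 4) / 4) ≤ ENNReal.ofReal (4 * r) := by
    apply ENNReal.ofReal_le_ofReal
    nlinarith [pow_pos hr 2, pow_pos hr 3, pow_pos hr 4, mul_nonneg hr.le (sub_nonneg.2 hr1),
      mul_nonneg (pow_pos hr 2).le (sub_nonneg.2 hr1), mul_nonneg (pow_pos hr 3).le (sub_nonneg.2 hr1)]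
  have hle2 := hle.trans (mul_le_mul_left hup (vol3 (Metric.ball p r)))
  have hr0 : ENNReal.ofReal (4 * r) ≠ 0 := by simpa using hr
  rw [← ENNReal.mul_le_mul_iff_right hr0 ENNReal.ofReal_ne_top]
  refine le_trans (le_of_eq ?_) hle2
  rw [← ENNReal.ofReal_mul (by positivity)]
  congr 1
  ring

/-- Points of the sphere near `p` can be moved to zeros of `z` with a prescribed value of a linear
function, by a distance controlled by the change of the values. -/
lemma exists_zero_near {z : E4 → ℂ} (hz : ContDiff ℝ ∞ z) {p : S3}
    (hsurj : ∀ ζ : ℂ, ∃ v : E4, inner ℝ (p : E4) v = 0 ∧ fderiv ℝ z p v = ζ) :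
    ∃ e : E4, e ≠ 0 ∧ ∃ C > 0, ∃ ε > 0, ∀ q : S3, dist q p < ε → ∀ t : ℝ,
      ‖z q‖ + |t - inner ℝ e ((q : E4) - p)| < ε → ∃ q' : S3, z q' = 0 ∧
        inner ℝ e ((q' : E4) - p) = t ∧
        dist q' q ≤ C * (‖z q‖ + |t - inner ℝ e ((q : E4) - p)|) := by
  have hn : ‖(p : E4)‖ ^ 2 = 1 := by rw [norm_eq_of_mem_sphere, one_pow]
  -- a vector tangent to the zero set
  set L : E4 →ₗ[ℝ] ℂ × ℝ := (fderiv ℝ z p : E4 →ₗ[ℝ] ℂ).prod (innerₗ E4 (p : E4)) with hL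
  have hker : LinearMap.ker L ≠ ⊥ := by
    refine LinearMap.ker_ne_bot_of_finrank_lt ?_
    simp
  obtain ⟨e, he, he0⟩ := (Submodule.ne_bot_iff _).1 hker
  have he1 : fderiv ℝ z p e = 0 := congrArg Prod.fst (LinearMap.mem_ker.1 he)
  have he2 : inner ℝ (p : E4) e = 0 := congrArg Prod.snd (LinearMap.mem_ker.1 he)
  have hee : inner ℝ e e ≠ 0 := inner_self_ne_zero.2 he0
  let N : E4 → ℝ := fun x => ‖x‖ ^ 2
  let F : E4 → ℂ × ℝ × ℝ := fun x => (z x, ‖x‖ ^ 2, inner ℝ e (x - p))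
  have hz' : HasStrictFDerivAt z (fderiv ℝ z p) p :=
    hz.contDiffAt.hasStrictFDerivAt (by simp)
  have hN : HasStrictFDerivAt N (2 • innerSL ℝ (p : E4)) p := hasStrictFDerivAt_norm_sq (p : E4)
  have hl : HasStrictFDerivAt (fun x : E4 => inner ℝ e (x - p)) (innerSL ℝ e) (p : E4) := by
    have h1 := (innerSL ℝ e).hasStrictFDerivAt (x := (p : E4))
    have h2 := h1.sub_const (inner ℝ e (p : E4))
    refine h2.congr_of_eventuallyEq (Eventually.of_forall fun x => ?_)
    simp [inner_sub_right]
  have hF : HasStrictFDerivAt F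
      ((fderiv ℝ z p).prod ((2 • innerSL ℝ (p : E4)).prod (innerSL ℝ e))) p :=
    hz'.prodMk (hN.prodMk hl)
  have hFs : Function.Surjective
      ((fderiv ℝ z p).prod ((2 • innerSL ℝ (p : E4)).prod (innerSL ℝ e))) := by
    rintro ⟨ζ, s, t⟩
    obtain ⟨v, hv1, hv2⟩ := hsurj (ζ - fderiv ℝ z p ((s / 2) • (p : E4)))
    set y : E4 := (s / 2) • (p : E4) + v with hy
    refine ⟨y + ((t - inner ℝ e y) / inner ℝ e e) • e, ?_⟩
    have e1 : fderiv ℝ z p (y + ((t - inner ℝ e y) / inner ℝ e e) • e) = ζ := by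
      rw [map_add, map_smul, he1, smul_zero, add_zero, hy, map_add, hv2]
      abel
    have e2 : (2 : ℝ) * inner ℝ (p : E4) (y + ((t - inner ℝ e y) / inner ℝ e e) • e) = s := by
      rw [inner_add_right, inner_smul_right, he2, mul_zero, add_zero, hy, inner_add_right, hv1,
        inner_smul_right, real_inner_self_eq_norm_sq, hn]
      ring
    have e3 : inner ℝ e (y + ((t - inner ℝ e y) / inner ℝ e e) • e) = t := by
      rw [inner_add_right, inner_smul_right, div_mul_cancel₀ _ hee]
      ring
    refine Prod.ext e1 (Prod.ext ?_ e3)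
    simpa [two_smul, two_mul] using e2
  obtain ⟨C, hC, ε, hε, H⟩ := exists_preimage_near hF hFs
  refine ⟨e, he0, C, hC, ε, hε, fun q hq t ht => ?_⟩
  have hnorm : ‖((0 : ℂ), (1 : ℝ), t) - F q‖ ≤ ‖z q‖ + |t - inner ℝ e ((q : E4) - p)| := by
    have hnq : ‖(q : E4)‖ ^ 2 = 1 := by rw [norm_eq_of_mem_sphere, one_pow]
    have e1 : ((0 : ℂ), (1 : ℝ), t) - F q = (-z q, 0, t - inner ℝ e ((q : E4) - p)) := by
      simp only [F, hnq, Prod.mk_sub_mk, zero_sub, sub_self]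
    rw [e1, Prod.norm_def, Prod.norm_def, norm_neg, norm_zero, Real.norm_eq_abs]
    refine max_le (by linarith [abs_nonneg (t - inner ℝ e ((q : E4) - p))]) (max_le (by positivity) ?_)
    linarith [norm_nonneg (z q)]
  obtain ⟨x, hx1, hx2⟩ := H q hq (0, 1, t) (hnorm.trans_lt ht)
  have hx3 : ‖x‖ ^ 2 = 1 := congrArg (fun y => y.2.1) hx1
  have hx4 : ‖x‖ = 1 := by
    rw [← one_pow 2] at hx3
    exact (pow_left_inj₀ (norm_nonneg x) zero_le_one two_ne_zero).1 hx3
  refine ⟨⟨x, mem_sphere_zero_iff_norm.2 hx4⟩, congrArg Prod.fst hx1,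
    congrArg (fun y => y.2.2) hx1, hx2.trans ?_⟩
  exact mul_le_mul_of_nonneg_left hnorm hC.le

section
variable {z : E4 → ℂ} {p : S3}

lemma continuous_coord (hz : ContDiff ℝ ∞ z) : Continuous fun q : S3 => z q :=
  hz.continuous.comp continuous_subtype_val

/-- The distance to the boundary is `O(|z|)`. -/
lemma exists_boundary_near {S : OrientedSurface} {V : Set S3} (hV : IsOpen V) (hpV : p ∈ V)
    (H : IsBoundaryCoordinate S V z) (hzp : z p = 0)
    (hsurj : ∀ ζ : ℂ, ∃ v : E4, inner ℝ (p : E4) v = 0 ∧ fderiv ℝ z p v = ζ) {ε' : ℝ}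
    (hε' : 0 < ε') : ∃ C > 0, ∃ W, IsOpen W ∧ p ∈ W ∧ ∀ q ∈ W, ∃ q' ∈ V,
      z q' = 0 ∧ dist q' p < ε' ∧ dist q' q ≤ C * ‖z q‖ := by
  obtain ⟨e, -, C, hC, ε, hε, hnear⟩ := exists_zero_near H.smooth hsurj
  obtain ⟨δ, hδ, hball⟩ := Metric.isOpen_iff.1 hV p hpV
  set η := min δ ε' with hη
  have hη0 : 0 < η := lt_min hδ hε'
  have hcont : Continuous fun q : S3 => C * ‖z q‖ :=
    continuous_const.mul (continuous_coord H.smooth).norm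
  refine ⟨C, hC, {q | dist q p < min ε (η / 2) ∧ ‖z q‖ < ε ∧ C * ‖z q‖ < η / 2}, ?_, ?_, ?_⟩
  · exact (isOpen_lt (continuous_id.dist continuous_const) continuous_const).inter
      ((isOpen_lt (continuous_coord H.smooth).norm continuous_const).inter
        (isOpen_lt hcont continuous_const))
  · refine ⟨?_, ?_, ?_⟩
    · rw [dist_self]; positivity
    · rwa [hzp, norm_zero]
    · rw [hzp, norm_zero, mul_zero]; positivity
  · rintro q ⟨h1, h2, h3⟩
    obtain ⟨q', hq1, -, hq2⟩ := hnear q (h1.trans_le (min_le_left _ _))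
      (inner ℝ e ((q : E4) - p)) (by simpa using h2)
    rw [sub_self, abs_zero, add_zero] at hq2
    have h4 : dist q' p < η := by
      have := h1.trans_le (min_le_right _ _)
      linarith [dist_triangle q' q p]
    exact ⟨q', hball (h4.trans_le (min_le_left _ _)), hq1, h4.trans_le (min_le_right _ _), hq2⟩

/-- The set `{|z| < ρ}` is contained in a tube of radius `O(ρ)` around the boundary. -/
lemma exists_vol3_tube_le {S : OrientedSurface} (hS : HasSmallTubes S.boundary) {V : Set S3}
    (hV : IsOpen V) (hpV : p ∈ V) (H : IsBoundaryCoordinate S V z) (hzp : z p = 0)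
    (hsurj : ∀ ζ : ℂ, ∃ v : E4, inner ℝ (p : E4) v = 0 ∧ fderiv ℝ z p v = ζ) :
    ∃ C : ℝ, 0 ≤ C ∧ ∃ W, IsOpen W ∧ p ∈ W ∧
      ∀ ρ, 0 < ρ → vol3 (W ∩ {q : S3 | ‖z q‖ < ρ}) ≤ ENNReal.ofReal (C * ρ ^ 2) := by
  obtain ⟨C₁, hC₁, W, hW, hpW, hnear⟩ := exists_boundary_near hV hpV H hzp hsurj one_pos
  obtain ⟨C₂, hC₂, htube⟩ := hS
  set m := vol3.real univ
  have hm : 0 ≤ m := measureReal_nonneg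
  refine ⟨C₂ * C₁ ^ 2 + m * C₁ ^ 2, by positivity, W, hW, hpW, fun ρ hρ => ?_⟩
  by_cases h1 : C₁ * ρ ≤ 1
  · refine (measure_mono ?_).trans ((htube (C₁ * ρ) (by positivity) h1).trans
      (ENNReal.ofReal_le_ofReal ?_))
    · rintro q ⟨hqW, hq⟩
      obtain ⟨q', hq'V, hq'0, -, hd⟩ := hnear q hqW
      refine Metric.mem_thickening_iff.2 ⟨q', H.mem_boundary q' hq'V hq'0, ?_⟩
      rw [dist_comm]
      exact hd.trans_lt (mul_lt_mul_of_pos_left hq hC₁)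
    · rw [mul_pow, add_mul, ← mul_assoc]
      have : 0 ≤ m * C₁ ^ 2 * ρ ^ 2 := by positivity
      linarith
  · refine (measure_mono (subset_univ _)).trans ?_
    rw [← ofReal_measureReal]
    refine ENNReal.ofReal_le_ofReal ?_
    have h2 : 1 ≤ (C₁ * ρ) ^ 2 := one_le_pow₀ (not_le.1 h1).le
    have h3 : 0 ≤ C₂ * C₁ ^ 2 * ρ ^ 2 := by positivity
    nlinarith

/-- The set `{|z| < ρ}` contains at least a multiple of `1/ρ` disjoint balls of radius comparable to
`ρ`, centred on an arc in `{z = 0}`. -/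
lemma exists_le_vol3_tube (hz : ContDiff ℝ ∞ z) (hzp : z p = 0)
    (hsurj : ∀ ζ : ℂ, ∃ v : E4, inner ℝ (p : E4) v = 0 ∧ fderiv ℝ z p v = ζ) {N : Set S3}
    (hN : IsOpen N) (hpN : p ∈ N) :
    ∃ c > 0, ∃ ρ₀ > 0, ∀ ρ, 0 < ρ → ρ < ρ₀ →
      ENNReal.ofReal (c * ρ ^ 2) ≤ vol3 (N ∩ {q : S3 | ‖z q‖ < ρ}) := by
  obtain ⟨e, he0, C, hC, ε, hε, hnear⟩ := exists_zero_near hz hsurj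
  obtain ⟨c₀, hc₀, hvol⟩ := exists_le_vol3_ball
  obtain ⟨δ, hδ, hball⟩ := Metric.isOpen_iff.1 hN p hpN
  obtain ⟨L, s, hs, hLip⟩ := (hz.contDiffAt (x := (p : E4)) |>.of_le
    (by exact_mod_cast le_top : (1 : WithTop ℕ∞) ≤ ∞)).exists_lipschitzOnWith
  obtain ⟨δ', hδ', hball'⟩ := Metric.mem_nhds_iff.1 hs
  set E := ‖e‖
  have hE : 0 < E := norm_pos_iff.2 he0
  have hL : (0 : ℝ) ≤ L := L.2
  -- the length of the arc and the radii of the balls along it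
  set d := min δ δ' with hd
  have hd0 : 0 < d := lt_min hδ hδ'
  set a := min (ε / 2) (d / (2 * C)) with ha
  have ha0 : 0 < a := by positivity
  refine ⟨c₀ * a / (4 * E * (L + 1) ^ 2), by positivity,
    min (min (d / 2) 1) (a / (4 * E)), by positivity, fun ρ hρ hρlt => ?_⟩
  have hρd : ρ < d / 2 := hρlt.trans_le ((min_le_left _ _).trans (min_le_left _ _))
  have hρ1 : ρ < 1 := hρlt.trans_le ((min_le_left _ _).trans (min_le_right _ _))
  have hρa : 4 * E * ρ < a := by
    have := hρlt.trans_le (min_le_right _ _)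
    rwa [lt_div_iff₀ (by positivity), mul_comm] at this
  set r := ρ / (L + 1) with hr
  have hr0 : 0 < r := by positivity
  have hrρ : r ≤ ρ := div_le_self hρ.le (by linarith)
  have hLr : L * r < ρ := by
    have : (L + 1) * r = ρ := by rw [hr]; field_simp
    linarith
  set η := 2 * r * E with hη
  have hη0 : 0 < η := by positivity
  have hηa : 2 * η ≤ a := by
    have : r * E ≤ ρ * E := mul_le_mul_of_nonneg_right hrρ hE.le
    linarith
  set n := ⌊a / η⌋₊ with hn
  have hn1 : (n : ℝ) * η ≤ a := by
    have := Nat.floor_le (div_nonneg ha0.le hη0.le)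
    rwa [le_div_iff₀ hη0] at this
  have hn2 : a < (n + 1) * η := by
    have := Nat.lt_floor_add_one (a / η)
    rwa [div_lt_iff₀ hη0] at this
  have hpt (i : ℕ) (hi : i < n) : ∃ x : S3, z x = 0 ∧ inner ℝ e ((x : E4) - p) = i * η ∧
      dist x p ≤ C * a := by
    have hi0 : 0 ≤ (i : ℝ) * η := by positivity
    have hia : (i : ℝ) * η ≤ a := by
      refine le_trans ?_ hn1
      gcongr
    obtain ⟨x, h1, h2, h3⟩ := hnear p (by simpa using hε) (i * η) (by
      rw [hzp, norm_zero, sub_self, inner_zero_right, sub_zero, zero_add, abs_of_nonneg hi0]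
      exact (hia.trans (min_le_left _ _)).trans_lt (half_lt_self hε))
    rw [hzp, norm_zero, sub_self, inner_zero_right, sub_zero, zero_add, abs_of_nonneg hi0] at h3
    exact ⟨x, h1, h2, h3.trans (mul_le_mul_of_nonneg_left hia hC.le)⟩
  have hCa : C * a ≤ d / 2 := by
    have : C * (d / (2 * C)) = d / 2 := by field_simp
    exact (mul_le_mul_of_nonneg_left (min_le_right _ _) hC.le).trans_eq this
  have : Nonempty S3 := ⟨p⟩
  choose! x hx0 hxe hxp using hpt
  have hdisj : (Finset.range n : Set ℕ).PairwiseDisjoint fun i => Metric.ball (x i) r := by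
    intro i hi j hj hij
    refine Metric.ball_disjoint_ball ?_
    have hi' := Finset.mem_range.1 (Finset.mem_coe.1 hi)
    have hj' := Finset.mem_range.1 (Finset.mem_coe.1 hj)
    have h1 : |((i : ℝ) - j) * η| ≤ E * dist (x i) (x j) := by
      have h2 : inner ℝ e ((x i : E4) - x j) = ((i : ℝ) - j) * η := by
        rw [sub_mul, ← hxe i hi', ← hxe j hj', ← inner_sub_right, sub_sub_sub_cancel_right]
      rw [← h2, Subtype.dist_eq, dist_eq_norm]
      exact abs_real_inner_le_norm _ _
    have h3 : 1 ≤ |(i : ℝ) - j| := by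
      have : 1 ≤ |(i : ℤ) - j| := Int.one_le_abs (by omega)
      exact_mod_cast this
    rw [abs_mul, abs_of_pos hη0] at h1
    have h4 : E * (2 * r) ≤ E * dist (x i) (x j) := by
      refine le_trans ?_ h1
      have := mul_le_mul_of_nonneg_right h3 hη0.le
      linarith
    have := le_of_mul_le_mul_left h4 hE
    linarith
  have hsub : (⋃ i ∈ Finset.range n, Metric.ball (x i) r) ⊆ N ∩ {q : S3 | ‖z q‖ < ρ} := by
    intro q hq
    obtain ⟨i, hi, hqi⟩ := mem_iUnion₂.1 hq
    have hi' := Finset.mem_range.1 hi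
    have hqi' := Metric.mem_ball.1 hqi
    have h1 : dist q p < d := by
      have := hxp i hi'
      linarith [dist_triangle q (x i) p]
    have h2 : (q : E4) ∈ s := hball' (h1.trans_le (min_le_right _ _))
    have h3 : (x i : E4) ∈ s := by
      refine hball' ?_
      have : dist (x i) p < d := by have := hxp i hi'; linarith
      exact this.trans_le (min_le_right _ _)
    refine ⟨hball (h1.trans_le (min_le_left _ _)), ?_⟩
    have h4 := hLip.dist_le_mul (q : E4) h2 (x i : E4) h3
    rw [hx0 i hi', dist_zero_right] at h4
    have h5 : (L : ℝ) * dist (q : E4) (x i) ≤ L * r := mul_le_mul_of_nonneg_left hqi'.le hL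
    exact (h4.trans h5).trans_lt hLr
  calc ENNReal.ofReal (c₀ * a / (4 * E * (L + 1) ^ 2) * ρ ^ 2)
      ≤ ENNReal.ofReal (n * (c₀ * r ^ 3)) := by
        refine ENNReal.ofReal_le_ofReal ?_
        have h1 : ρ = (L + 1) * r := by rw [hr]; field_simp
        have h2 : c₀ * a / (4 * E * (L + 1) ^ 2) * ρ ^ 2 = a * (c₀ * r ^ 2) / (4 * E) := by
          rw [h1]; field_simp
        have h3 : a ≤ 4 * E * (n * r) := by
          have : a ≤ 2 * (n * η) := by linarith
          rw [hη] at this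
          linarith
        rw [h2, div_le_iff₀ (by positivity)]
        have h4 : 0 ≤ c₀ * r ^ 2 := by positivity
        calc a * (c₀ * r ^ 2) ≤ 4 * E * (n * r) * (c₀ * r ^ 2) := mul_le_mul_of_nonneg_right h3 h4
          _ = n * (c₀ * r ^ 3) * (4 * E) := by ring
    _ = ∑ i ∈ Finset.range n, ENNReal.ofReal (c₀ * r ^ 3) := by
        rw [Finset.sum_const, Finset.card_range, nsmul_eq_mul,
          ENNReal.ofReal_mul (p := (n : ℝ)) (by positivity), ENNReal.ofReal_natCast]
    _ ≤ ∑ i ∈ Finset.range n, vol3 (Metric.ball (x i) r) :=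
        Finset.sum_le_sum fun i _ => hvol _ _ hr0 (by linarith)
    _ = vol3 (⋃ i ∈ Finset.range n, Metric.ball (x i) r) :=
        (measure_biUnion_finset hdisj fun i _ => measurableSet_ball).symm
    _ ≤ _ := measure_mono hsub

/-- `|z|^{-a}` is square integrable for `a < 1` if the tubes `{|z| < ρ}` have volume `O(ρ²)`. -/
lemma memLp_norm_rpow (hz : ContDiff ℝ ∞ z) {W : Set S3} (hW : IsOpen W) {C : ℝ}
    (h : ∀ ρ, 0 < ρ → vol3 (W ∩ {q : S3 | ‖z q‖ < ρ}) ≤ ENNReal.ofReal (C * ρ ^ 2)) {a : ℝ}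
    (ha : a ∈ Ioo (0 : ℝ) 1) : MemLp (fun q : S3 => ‖z q‖ ^ (-a)) 2 (vol3.restrict W) := by
  obtain ⟨ha0, ha1⟩ := ha
  have hm : Measurable fun q : S3 => ‖z q‖ ^ (-a) :=
    (continuous_coord hz).norm.measurable.pow_const _
  have hm2 : Measurable fun q : S3 => ‖z q‖ ^ (-(2 * a)) :=
    (continuous_coord hz).norm.measurable.pow_const _
  rw [memLp_two_iff_integrable_sq hm.aestronglyMeasurable]
  have e (q : S3) : (‖z q‖ ^ (-a)) ^ 2 = ‖z q‖ ^ (-(2 * a)) := by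
    rw [← Real.rpow_natCast, ← Real.rpow_mul (norm_nonneg _)]
    congr 1
    push_cast
    ring
  simp only [e]
  have hnn (q : S3) : 0 ≤ ‖z q‖ ^ (-(2 * a)) := Real.rpow_nonneg (norm_nonneg _) _
  refine ⟨hm2.aestronglyMeasurable, ?_⟩
  rw [hasFiniteIntegral_iff_ofReal (Eventually.of_forall hnn),
    lintegral_eq_lintegral_meas_lt _ (Eventually.of_forall hnn) hm2.aemeasurable,
    ← Ioc_union_Ioi_eq_Ioi (zero_le_one' ℝ)]
  refine (lintegral_union_le _ _ _).trans_lt (ENNReal.add_lt_top.2 ⟨?_, ?_⟩)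
  · calc ∫⁻ t in Ioc (0 : ℝ) 1, (vol3.restrict W) {q : S3 | t < ‖z q‖ ^ (-(2 * a))}
        ≤ ∫⁻ _ in Ioc (0 : ℝ) 1, vol3 univ :=
          lintegral_mono fun t => (Measure.restrict_apply_le _ _).trans (measure_mono (subset_univ _))
      _ < ⊤ := by
          rw [setLIntegral_const, Real.volume_Ioc]
          exact ENNReal.mul_lt_top (measure_lt_top _ _) ENNReal.ofReal_lt_top
  · have hb : ∀ t ∈ Ioi (1 : ℝ), (vol3.restrict W) {q : S3 | t < ‖z q‖ ^ (-(2 * a))} ≤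
        ENNReal.ofReal (C * t ^ (-(1 / a))) := by
      intro t ht
      have ht0 : (0 : ℝ) < t := zero_lt_one.trans ht
      rw [Measure.restrict_apply' hW.measurableSet]
      have hsub : {q : S3 | t < ‖z q‖ ^ (-(2 * a))} ∩ W ⊆
          W ∩ {q : S3 | ‖z q‖ < t ^ (-(1 / (2 * a)))} := by
        rintro q ⟨hq, hqW⟩
        refine ⟨hqW, ?_⟩
        have hq' : t < ‖z q‖ ^ (-(2 * a)) := hq
        have hz0 : 0 < ‖z q‖ := by
          rcases (norm_nonneg (z q)).eq_or_lt with h0 | h0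
          · rw [← h0, Real.zero_rpow (by linarith)] at hq'
            linarith
          · exact h0
        have h1 := Real.rpow_lt_rpow_of_neg ht0 hq'
          (neg_lt_zero.2 (by positivity : 0 < 1 / (2 * a)))
        rw [← Real.rpow_mul hz0.le] at h1
        have h2 : -(2 * a) * -(1 / (2 * a)) = 1 := by field_simp
        rwa [h2, Real.rpow_one] at h1
      refine (measure_mono hsub).trans ((h _ (Real.rpow_pos_of_pos ht0 _)).trans_eq ?_)
      rw [← Real.rpow_natCast, ← Real.rpow_mul ht0.le]
      congr 3
      push_cast
      field_simp
    refine (setLIntegral_mono' measurableSet_Ioi hb).trans_lt ?_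
    have hint : IntegrableOn (fun t : ℝ => C * t ^ (-(1 / a))) (Ioi 1) := by
      refine (integrableOn_Ioi_rpow_of_lt ?_ one_pos).const_mul C
      rw [neg_lt_neg_iff]
      exact (one_lt_div ha0).2 ha1
    exact hint.lintegral_lt_top
end

/-! ### Spinors which are singular along the boundary -/

/-- The spinor field `z^c s`. -/
def sing (c : ℝ) (z : E4 → ℂ) (s : E4 → Spinor) (p : S3) : Spinor := (z p) ^ (c : ℂ) • s p

/-- The derivative `X_j(z^c s)`, off the branch cut of `z^c`. -/
def dSing (c : ℝ) (z : E4 → ℂ) (s : E4 → Spinor) (j : Fin 3) (p : S3) : Spinor :=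
  (z p) ^ (c : ℂ) • (dX j s p + (c * dX j z p / z p) • s p)

lemma hasDerivAt_cpow_comp {f : ℝ → ℂ} {f' c : ℂ} {t : ℝ} (hf : HasDerivAt f f' t)
    (h : f t ∈ Complex.slitPlane) :
    HasDerivAt (fun t => f t ^ c) (f t ^ c * (c * f' / f t)) t := by
  have h0 : f t ≠ 0 := Complex.slitPlane_ne_zero h
  have h1 : HasDerivAt (fun y : ℂ => y ^ c) (c * f t ^ (c - 1) * 1) (f t) :=
    (hasDerivAt_id (f t)).cpow_const h
  have h2 := (h1.hasFDerivAt.restrictScalars ℝ).comp_hasDerivAt t hf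
  refine h2.congr_deriv ?_
  simp only [ContinuousLinearMap.coe_restrictScalars', ContinuousLinearMap.toSpanSingleton_apply,
    smul_eq_mul]
  rw [Complex.cpow_sub _ _ h0, Complex.cpow_one]
  field_simp

lemma contDiffAt_cpow {f : E4 → ℂ} (hf : ContDiff ℝ ∞ f) {c : ℂ} {x : E4}
    (h : f x ∈ Complex.slitPlane) : ContDiffAt ℝ ∞ (fun y => f y ^ c) x := by
  have h1 : ContDiffAt ℝ ∞ Complex.log (f x) :=
    (Complex.contDiffAt_log h).restrict_scalars ℝ
  have h2 : ContDiffAt ℝ ∞ (fun y => Complex.exp (Complex.log (f y) * c)) x :=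
    ((h1.comp x hf.contDiffAt).mul contDiffAt_const).cexp
  refine h2.congr_of_eventuallyEq ?_
  filter_upwards [hf.continuous.continuousAt.preimage_mem_nhds
    (Complex.isOpen_slitPlane.mem_nhds h)] with y hy
  exact Complex.cpow_def_of_ne_zero (Complex.slitPlane_ne_zero hy) c

/-- Where, in the gauge `u`, the power `z^c` agrees with a smooth branch `κ (τz)^c`, the spinor
`z^c s` is locally in `H¹`. -/
lemma exists_gaugeH1_sing {c : ℝ} {z : E4 → ℂ} {s : E4 → Spinor} (hz : ContDiff ℝ ∞ z)
    (hs : ContDiff ℝ ∞ s) {q : S3} {τ κ : ℂ} (hτ : τ * z q ∈ Complex.slitPlane) {u : S3 → ℂ}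
    {U : Set S3} (hU : IsOpen U) (hqU : q ∈ U)
    (hu : ∀ᵐ p : S3 ∂vol3, p ∈ U → u p * z p ^ (c : ℂ) = κ * (τ * z p) ^ (c : ℂ)) {v : L2}
    (hv : v =ᵐ[vol3] sing c z s) :
    ∃ U', IsOpen U' ∧ q ∈ U' ∧ U' ⊆ U ∧ GaugeH1 U' u v (dSing c z s) := by
  have hτz : ContDiff ℝ ∞ fun x => τ * z x := contDiff_const.mul hz
  have hτ0 : τ ≠ 0 := fun h => Complex.slitPlane_ne_zero hτ (by rw [h, zero_mul])
  obtain ⟨r, hr, hball⟩ := Metric.isOpen_iff.1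
    (Complex.isOpen_slitPlane.preimage hτz.continuous) (q : E4) hτ
  let ζ : ContDiffBump (q : E4) := ⟨r / 4, r / 2, by positivity, by linarith⟩
  set w : E4 → Spinor := fun x => ζ x • (κ * (τ * z x) ^ (c : ℂ)) • s x with hw
  have hwc : ContDiff ℝ ∞ w := by
    rw [contDiff_iff_contDiffAt]
    intro x
    by_cases hx : x ∈ tsupport ζ
    · have hx' : x ∈ Metric.ball (q : E4) r := by
        rw [ζ.tsupport_eq] at hx
        exact Metric.closedBall_subset_ball (by simp only [ζ]; linarith) hx
      exact ζ.contDiff.contDiffAt.smul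
        ((contDiffAt_const.mul (contDiffAt_cpow hτz (hball hx'))).smul hs.contDiffAt)
    · have : w =ᶠ[𝓝 x] fun _ => 0 := by
        filter_upwards [(isClosed_tsupport ζ).isOpen_compl.mem_nhds hx] with y hy
        simp only [hw, image_eq_zero_of_notMem_tsupport hy, zero_smul]
      exact contDiffAt_const.congr_of_eventuallyEq this
  have hζ1 (x : E4) (hx : x ∈ Metric.ball (q : E4) (r / 4)) : ζ x = 1 :=
    ζ.one_of_mem_closedBall (Metric.ball_subset_closedBall hx)
  have hdw (p : S3) (hp : (p : E4) ∈ Metric.ball (q : E4) (r / 4)) (j : Fin 3) : dX j w p =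
      (κ * (τ * z p) ^ (c : ℂ)) • (dX j s p + (c * dX j z p / z p) • s p) := by
    have hslit : τ * z (rot j 0 p) ∈ Complex.slitPlane := by
      rw [rot_zero]
      exact hball (Metric.ball_subset_ball (by linarith) hp)
    refine dX_eq_of_hasDerivAt hwc ?_
    have d1 : HasDerivAt (fun t => τ * z (rot j t p)) (τ * dX j z p) 0 :=
      (hasDerivAt_rot_zero hz j p).const_mul τ
    have d2 := (((hasDerivAt_cpow_comp (c := c) d1 hslit).const_mul κ).smul
      (hasDerivAt_rot_zero hs j p))
    have hev : (fun t => w (rot j t p)) =ᶠ[𝓝 0]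
        fun t => (κ * (τ * z (rot j t p)) ^ (c : ℂ)) • s (rot j t p) := by
      have hc : ContinuousAt (fun t => rot j t p) 0 := (hasDerivAt_rot j p 0).continuousAt
      have := hc.preimage_mem_nhds (t := Metric.ball (q : E4) (r / 4))
        (Metric.isOpen_ball.mem_nhds (by rwa [rot_zero]))
      filter_upwards [this] with t ht
      simp only [hw]
      rw [hζ1 _ ht, one_smul]
    have d3 := HasDerivAt.congr_of_eventuallyEq d2 hev
    refine d3.congr_deriv ?_
    rw [rot_zero] at *
    rw [smul_add, smul_smul]
    congr 2
    have hz0 : z p ≠ 0 := fun h => Complex.slitPlane_ne_zero hslit (by rw [h, mul_zero])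
    field_simp
  refine ⟨U ∩ {p : S3 | (p : E4) ∈ Metric.ball (q : E4) (r / 4)},
    hU.inter (Metric.isOpen_ball.preimage continuous_subtype_val),
    ⟨hqU, Metric.mem_ball_self (by positivity)⟩, inter_subset_left, toL2 w hwc.continuous,
    fun j => toL2 (dX j w) (contDiff_dX hwc).continuous, fun j => ?_, ?_⟩
  · exact (weakDeriv_of_contDiff univ j hwc).congr_ae (coeFn_toL2 hwc.continuous).symm
      (coeFn_toL2 (contDiff_dX hwc).continuous).symm
  · filter_upwards [hu, hv, coeFn_toL2 hwc.continuous,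
      ae_all_iff.2 fun j => coeFn_toL2 (contDiff_dX (j := j) hwc).continuous] with p h1 h2 h3 h4 hp
    refine ⟨?_, fun j => ?_⟩
    · rw [h3, h2, sing, smul_smul, h1 hp.1, hw]
      simp only
      rw [hζ1 p hp.2, one_smul]
    · rw [h4, hdw p hp.2, dSing, smul_smul, h1 hp.1]

/-- The jump of `z^{-a}` across the branch cut is compensated by the gauge factor. -/
lemma phase_mul_cpow (a : ℝ) {z : ℂ} (hz : z.im ≠ 0) :
    phase a z.im * z ^ ((-a : ℝ) : ℂ) =
      Complex.exp (Complex.I * Real.pi * a) * (-1 * z) ^ ((-a : ℝ) : ℂ) := by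
  have hz0 : z ≠ 0 := fun h => hz (by rw [h, Complex.zero_im])
  have hn0 : -1 * z ≠ 0 := by simpa using hz0
  rw [Complex.cpow_def_of_ne_zero hz0, Complex.cpow_def_of_ne_zero hn0, neg_one_mul, Complex.log,
    Complex.log, norm_neg, phase]
  rcases lt_or_gt_of_ne hz with h | h
  · rw [if_neg h.le.not_gt, Complex.arg_neg_eq_arg_add_pi_of_im_neg h, one_mul, ← Complex.exp_add]
    congr 1
    push_cast
    ring
  · rw [if_pos h, Complex.arg_neg_eq_arg_sub_pi_of_im_pos h, ← Complex.exp_add, ← Complex.exp_add]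
    congr 1
    push_cast
    ring

/-- The Clifford relations, for a complex vector `A`. -/
lemma sum_smul_pauliOp_sq (A : Fin 3 → ℂ) (ξ : Spinor) :
    ∑ j, A j • pauliOp j (∑ k, A k • pauliOp k ξ) = (∑ j, A j ^ 2) • ξ := by
  have hI := Complex.I_sq
  ext i
  fin_cases i <;>
    simp [pauliOp_apply, pauli, Fin.sum_univ_three]
  · linear_combination (-(A 1) ^ 2 * ξ 0) * hI
  · linear_combination (-(A 1) ^ 2 * ξ 1) * hI

lemma exists_sum_smul_pauliOp_ne_zero {A : Fin 3 → ℂ} (hA : A ≠ 0) :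
    ∃ ξ : Spinor, ∑ k, A k • pauliOp k ξ ≠ 0 := by
  by_contra! h
  refine hA (funext fun j => ?_)
  have h1 := h (WithLp.toLp 2 ![1, 0])
  have h2 := h (WithLp.toLp 2 ![0, 1])
  have e1 := congrArg (fun x : Spinor => x 0) h1
  have e2 := congrArg (fun x : Spinor => x 1) h1
  have e3 := congrArg (fun x : Spinor => x 0) h2
  simp [pauliOp_apply, pauli, Fin.sum_univ_three] at e1 e2 e3
  fin_cases j
  · simp only [Fin.zero_eta, Pi.zero_apply]
    linear_combination (e2 + e3) / 2
  · simp only [Fin.mk_one, Pi.zero_apply]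
    linear_combination (-Complex.I / 2) * (e2 - e3) + A 1 * Complex.I_sq
  · exact e1

lemma norm_cpow_smul (c : ℝ) (z : ℂ) (m : Spinor) : ‖z ^ (c : ℂ) • m‖ = ‖z‖ ^ c * ‖m‖ := by
  rw [norm_smul, Complex.norm_cpow_real]

lemma measurable_cpow_coord {z : E4 → ℂ} (hz : ContDiff ℝ ∞ z) (c : ℂ) :
    Measurable fun q : S3 => z q ^ c :=
  (continuous_coord hz).measurable.pow_const c

lemma memLp_cpow_smul {c : ℝ} {z : E4 → ℂ} (hz : ContDiff ℝ ∞ z) {V : Set S3} (hV : IsOpen V)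
    (h : MemLp (fun q : S3 => ‖z q‖ ^ c) 2 (vol3.restrict V)) {m : S3 → Spinor}
    (hm : Measurable m) {C : ℝ} (hC : ∀ q, ‖m q‖ ≤ C) (h0 : ∀ q ∉ V, m q = 0) :
    MemLp (fun q : S3 => z q ^ (c : ℂ) • m q) 2 vol3 := by
  have h1 := (memLp_indicator_iff_restrict hV.measurableSet).2 h
  refine h1.of_le_mul (c := C)
    ((measurable_cpow_coord hz c).smul hm).aestronglyMeasurable (Eventually.of_forall fun q => ?_)
  rw [norm_cpow_smul]
  by_cases hq : q ∈ V
  · rw [indicator_of_mem hq, Real.norm_of_nonneg (Real.rpow_nonneg (norm_nonneg _) _), mul_comm]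
    exact mul_le_mul_of_nonneg_right (hC q) (Real.rpow_nonneg (norm_nonneg _) _)
  · rw [h0 q hq, indicator_of_notMem hq]
    simp

lemma exists_bound_sphere {V : Type*} [NormedAddCommGroup V] {f : E4 → V} (hf : Continuous f) :
    ∃ C, 0 ≤ C ∧ ∀ q : S3, ‖f q‖ ≤ C := by
  obtain ⟨C, hC⟩ := isCompact_univ.exists_bound_of_continuousOn
    (hf.comp continuous_subtype_val : Continuous fun q : S3 => f q).continuousOn
  exact ⟨max C 0, le_max_right _ _, fun q => (hC q (mem_univ q)).trans (le_max_left _ _)⟩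

/-- Weak derivatives are local. -/
lemma WeakDeriv.ae_eq {U : Set S3} (hU : IsOpen U) {j : Fin 3} {ψ ψ' g g' : L2}
    (h : WeakDeriv U j ψ g) (h' : WeakDeriv U j ψ' g')
    (heq : ∀ᵐ p ∂vol3, p ∈ U → ψ p = ψ' p) : ∀ᵐ p ∂vol3, p ∈ U → g p = g' p := by
  set d : L2 := ((Lp.memLp (g - g')).indicator hU.measurableSet).toLp _ with hd
  have hdae : d =ᵐ[vol3] U.indicator (g - g' : L2) := MemLp.coeFn_toLp _
  have key : HasWeakDeriv U j 0 d := by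
    refine ⟨?_, fun f hf => ?_⟩
    · filter_upwards [hdae] with p hp hpU
      rw [hp, indicator_of_notMem hpU]
    · have e0 : ∫ p in U, frameDeriv j f p • (0 : L2) p ∂vol3 = 0 := by
        rw [integral_eq_zero_of_ae]
        filter_upwards [ae_restrict_of_ae (Lp.coeFn_zero Spinor 2 vol3)] with p hp
        rw [hp]
        simp only [Pi.zero_apply, smul_zero]
      rw [e0, neg_zero, setIntegral_eq_integral_of_forall_compl_eq_zero fun p hp => by
        rw [hf.eq_zero hp, zero_smul]]
      have i1 : Integrable (fun p : S3 => f p • g p + dX j f p • ψ p) vol3 :=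
        (integrable_smoothSmul hf.1 (L2_integrable g)).add
          (integrable_dXSmul hf.1 (L2_integrable ψ))
      have i2 : Integrable (fun p : S3 => f p • g' p + dX j f p • ψ' p) vol3 :=
        (integrable_smoothSmul hf.1 (L2_integrable g')).add
          (integrable_dXSmul hf.1 (L2_integrable ψ'))
      have e1 := integral_sub i1 i2
      rw [h f hf, h' f hf, sub_zero] at e1
      rw [← e1]
      refine integral_congr_ae ?_
      filter_upwards [hdae, Lp.coeFn_sub g g', heq] with p h1 h2 h3
      by_cases hp : p ∈ U
      · rw [h1, indicator_of_mem hp, h2, h3 hp, Pi.sub_apply, smul_sub, add_sub_add_right_eq_sub]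
      · rw [hf.eq_zero hp, hf.dX_eq_zero j hp]
        simp
  have h0 : d =ᵐ[vol3] 0 := by
    rw [key.eq_zero hU]
    exact Lp.coeFn_zero _ _ _
  filter_upwards [hdae, h0, Lp.coeFn_sub g g'] with p h1 h2 h3 hp
  rw [h2, indicator_of_mem hp, h3] at h1
  exact (sub_eq_zero.1 h1.symm)

lemma WeakDeriv.mono {U U' : Set S3} (hU : U' ⊆ U) {j : Fin 3} {V : Type*} [NormedAddCommGroup V]
    [NormedSpace ℝ V] {F G : S3 → V} (h : WeakDeriv U j F G) : WeakDeriv U' j F G :=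
  fun f hf => h f (hf.mono hU)

lemma IsBoundaryCoordinate.mono {S : OrientedSurface} {V V' : Set S3} {z : E4 → ℂ} (hV : V' ⊆ V)
    (H : IsBoundaryCoordinate S V z) : IsBoundaryCoordinate S V' z :=
  ⟨H.smooth, fun q hq => H.mem_iff q (hV hq), H.localEquation.mono
    fun q (hq : q ∈ V' ∧ (z q).re < 0) => show q ∈ V ∧ (z q).re < 0 from ⟨hV hq.1, hq.2⟩,
   
    fun q hq => H.mem_boundary q (hV hq), fun q hq => H.isotropic q (hV hq)⟩

/-- The square of the complex gradient of `z` vanishes on the knot, hence is `O(|z|)`. -/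
lemma IsBoundaryCoordinate.exists_isotropic_le {S : OrientedSurface} {V : Set S3} {z : E4 → ℂ}
    {p : S3} (hV : IsOpen V) (hpV : p ∈ V) (H : IsBoundaryCoordinate S V z) (hzp : z p = 0)
    (hsurj : ∀ ζ : ℂ, ∃ v : E4, inner ℝ (p : E4) v = 0 ∧ fderiv ℝ z p v = ζ) :
    ∃ C, 0 ≤ C ∧ ∃ W, IsOpen W ∧ p ∈ W ∧ ∀ q ∈ W, ‖∑ j, dX j z q ^ 2‖ ≤ C * ‖z q‖ := by
  have hn : ContDiff ℝ ∞ fun x : E4 => ∑ j, dX j z x ^ 2 :=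
    ContDiff.sum fun j _ => (contDiff_dX H.smooth).pow 2
  obtain ⟨L, s, hs, hLip⟩ := (hn.contDiffAt (x := (p : E4)) |>.of_le
    (by exact_mod_cast le_top : (1 : WithTop ℕ∞) ≤ ∞)).exists_lipschitzOnWith
  obtain ⟨ε, hε, hball⟩ := Metric.mem_nhds_iff.1 hs
  obtain ⟨C, hC, W, hW, hpW, hnear⟩ := exists_boundary_near hV hpV H hzp hsurj hε
  refine ⟨L * C, by positivity, W ∩ Metric.ball p ε, hW.inter Metric.isOpen_ball,
    ⟨hpW, Metric.mem_ball_self hε⟩, fun q hq => ?_⟩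
  obtain ⟨q', hq'V, hzq', hq'p, hq'q⟩ := hnear q hq.1
  have h1 := hLip.dist_le_mul (q : E4) (hball hq.2) (q' : E4) (hball hq'p)
  rw [H.isotropic q' hq'V hzq', dist_zero_right] at h1
  calc _ ≤ L * dist (q : E4) q' := h1
    _ ≤ L * (C * ‖z q‖) := by
        refine mul_le_mul_of_nonneg_left ?_ L.2
        rw [dist_comm]
        exact hq'q
    _ = _ := by ring

lemma exists_dX_coord_ne_zero {z : E4 → ℂ} {p : S3}
    (hsurj : ∀ ζ : ℂ, ∃ v : E4, inner ℝ (p : E4) v = 0 ∧ fderiv ℝ z p v = ζ) :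
    ∃ j, dX j z p ≠ 0 := by
  by_contra! h
  obtain ⟨v, hv, hv'⟩ := hsurj 1
  rw [eq_sum_frame p hv, map_sum] at hv'
  refine zero_ne_one (α := ℂ) (hv' ▸ (Finset.sum_eq_zero fun j _ => ?_).symm)
  rw [map_smul]
  exact (congrArg _ (h j)).trans (smul_zero _)

/-- `1/|z|` is not square integrable near a point where `z` is a submersion to `ℂ`. -/
lemma false_of_le_mul_norm {z : E4 → ℂ} {p : S3} (hz : ContDiff ℝ ∞ z) (hzp : z p = 0)
    (hsurj : ∀ ζ : ℂ, ∃ v : E4, inner ℝ (p : E4) v = 0 ∧ fderiv ℝ z p v = ζ) {N : Set S3}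
    (hN : IsOpen N) (hpN : p ∈ N) {C : ℝ}
    (htube : ∀ ρ, 0 < ρ → vol3 (N ∩ {q : S3 | ‖z q‖ < ρ}) ≤ ENNReal.ofReal (C * ρ ^ 2))
    {c₁ : ℝ} (hc₁ : 0 < c₁) {g : L2} (hg : ∀ᵐ q ∂vol3, q ∈ N → c₁ ≤ ‖z q‖ * ‖g q‖) : False := by
  obtain ⟨c, hc, ρ₀, hρ₀, hlow⟩ := exists_le_vol3_tube hz hzp hsurj hN hpN
  have hfin : ∫⁻ q, ‖g q‖ₑ ^ 2 ∂vol3 ≠ ⊤ := by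
    have := (Lp.memLp g).eLpNorm_lt_top
    have h2 := lintegral_rpow_enorm_lt_top_of_eLpNorm_lt_top (by norm_num) (by norm_num) this
    simpa using h2.ne
  set E : ℝ → Set S3 := fun ρ => N ∩ {q : S3 | ‖z q‖ < ρ} with hE
  have hEm (ρ : ℝ) : MeasurableSet (E ρ) := (hN.inter
    (isOpen_lt (continuous_coord hz).norm continuous_const)).measurableSet
  have hzero : Tendsto (fun ρ : ℝ => vol3 (E ρ)) (𝓝[>] 0) (𝓝 0) := by
    have h1 : Tendsto (fun ρ : ℝ => ENNReal.ofReal (C * ρ ^ 2)) (𝓝[>] 0) (𝓝 0) := by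
      have : Tendsto (fun ρ : ℝ => C * ρ ^ 2) (𝓝[>] 0) (𝓝 (C * 0 ^ 2)) :=
        (Continuous.tendsto (by fun_prop) 0).mono_left nhdsWithin_le_nhds
      have h2 := (ENNReal.continuous_ofReal.tendsto _).comp this
      rwa [zero_pow two_ne_zero, mul_zero, ENNReal.ofReal_zero] at h2
    refine tendsto_of_tendsto_of_tendsto_of_le_of_le' tendsto_const_nhds h1
      (Eventually.of_forall fun _ => zero_le) ?_
    filter_upwards [self_mem_nhdsWithin] with ρ hρ
    exact htube ρ hρ
  have hlim := tendsto_setLIntegral_zero hfin hzero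
  have hpos : 0 < ENNReal.ofReal (c₁ ^ 2 * c) := ENNReal.ofReal_pos.2 (by positivity)
  have hev := (hlim.eventually (gt_mem_nhds hpos)).and
    (Ioo_mem_nhdsGT hρ₀)
  obtain ⟨ρ, hlt, hρ⟩ := hev.exists
  refine hlt.not_ge ?_
  have hρ0 : 0 < ρ := hρ.1
  calc ENNReal.ofReal (c₁ ^ 2 * c)
      = ENNReal.ofReal ((c₁ / ρ) ^ 2) * ENNReal.ofReal (c * ρ ^ 2) := by
        rw [← ENNReal.ofReal_mul (by positivity)]
        congr 1
        field_simp
    _ ≤ ENNReal.ofReal ((c₁ / ρ) ^ 2) * vol3 (E ρ) := by gcongr; exact hlow ρ hρ.1 hρ.2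
    _ = ∫⁻ _ in E ρ, ENNReal.ofReal ((c₁ / ρ) ^ 2) ∂vol3 := by rw [setLIntegral_const]
    _ ≤ ∫⁻ q in E ρ, ‖g q‖ₑ ^ 2 ∂vol3 := by
        refine setLIntegral_mono_ae' (hEm ρ) ?_
        filter_upwards [hg] with q hq hqE
        have h1 := hq hqE.1
        have hzq : ‖z q‖ < ρ := hqE.2
        have h2 : c₁ / ρ ≤ ‖g q‖ := by
          rw [div_le_iff₀ hρ0, mul_comm]
          exact h1.trans (mul_le_mul_of_nonneg_right hzq.le (norm_nonneg _))
        rw [← ofReal_norm, ENNReal.ofReal_pow (by positivity)]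
        gcongr

/-- Near a point where `z` vanishes to first order and `s` does not vanish, some derivative of
`z^c s` is at least of the order `1/|z|` if `c < 0`. -/
lemma exists_le_dSing {c : ℝ} (hc : c < 0) {z : E4 → ℂ} (hz : ContDiff ℝ ∞ z) {s : E4 → Spinor}
    (hs : ContDiff ℝ ∞ s) {p : S3} (hzp : z p = 0) (hsp : s p ≠ 0) {j : Fin 3}
    (hj : dX j z p ≠ 0) : ∃ c₁ > 0, ∃ N, IsOpen N ∧ p ∈ N ∧
      ∀ q ∈ N, z q ≠ 0 → c₁ ≤ ‖z q‖ * ‖dSing c z s j q‖ := by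
  set Φ : S3 → ℝ := fun q => ‖z q • dX j s q + (c * dX j z q) • s q‖ with hΦ
  have hΦc : Continuous Φ := by
    have h1 : Continuous fun q : S3 => dX j s q :=
      (contDiff_dX hs).continuous.comp continuous_subtype_val
    have h2 : Continuous fun q : S3 => dX j z q :=
      (contDiff_dX hz).continuous.comp continuous_subtype_val
    have h3 : Continuous fun q : S3 => s q := hs.continuous.comp continuous_subtype_val
    exact (((continuous_coord hz).smul h1).add ((continuous_const.mul h2).smul h3)).norm
  have hΦp : 0 < Φ p := by
    simp only [hΦ, hzp, zero_smul, zero_add]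
    rw [norm_pos_iff]
    exact smul_ne_zero (mul_ne_zero (Complex.ofReal_ne_zero.2 hc.ne) hj) hsp
  refine ⟨Φ p / 2, by positivity, {q | Φ p / 2 < Φ q} ∩ {q : S3 | ‖z q‖ < 1},
    (isOpen_lt continuous_const hΦc).inter
      (isOpen_lt (continuous_coord hz).norm continuous_const), ⟨?_, ?_⟩, fun q hq hzq => ?_⟩
  · show Φ p / 2 < Φ p
    linarith
  · show ‖z p‖ < 1
    rw [hzp, norm_zero]
    exact one_pos
  · have h1 : Φ p / 2 < Φ q := hq.1
    have h2 : ‖z q‖ < 1 := hq.2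
    have h3 : 1 ≤ ‖z q‖ ^ c :=
      Real.one_le_rpow_of_pos_of_le_one_of_nonpos (norm_pos_iff.2 hzq) h2.le hc.le
    have h4 : ‖z q‖ * ‖dX j s q + (c * dX j z q / z q) • s q‖ = Φ q := by
      rw [← norm_smul, smul_add, smul_smul, mul_div_cancel₀ _ hzq]
    rw [dSing, norm_cpow_smul]
    calc Φ p / 2 ≤ 1 * Φ q := by linarith
      _ ≤ ‖z q‖ ^ c * Φ q := mul_le_mul_of_nonneg_right h3 (norm_nonneg _)
      _ = _ := by rw [← h4]; ring

variable {K : ℕ} {S : Fin K → OrientedSurface} {α : Fin K → ℝ}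

/-- The data of a singular spinor `z^{-a} s` concentrated near the point `p` of the knot `∂S_k`: `z`
is a boundary coordinate of `S_k` on the neighbourhood `V` of `p`, which is disjoint from the other
surfaces, and `s` is a spinor with support in `V` and `s(p) ≠ 0`, such that
`σ · ∇(z^{-a} s) = O(|z|^{-a})`. -/
structure IsSingularAnsatz (S : Fin K → OrientedSurface) (k : Fin K) (p : S3) (V : Set S3) (a : ℝ)
    (z : E4 → ℂ) (s : E4 → Spinor) : Prop where
  isOpen : IsOpen V
  mem : p ∈ V
  disjoint : ∀ l ≠ k, Disjoint V (S l).carrier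
  coord : IsBoundaryCoordinate (S k) V z
  coord_eq_zero : z p = 0
  surjective : ∀ ζ : ℂ, ∃ v : E4, inner ℝ (p : E4) v = 0 ∧ fderiv ℝ z p v = ζ
  tube : ∃ C : ℝ, ∀ ρ, 0 < ρ → vol3 (V ∩ {q : S3 | ‖z q‖ < ρ}) ≤ ENNReal.ofReal (C * ρ ^ 2)
  smooth : ContDiff ℝ ∞ s
  support : tsupport (fun q : S3 => s q) ⊆ V
  ne_zero : s p ≠ 0
  slash_le : ∃ C : ℝ, ∀ q : S3,
    ‖slash fun j => dX j s q + ((-a : ℝ) * dX j z q / z q) • s q‖ ≤ C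

/-- Take `s = ∑_j (X_j z) σ_j ξ` near `p`. Then `∑_j (X_j z) σ_j s = ∑_j (X_j z)² ξ = O(|z|)`, which
cancels the leading singularity of `σ · ∇(z^{-a} s)`. -/
theorem exists_isSingularAnsatz (hS : IsSeifertFamily S) {k : Fin K} {p : S3}
    (hp : p ∈ (S k).boundary) (hother : ∀ l ≠ k, p ∉ (S l).carrier) {O : Set S3} (hO : IsOpen O)
    (hpO : p ∈ O) (a : ℝ) : ∃ V ⊆ O, ∃ z s, IsSingularAnsatz S k p V a z s := by
  obtain ⟨V₀, z, hV₀, hpV₀, H, hzp, hsurj⟩ := exists_boundaryCoordinate hp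
  obtain ⟨C₁, hC₁, W₁, hW₁, hpW₁, htube⟩ :=
    exists_vol3_tube_le (hS.knot k).hasSmallTubes hV₀ hpV₀ H hzp hsurj
  obtain ⟨C₂, hC₂, W₂, hW₂, hpW₂, hiso⟩ := H.exists_isotropic_le hV₀ hpV₀ hzp hsurj
  obtain ⟨j₀, hj₀⟩ := exists_dX_coord_ne_zero hsurj
  obtain ⟨ξ, hξ⟩ := exists_sum_smul_pauliOp_ne_zero (A := fun j => dX j z p)
    fun h => hj₀ (congrFun h j₀)
  set V := V₀ ∩ W₁ ∩ W₂ ∩ O ∩ ⋂ l ∈ {l | l ≠ k}, (S l).carrierᶜ with hV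
  have hVo : IsOpen V := (((hV₀.inter hW₁).inter hW₂).inter hO).inter
    (isOpen_biInter_finset (s := Finset.univ.filter (· ≠ k)) (fun l _ =>
      (S l).isCompact.isClosed.isOpen_compl) |> fun h => by simpa using h)
  have hpV : p ∈ V := ⟨⟨⟨⟨hpV₀, hpW₁⟩, hpW₂⟩, hpO⟩, mem_iInter₂.2 hother⟩
  obtain ⟨f, hf, hf01, hf1⟩ := exists_test_eq_one (isClosed_singleton (x := p)) hVo
    (singleton_subset_iff.2 hpV)
  rw [nhdsSet_singleton] at hf1
  have hz := H.smooth
  set t : E4 → Spinor := fun x => ∑ j, dX j z x • pauliOp j ξ with ht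
  have htc : ContDiff ℝ ∞ t := ContDiff.sum fun j _ => (contDiff_dX hz).smul contDiff_const
  set s : E4 → Spinor := fun x => (f x : ℂ) • t x with hs
  have hsc : ContDiff ℝ ∞ s := (Complex.ofRealCLM.contDiff.comp hf.1).smul htc
  obtain ⟨C₃, hC₃, hbd⟩ := exists_bound_sphere
    (contDiff_slash (s := fun j => dX j s) fun j => contDiff_dX hsc).continuous
  refine ⟨V, fun q hq => hq.1.2, z, s, ⟨hVo, hpV, fun l hl => disjoint_left.2 fun q hq =>
    mem_iInter₂.1 hq.2 l hl, H.mono fun q hq => hq.1.1.1.1, hzp, hsurj,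
    ⟨C₁, fun ρ hρ => (measure_mono
      (inter_subset_inter_left _ fun q hq => hq.1.1.1.2)).trans (htube ρ hρ)⟩, hsc,
    ?_, ?_, ⟨C₃ + |a| * C₂ * ‖ξ‖, fun q => ?_⟩⟩⟩
  · refine (closure_mono fun q hq => ?_).trans hf.2
    intro h
    have h' : f q = 0 := h
    exact hq (by simp [hs, h'])
  · simp only [hs]
    rw [hf1.self_of_nhds, Complex.ofReal_one, one_smul]
    exact hξ
  · have e : (slash fun j => dX j s q + ((-a : ℝ) * dX j z q / z q) • s q) =
        (slash fun j => dX j s q) + ((-a : ℝ) / z q * f q * ∑ j, dX j z q ^ 2) • ξ := by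
      have ht2 : ∑ j, dX j z q • pauliOp j (t q) = (∑ j, dX j z q ^ 2) • ξ :=
        sum_smul_pauliOp_sq (fun j => dX j z q) ξ
      have hsq : s q = (f q : ℂ) • t q := rfl
      rw [mul_smul, ← ht2, Finset.smul_sum, hsq]
      simp only [slash, map_add, Finset.sum_add_distrib, map_smul, smul_smul]
      congr 1
      refine Finset.sum_congr rfl fun j _ => ?_
      congr 1
      ring
    rw [e]
    refine (norm_add_le _ _).trans (add_le_add (hbd q) ?_)
    rw [norm_smul]
    refine mul_le_mul_of_nonneg_right ?_ (norm_nonneg _)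
    by_cases hq : q ∈ V
    · have h1 := hiso q hq.1.1.2
      have h2 : ‖(f q : ℂ)‖ ≤ 1 := by
        rw [Complex.norm_real, Real.norm_of_nonneg (hf01 q).1]
        exact (hf01 q).2
      rw [norm_mul, norm_mul, norm_div, Complex.norm_real, norm_neg, Real.norm_eq_abs]
      calc |a| / ‖z q‖ * ‖(f q : ℂ)‖ * ‖∑ j, dX j z q ^ 2‖
          ≤ |a| / ‖z q‖ * 1 * (C₂ * ‖z q‖) := by gcongr
        _ = |a| * C₂ * (‖z q‖ / ‖z q‖) := by ring
        _ ≤ |a| * C₂ * 1 := by gcongr; exact div_self_le_one _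
        _ = _ := mul_one _
    · rw [hf.eq_zero hq]
      simp only [Complex.ofReal_zero, mul_zero, zero_mul, norm_zero]
      positivity

namespace IsSingularAnsatz

variable {k : Fin K} {p : S3} {V : Set S3} {a : ℝ} {z : E4 → ℂ} {s : E4 → Spinor}

lemma eq_zero (H : IsSingularAnsatz S k p V a z s) {q : S3} (hq : q ∉ V) : s q = 0 :=
  image_eq_zero_of_notMem_tsupport (f := fun q : S3 => s q) fun h => hq (H.support h)

lemma dX_eq_zero (H : IsSingularAnsatz S k p V a z s) {q : S3}
    (hq : q ∉ tsupport fun q : S3 => s q) (j : Fin 3) : dX j s q = 0 :=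
  MagneticLink.dX_eq_zero (H.smooth.differentiable (by simp)).differentiableAt hq

lemma memLp_norm_rpow (H : IsSingularAnsatz S k p V a z s) (ha : a ∈ Ioo (0 : ℝ) 1) :
    MemLp (fun q : S3 => ‖z q‖ ^ (-a)) 2 (vol3.restrict V) := by
  obtain ⟨C, hC⟩ := H.tube
  exact MagneticLink.memLp_norm_rpow H.coord.smooth H.isOpen hC ha

lemma memLp_sing (H : IsSingularAnsatz S k p V a z s) (ha : a ∈ Ioo (0 : ℝ) 1) :
    MemLp (sing (-a) z s) 2 vol3 := by
  obtain ⟨C, -, hC⟩ := exists_bound_sphere H.smooth.continuous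
  exact memLp_cpow_smul H.coord.smooth H.isOpen (H.memLp_norm_rpow ha)
    (H.smooth.continuous.comp continuous_subtype_val).measurable hC fun q hq => H.eq_zero hq

lemma memLp_slash (H : IsSingularAnsatz S k p V a z s) (ha : a ∈ Ioo (0 : ℝ) 1) :
    MemLp (fun q => slash fun j => dSing (-a) z s j q) 2 vol3 := by
  obtain ⟨C, hC⟩ := H.slash_le
  have e : (fun q => slash fun j => dSing (-a) z s j q) = fun q : S3 =>
      z q ^ ((-a : ℝ) : ℂ) • slash fun j => dX j s q + ((-a : ℝ) * dX j z q / z q) • s q := by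
    funext q
    rw [← slash_smul]
    rfl
  rw [e]
  refine memLp_cpow_smul H.coord.smooth H.isOpen (H.memLp_norm_rpow ha) ?_ hC fun q hq => ?_
  · refine continuous_slash.measurable.comp (measurable_pi_lambda _ fun j => ?_)
    have h1 : Measurable fun q : S3 => dX j s q :=
      ((contDiff_dX H.smooth).continuous.comp continuous_subtype_val).measurable
    have h2 : Measurable fun q : S3 => dX j z q :=
      ((contDiff_dX H.coord.smooth).continuous.comp continuous_subtype_val).measurable
    have h3 : Measurable fun q : S3 => s q :=
      (H.smooth.continuous.comp continuous_subtype_val).measurable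
    exact h1.add (((h2.const_mul _).div (continuous_coord H.coord.smooth).measurable).smul h3)
  · have h1 (j : Fin 3) : dX j s q = 0 := H.dX_eq_zero (fun h => hq (H.support h)) j
    simp [slash, h1, H.eq_zero hq]

/-- Off the surfaces, a continuous branch of `z^{-a} s` is locally in `H¹`. -/
lemma exists_gaugeH1 (H : IsSingularAnsatz S k p V a z s) {v : L2}
    (hv : v =ᵐ[vol3] sing (-a) z s) {q : S3} (hq : q ∈ V) (hqS : q ∉ (S k).carrier) {U : Set S3}
    (hU : IsOpen U) (hqU : q ∈ U) :
    ∃ U', IsOpen U' ∧ q ∈ U' ∧ U' ⊆ U ∧ GaugeH1 U' (fun _ => 1) v (dSing (-a) z s) := by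
  refine exists_gaugeH1_sing (τ := 1) (κ := 1) H.coord.smooth H.smooth ?_ hU hqU
    (Eventually.of_forall fun p _ => by simp only [one_mul]) hv
  rw [one_mul, Complex.mem_slitPlane_iff]
  rw [H.coord.mem_iff q hq, not_and_or, not_le] at hqS
  exact hqS.symm

/-- Off the link, the spinor `z^{-a} s` is locally in `H¹` up to a gauge transformation. -/
lemma exists_gauge (hS : IsSeifertFamily S) (H : IsSingularAnsatz S k p V (α k) z s) {v : L2}
    (hv : v =ᵐ[vol3] sing (-α k) z s) {q : S3} (hq : q ∉ link S) :
    ∃ (U : Set S3) (e : Fin K → E4 → ℝ), IsOpen U ∧ q ∈ U ∧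
      Disjoint U (link S) ∧ (∀ k, IsLocalEquation (S k).carrier (S k).normal U (e k)) ∧
      GaugeH1 U (gauge α e) v (dSing (-α k) z s) := by
  have hlink : IsOpen (link S)ᶜ := hS.isClosed_link.isOpen_compl
  by_cases hqV : q ∈ V
  · by_cases hqS : q ∈ (S k).carrier
    -- at a point of `S_k` the gauge turns `z^{-a}` into the branch with its cut on the other side
    · have hz0 : z q ≠ 0 := fun h => hq (mem_iUnion.2 ⟨k, H.coord.mem_boundary q hqV h⟩)
      obtain ⟨h1, h2⟩ := (H.coord.mem_iff q hqV).1 hqS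
      have hre : (z q).re < 0 := h2.lt_of_ne fun h => hz0 (Complex.ext h h1)
      set e : Fin K → E4 → ℝ := fun l => if l = k then fun x => (z x).im else fun _ => -1 with he
      set U : Set S3 := {q | q ∈ V ∧ (z q).re < 0} ∩ (link S)ᶜ with hU
      have hUo : IsOpen U := (H.isOpen.inter (isOpen_lt
        (Complex.continuous_re.comp (continuous_coord H.coord.smooth)) continuous_const)).inter
        hlink
      have hloc (l : Fin K) : IsLocalEquation (S l).carrier (S l).normal U (e l) := by
        by_cases hl : l = k
        · subst hl
          simp only [he, if_true]
          exact H.coord.localEquation.mono inter_subset_left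
        · simp only [he, if_neg hl]
          exact isLocalEquation_const ((H.disjoint l hl).mono_left fun q hq => hq.1.1)
            (by norm_num)
      have hgauge (x : S3) : gauge α e x = phase (α k) (z x).im := by
        rw [gauge, Finset.prod_eq_single k]
        · simp [he]
        · intro l _ hl
          simp only [he, if_neg hl, phase]
          norm_num
        · simp
      have hnull := H.coord.localEquation.vol3_zeros
      have hu : ∀ᵐ x : S3 ∂vol3, x ∈ U → gauge α e x * z x ^ ((-α k : ℝ) : ℂ) =
          Complex.exp (Complex.I * Real.pi * α k) * (-1 * z x) ^ ((-α k : ℝ) : ℂ) := by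
        filter_upwards [measure_eq_zero_iff_ae_notMem.1 hnull] with x hx hxU
        rw [hgauge, phase_mul_cpow]
        exact fun h => hx ⟨hxU.1, h⟩
      obtain ⟨U', hU', hqU', hUU', hG⟩ := exists_gaugeH1_sing (τ := -1) H.coord.smooth H.smooth
        (by rw [Complex.mem_slitPlane_iff]; left; simpa using hre) hUo ⟨⟨hqV, hre⟩, hq⟩ hu hv
      exact ⟨U', e, hU', hqU', disjoint_left.2 fun x hx => (hUU' hx).2,
        fun l => (hloc l).mono hUU', hG⟩
    -- off `S_k` the principal branch of `z^{-a}` is smooth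
    · set U : Set S3 := V ∩ (S k).carrierᶜ ∩ (link S)ᶜ with hU
      have hUo : IsOpen U :=
        (H.isOpen.inter (S k).isCompact.isClosed.isOpen_compl).inter hlink
      obtain ⟨U', hU', hqU', hUU', hG⟩ := H.exists_gaugeH1 hv hqV hqS hUo ⟨⟨hqV, hqS⟩, hq⟩
      refine ⟨U', fun _ _ => -1, hU', hqU', disjoint_left.2 fun x hx => (hUU' hx).2,
        fun l => isLocalEquation_const ?_ (by norm_num), ?_⟩
      · by_cases hl : l = k
        · subst hl
          exact disjoint_left.2 fun x hx => (hUU' hx).1.2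
        · exact (H.disjoint l hl).mono_left fun x hx => (hUU' hx).1.1
      · have : gauge α (fun _ _ => (-1 : ℝ)) = fun _ => 1 := by
          funext x
          simp only [gauge, phase]
          norm_num
        rwa [this]
  · obtain ⟨U, e, hU, hqU, hUΓ, he⟩ := exists_localEquations hS hq
    set T : Set S3 := tsupport fun q : S3 => s q with hT
    refine ⟨U ∩ Tᶜ, e, hU.inter (isClosed_tsupport _).isOpen_compl,
      ⟨hqU, fun h => hqV (H.support h)⟩, hUΓ.mono_left inter_subset_left,
      fun l => (he l).mono inter_subset_left, 0, fun _ => 0,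
      fun j => (HasWeakDeriv.zero univ j).weakDeriv, ?_⟩
    filter_upwards [hv, Lp.coeFn_zero Spinor 2 vol3] with x h1 h2 hx
    have hsx : s x = 0 := image_eq_zero_of_notMem_tsupport (f := fun q : S3 => s q) hx.2
    refine ⟨?_, fun j => ?_⟩
    · rw [h1, h2, sing, hsx]
      simp
    · rw [h2, dSing, hsx, H.dX_eq_zero hx.2]
      simp

/-- The spinor `z^{-a} s` does not agree near `p` with a spinor in `H¹(Ω)²`, as its derivatives are
of the order `1/|z|` at least. -/
lemma notMem_sobolev (hS : IsSeifertFamily S) (H : IsSingularAnsatz S k p V a z s) (ha : 0 < a)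
    {v : L2} (hv : v =ᵐ[vol3] sing (-a) z s) {y : L2} (hy : y ∈ sobolev S) :
    ¬ ∀ᵐ q ∂vol3, q ∈ V → y q = v q := by
  intro hyv
  obtain ⟨g, hg⟩ := hy
  obtain ⟨j, hj⟩ := exists_dX_coord_ne_zero H.surjective
  obtain ⟨c₁, hc₁, N, hN, hpN, hlow⟩ :=
    exists_le_dSing (neg_lt_zero.2 ha) H.coord.smooth H.smooth H.coord_eq_zero H.ne_zero hj
  obtain ⟨C, hC⟩ := H.tube
  have hgv : ∀ᵐ q ∂vol3, q ∈ V ∩ complSurfaces S → g j q = dSing (-a) z s j q := by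
    set B : Set S3 := {q | q ∈ V ∩ complSurfaces S ∧ g j q ≠ dSing (-a) z s j q} with hB
    have h0 : vol3 B = 0 := by
      refine measure_null_of_locally_null _ fun q hq => ?_
      obtain ⟨⟨hqV, hqS⟩, -⟩ := hq
      have hqk : q ∉ (S k).carrier := fun h => hqS (mem_iUnion.2 ⟨k, h⟩)
      obtain ⟨U, hU, hqU, hUV, w, G, hw, hae⟩ := H.exists_gaugeH1 hv hqV hqk
        (H.isOpen.inter (complSurfaces_isOpen S)) ⟨hqV, hqS⟩
      refine ⟨B ∩ U, inter_mem self_mem_nhdsWithin (mem_nhdsWithin_of_mem_nhds (hU.mem_nhds hqU)),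
        ?_⟩
      have h1 := ((hg j).weakDeriv.mono (hUV.trans inter_subset_right)).ae_eq hU
        ((hw j).mono (subset_univ U)) (by
          filter_upwards [hae, hyv] with x hx hyx hxU
          rw [hyx (hUV hxU).1, (hx hxU).1, one_smul])
      rw [measure_eq_zero_iff_ae_notMem]
      filter_upwards [h1, hae] with x hx hx' hxB
      refine hxB.1.2 ?_
      rw [hx hxB.2, (hx' hxB.2).2 j, one_smul]
    filter_upwards [measure_eq_zero_iff_ae_notMem.1 h0] with q hq hqV
    by_contra hne
    exact hq ⟨hqV, hne⟩
  have hz0 : ∀ᵐ q : S3 ∂vol3, q ∈ V → z q ≠ 0 := by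
    filter_upwards [measure_eq_zero_iff_ae_notMem.1 (hS.knot k).hasSmallTubes.vol3_eq_zero]
      with q hq hqV h
    exact hq (H.coord.mem_boundary q hqV h)
  refine false_of_le_mul_norm H.coord.smooth H.coord_eq_zero H.surjective (H.isOpen.inter hN)
    ⟨H.mem, hpN⟩ (fun ρ hρ => (measure_mono
      (inter_subset_inter_left _ inter_subset_left)).trans (hC ρ hρ)) hc₁
    (g := g j) ?_
  filter_upwards [hgv, hz0, ae_mem_complSurfaces S] with q h1 h2 h3 hq
  rw [h1 ⟨hq.1, h3⟩]
  exact hlow q hq.2 (h2 hq.1)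

end IsSingularAnsatz

/-- Near each point of a knot which is not on the other surfaces there lives a spinor in the domain
of the adjoint which is not in `H¹(Ω)²`. -/
theorem exists_singular (hS : IsSeifertFamily S) (hK : 1 ≤ K) (hα : ∀ k, α k ∈ Ioo (0 : ℝ) 1)
    {k : Fin K} {p : S3} (hp : p ∈ (S k).boundary) (hother : ∀ l ≠ k, p ∉ (S l).carrier)
    {O : Set S3} (hO : IsOpen O) (hpO : p ∈ O) :
    ∃ v w : L2, (∀ᵐ q ∂vol3, q ∉ O → v q = 0) ∧
      (∀ ψ g, IsMinPair S α ψ g → inner ℂ (diracExpr ψ g) v = inner ℂ ψ w) ∧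
      ∀ y ∈ sobolev S, ¬ ∀ᵐ q ∂vol3, q ∈ O → y q = v q := by
  obtain ⟨V, hVO, z, s, H⟩ := exists_isSingularAnsatz hS hp hother hO hpO (α k)
  have hv := (H.memLp_sing (hα k)).coeFn_toLp
  refine ⟨(H.memLp_sing (hα k)).toLp _, _, ?_, fun ψ g hψ =>
    hψ.inner_diracExpr hS hK (H.memLp_slash (hα k)).coeFn_toLp
      fun q hq => H.exists_gauge hS hv hq, fun y hy h =>
    H.notMem_sobolev hS (hα k).1 hv hy (h.mono fun q hq hqV => hq (hVO hqV))⟩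
  filter_upwards [hv] with q h1 hq
  rw [h1, sing, H.eq_zero fun h => hq (hVO h), smul_zero]

/-! ### Points of a knot off the other surfaces -/

variable {K : ℕ} {S : Fin K → OrientedSurface} {α : Fin K → ℝ}

/-- A parametrization of a knot is open onto its image. -/
lemma exists_nhds_of_isKnot {γ : Set S3} {c : ℝ → E4} (hc : Continuous c)
    (hper : ∀ t, c (t + 1) = c t) (hinj : InjOn c (Ico 0 1)) (hrange : range c = Subtype.val '' γ)
    {t₀ δ : ℝ} (hδ : 0 < δ) :
    ∃ W : Set E4, IsOpen W ∧ c t₀ ∈ W ∧ ∀ x ∈ W, x ∈ Subtype.val '' γ → ∃ t, |t - t₀| < δ ∧ c t = x := by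
  have hP : Function.Periodic c 1 := hper
  have hfract (t : ℝ) : c (Int.fract t) = c t := by
    rw [Int.fract, show t - (⌊t⌋ : ℝ) = t - ⌊t⌋ • (1 : ℝ) by simp]
    exact hP.sub_zsmul_eq _
  set B : Set ℝ := Icc (t₀ - 1 / 2) (t₀ + 1 / 2) ∩ {t | δ ≤ |t - t₀|} with hB
  have hBc : IsCompact (c '' B) :=
    (isCompact_Icc.inter_right (isClosed_le continuous_const (by fun_prop))).image hc
  refine ⟨(c '' B)ᶜ, hBc.isClosed.isOpen_compl, ?_, fun x hxW hx => ?_⟩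
  · rintro ⟨t, ⟨ht, htδ⟩, heq⟩
    rw [← hfract t, ← hfract t₀] at heq
    have h1 := hinj ⟨Int.fract_nonneg t, Int.fract_lt_one t⟩
      ⟨Int.fract_nonneg t₀, Int.fract_lt_one t₀⟩ heq
    obtain ⟨n, hn⟩ := Int.fract_eq_fract.1 h1
    have htδ' : δ ≤ |t - t₀| := htδ
    have h2 : |(n : ℝ)| ≤ 1 / 2 := by
      rw [← hn, abs_le]
      constructor <;> linarith [ht.1, ht.2]
    have h3 : n = 0 := by
      by_contra h
      have : (1 : ℝ) ≤ |(n : ℝ)| := by exact_mod_cast Int.one_le_abs h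
      linarith
    rw [hn, h3, Int.cast_zero, abs_zero] at htδ'
    linarith
  · rw [← hrange] at hx
    obtain ⟨t, rfl⟩ := hx
    have he : c (t - round (t - t₀)) = c t := by
      rw [show t - (round (t - t₀) : ℝ) = t - round (t - t₀) • (1 : ℝ) by simp]
      exact hP.sub_zsmul_eq _
    refine ⟨t - round (t - t₀), ?_, he⟩
    by_contra! h
    refine hxW ⟨t - round (t - t₀), ⟨?_, h⟩, he⟩
    have h1 := abs_le.1 (abs_sub_round (t - t₀))
    constructor <;> linarith [h1.1, h1.2]

/-- A curve which is transverse to a surface at an interior point is not contained in the surface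
near that point. -/
lemma not_eventually_mem {T : OrientedSurface} {γ : Set S3} {p : S3}
    (hp : IsInteriorPoint T.carrier T.normal p) {v : E4} (hv : IsTangentTo γ p v)
    (hne : inner ℝ (T.normal p) v ≠ 0) : ¬ ∀ᶠ q in 𝓝 p, q ∈ γ → q ∈ T.carrier := by
  intro hev
  obtain ⟨hpT, U, h, hU, hpU, H⟩ := hp
  obtain ⟨c, hc, hcγ, hc0, hdc⟩ := hv
  have hder : HasDerivAt c v 0 := by
    rw [← hdc]
    exact (hc.differentiable (by simp)).differentiableAt.hasDerivAt
  have hnorm (t : ℝ) : c t ∈ Metric.sphere (0 : E4) 1 := by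
    obtain ⟨q, -, hq⟩ := hcγ t
    rw [← hq]
    exact q.2
  have htan : inner ℝ (p : E4) v = 0 := by
    have h1 := (hder.inner ℝ hder)
    have h2 : (fun t => inner ℝ (c t) (c t)) = fun _ => (1 : ℝ) := by
      funext t
      rw [real_inner_self_eq_norm_sq, mem_sphere_zero_iff_norm.1 (hnorm t), one_pow]
    rw [h2] at h1
    have h3 := h1.unique (hasDerivAt_const _ _)
    rw [hc0, real_inner_comm (p : E4) v] at h3
    linarith
  set c' : ℝ → S3 := fun t => ⟨c t, hnorm t⟩ with hc'
  have hc'c : Continuous c' := hc.continuous.subtype_mk _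
  have hc'0 : c' 0 = p := Subtype.ext hc0
  have hev2 : ∀ᶠ t in 𝓝 (0 : ℝ), h (c t) = 0 := by
    have h1 : Tendsto c' (𝓝 0) (𝓝 p) := by
      rw [← hc'0]
      exact hc'c.tendsto 0
    filter_upwards [h1.eventually hev, h1.eventually (hU.mem_nhds hpU)] with t ht htU
    obtain ⟨q, hq, hqt⟩ := hcγ t
    have : q = c' t := Subtype.ext hqt
    exact (H.mem_iff _ htU).1 (ht (this ▸ hq))
  have hcomp : HasDerivAt (fun t => h (c t)) (fderiv ℝ h p v) 0 := by
    have h1 : HasFDerivAt h (fderiv ℝ h p) (c 0) := by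
      rw [hc0]
      exact (H.smooth.differentiable (by simp)).differentiableAt.hasFDerivAt
    exact h1.comp_hasDerivAt 0 hder
  have hz : fderiv ℝ h p v = 0 :=
    hcomp.unique ((hasDerivAt_const (0 : ℝ) (0 : ℝ)).congr_of_eventuallyEq hev2)
  obtain ⟨κ, hκ, hgrad⟩ := H.gradient p hpU hpT
  rw [hgrad v htan] at hz
  exact (mul_ne_zero hκ.ne' hne) hz

/-- By transversality, each knot meets the other surfaces in a nowhere dense set only. -/
theorem infinite_boundary_diff (hS : IsSeifertFamily S) (k : Fin K) :
    {p | p ∈ (S k).boundary ∧ ∀ l ≠ k, p ∉ (S l).carrier}.Infinite := by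
  obtain ⟨c, hc, hper, hinj, -, hrange⟩ := hS.knot k
  have hmem (t : ℝ) : ∃ q : S3, q ∈ (S k).boundary ∧ (q : E4) = c t := by
    have : c t ∈ Subtype.val '' (S k).boundary := hrange ▸ mem_range_self t
    obtain ⟨q, hq, hqt⟩ := this
    exact ⟨q, hq, hqt⟩
  choose d hd hdc using hmem
  have hdcont : Continuous d := by
    rw [Topology.IsInducing.subtypeVal.continuous_iff]
    exact hc.continuous.congr fun t => (hdc t).symm
  have hopen (l : Fin K) : IsOpen {t | d t ∉ (S l).carrier} :=
    (S l).isCompact.isClosed.isOpen_compl.preimage hdcont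
  have hdense (l : Fin K) (hl : l ≠ k) : Dense {t | d t ∉ (S l).carrier} := by
    rw [dense_iff_inter_open]
    intro O hO ⟨t₀, ht₀⟩
    by_contra hempty
    have hall (t : ℝ) (ht : t ∈ O) : d t ∈ (S l).carrier := by
      by_contra h
      exact hempty ⟨t, ht, h⟩
    obtain ⟨δ, hδ, hball⟩ := Metric.isOpen_iff.1 hO t₀ ht₀
    obtain ⟨W, hW, hpW, hnear⟩ := exists_nhds_of_isKnot hc.continuous hper hinj hrange
      (t₀ := t₀) hδ
    have hint : IsInteriorPoint (S l).carrier (S l).normal (d t₀) := by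
      refine ((S l).local_form _ (hall t₀ ht₀)).resolve_right fun h => ?_
      exact disjoint_left.1 (hS.disjoint_boundary l k hl) h (hd t₀)
    obtain ⟨v, hv, hne⟩ := hS.transverse l k hl (d t₀) ⟨hall t₀ ht₀, hd t₀⟩
    refine not_eventually_mem hint hv hne ?_
    filter_upwards [(hW.preimage continuous_subtype_val).mem_nhds
      (show (d t₀ : E4) ∈ W by rwa [hdc])] with q hqW hq
    obtain ⟨t, ht, htq⟩ := hnear q hqW (mem_image_of_mem _ hq)
    have : d t = q := Subtype.ext ((hdc t).trans htq)
    rw [← this]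
    exact hall t (hball (by rwa [Metric.mem_ball, Real.dist_eq]))
  have hD : Dense (⋂ l : {l // l ≠ k}, {t | d t ∉ (S l).carrier}) :=
    dense_iInter_of_isOpen (fun l => hopen l) fun l => hdense l l.2
  have hO : IsOpen (Ioo (0 : ℝ) 1 ∩ ⋂ l : {l // l ≠ k}, {t | d t ∉ (S l).carrier}) :=
    isOpen_Ioo.inter (isOpen_iInter_of_finite fun l => hopen l)
  obtain ⟨t, ht⟩ := hD.inter_open_nonempty (Ioo (0 : ℝ) 1) isOpen_Ioo ⟨1 / 2, by norm_num⟩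
  refine ((infinite_of_mem_nhds t (hO.mem_nhds ht)).image (f := d) ?_).mono ?_
  · intro x hx y hy hxy
    refine hinj (Ioo_subset_Ico_self hx.1) (Ioo_subset_Ico_self hy.1) ?_
    rw [← hdc, ← hdc, hxy]
  · rintro _ ⟨x, hx, rfl⟩
    exact ⟨hd x, fun l hl => mem_iInter.1 hx.2 ⟨l, hl⟩⟩

/-! ### The domain of the adjoint -/

/-- Singular spinors with disjoint supports are linearly independent modulo `H¹(Ω)²`. -/
theorem exists_independent (hS : IsSeifertFamily S) (hK : 1 ≤ K)
    (hα : ∀ k, α k ∈ Ioo (0 : ℝ) 1) (m : ℕ) :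
    ∃ v : Fin m → (diracMin S α).adjoint.domain, ∀ c : Fin m → ℂ,
      ∑ i, c i • (v i : L2) ∈ sobolev S → c = 0 := by
  have hinf := infinite_boundary_diff hS ⟨0, hK⟩
  set P : Fin m → S3 := fun i => hinf.natEmbedding _ i with hP
  have hPinj : Function.Injective P := fun i j h =>
    Fin.ext ((hinf.natEmbedding _).injective (Subtype.ext h))
  obtain ⟨O, hO, hdisj⟩ := (finite_range P).t2_separation
  choose v w hv hvw hvs using fun i : Fin m => exists_singular hS hK hα (hinf.natEmbedding _ i).2.1
    (hinf.natEmbedding _ i).2.2 (hO (P i)).2 (hO (P i)).1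
  have hdom (i : Fin m) : v i ∈ (diracMin S α).adjoint.domain := by
    refine (adjoint_of_inner_eq (dense_domain S α) (w := w i) fun x => ?_).choose
    obtain ⟨g, hg, hx⟩ := exists_isMinPair x
    rw [hx, ← inner_conj_symm, ← hvw i x g hg, inner_conj_symm]
  refine ⟨fun i => ⟨v i, hdom i⟩, fun c hc => funext fun i => ?_⟩
  by_contra hci
  refine hvs i _ ((sobolev S).smul_mem (c i)⁻¹ hc) ?_
  filter_upwards [Lp.coeFn_smul (c i)⁻¹ (∑ j, c j • v j),
    Lp.coeFn_finsetSum Finset.univ fun j => c j • v j,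
    ae_all_iff.2 fun j => Lp.coeFn_smul (c j) (v j), ae_all_iff.2 hv] with q h1 h2 h3 h4 hq
  rw [h1, Pi.smul_apply, h2, Finset.sum_apply, Finset.sum_eq_single i]
  · rw [h3, Pi.smul_apply, smul_smul, inv_mul_cancel₀ hci, one_smul]
  · intro j _ hj
    rw [h3, Pi.smul_apply, h4 j, smul_zero]
    exact disjoint_left.1 (hdisj (mem_range_self i) (mem_range_self j)
      fun h => hj (hPinj h).symm) hq
  · simp

end MagneticLink

end

theorem proposition2p4 (K : ℕ) (hK : 1 ≤ K) (S : Fin K → MagneticLink.OrientedSurface)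
    (hS : MagneticLink.IsSeifertFamily S) (α : Fin K → ℝ) (hα : ∀ k, α k ∈ Set.Ioo (0 : ℝ) 1) :
    Dense ((MagneticLink.diracMin S α).domain : Set MagneticLink.L2) ∧
    MagneticLink.kerOp
        (MagneticLink.compOp (MagneticLink.diracMin S α) (MagneticLink.diracMin S α).adjoint) =
      MagneticLink.kerOp (MagneticLink.diracMin S α).adjoint ∧
    ¬ FiniteDimensional ℂ (MagneticLink.kerOp (MagneticLink.diracMin S α).adjoint) := by
  have hT := MagneticLink.dense_domain S α
  refine ⟨hT, MagneticLink.kerOp_compOp_adjoint hT,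
    MagneticLink.not_finiteDimensional_kerOp_adjoint (C := 2) hT
      (MagneticLink.isFormalAdjoint_self hS hK) (fun x => ?_)
      (MagneticLink.mem_sobolev_of_tendsto hS hK) (MagneticLink.exists_independent hS hK hα)⟩
  obtain ⟨g, hg, hx⟩ := MagneticLink.exists_isMinPair x
  rw [hx]
  exact (hg.norm_le hS hK).1
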